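/- Inclusion logic $\mathrm{FO}(\subseteq)$ over a finite vocabulary $\tau$ (relation and function symbols, equality) is given by $\varphi ::= t_1=t_2 \mid t_1\ne t_2 \mid R(\mathbf t)\mid \neg R(\mathbf t)\mid \mathbf t\subseteq\mathbf u\mid \varphi\wedge\varphi\mid\varphi\vee\varphi\mid\exists x\varphi\mid\forall x\varphi$, with (lax) team semantics: a team $T$ with domain $X$ in a structure $\mathcal A$ is a set of assignments $s\colon X\to A$; a first-order literal holds in $T$ iff it holds for every $s\in T$; $\mathcal A,T\models \mathbf t\subseteq\mathbf u$ iff for every $s_1\in T$ there is $s_2\in T$ with $\mathbf t^{\mathcal A}\langle s_1\rangle=\mathbf u^{\mathcal A}\langle s_2\rangle$; and $\mathcal A,T\models\varphi\wedge\psi$ iff $\mathcal A,T\models\varphi$ and $\mathcal A,T\models\psi$. For a fixed formula $\varphi$ with set of free variables $\mathrm{Fr}(\varphi)$, the parameterized problem $\text{p-WT}_\varphi$ asks, given a finite nonempty $\tau$-structure $\mathcal A$ and $k\in\mathbb N$, with parameter $k$, whether there is a team $T$ with domain $\mathrm{Fr}(\varphi)$ in $\mathcal A$ such that $|T|=k$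 and $\mathcal A,T\models\varphi$. For $t\ge 1$, $\mathrm W[t]$ is the class of parameterized problems that are fpt-reducible to $\text{p-WD}_\psi$ for some $\Pi_t$-sentence $\psi(S)$ of first-order logic over a finite relational vocabulary with one additional relation variable $S$, where $\text{p-WD}_\psi$ asks, given a finite nonempty structure $\mathcal A$ and the parameter $k$, whether there is a relation $S$ over $A$ with $|S|=k$ and $\mathcal A\models\psi(S)$. A problem is $\mathrm W[t]$-hard if every problem in $\mathrm W[t]$ is fpt-reducible to it. **Corollary.** For every quantifier-free $\mathrm{FO}(\subseteq)$-formula $\varphi$ without $\vee$, the problem $\text{p-WT}_\varphi$ is in $\mathrm W[2]$; and $\text{p-WT}_\varphi$ can be $\mathrm W[1]$-hard for such formulas, that is, there is a quantifier-free $\mathrm{FO}(\subseteq)$-formula $\varphi$ without $\vee$ (over some finite vocabulary) for which $\text{p-WT}_\varphi$ is $\mathrm W[1]$-hard. -/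

import Mathlib

open FirstOrder

/-! ### Vocabularies, finite structures and their encoding as words -/

/-- A finite vocabulary: the list of arities of its function symbols (arity `0` gives a constant)
and the list of arities of its relation symbols. Equality is always available. -/
structure Vocab where
  funs : List ℕ
  rels : List ℕ

/-- The first-order language of a vocabulary: an `n`-ary symbol is a position of the list
that carries the arity `n`. -/
def Vocab.lang (τ : Vocab) : FirstOrder.Language.{0, 0} where
  Functions n := {i : Fin τ.funs.length // τ.funs.get i = n}
  Relations n := {i : Fin τ.rels.length // τ.rels.get i = n}

/-- A vocabulary without function symbols. -/
def Vocab.IsRelational (τ : Vocab) : Prop := τ.funs = []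

/-- A finite `τ`-structure with the nonempty domain `{0, …, size - 1}`. -/
structure FinStruct (τ : Vocab) where
  size : ℕ
  size_pos : 0 < size
  str : τ.lang.Structure (Fin size)

/-- The domain of a finite structure. -/
abbrev FinStruct.Dom {τ : Vocab} (A : FinStruct τ) : Type := Fin A.size

instance {τ : Vocab} (A : FinStruct τ) : Nonempty A.Dom := ⟨⟨0, A.size_pos⟩⟩

instance {τ : Vocab} (A : FinStruct τ) : τ.lang.Structure A.Dom := A.str

open Classical in
/-- The characteristic bit string (adjacency matrix) of an `r`-ary relation on `Fin n`, of length
`n ^ r`; the tuples are listed in the order of the numbers that they represent in base `n`. -/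
noncomputable def encodeRel {n r : ℕ} (R : Set (Fin r → Fin n)) : List Bool :=
  (List.finRange (n ^ r)).map fun i => decide (finFunctionFinEquiv.symm i ∈ R)

/-- The standard encoding of a finite structure as a word over `{0, 1}`: the size of the domain in
unary, closed by a `0`, then the characteristic bit strings of the graphs of all functions,
then those of all relations. -/
noncomputable def FinStruct.encode {τ : Vocab} (A : FinStruct τ) : List Bool :=
  List.replicate A.size true ++ [false] ++
    (List.finRange τ.funs.length).flatMap (fun i =>
      encodeRel {v : Fin (τ.funs.get i + 1) → A.Dom |
        A.str.funMap (⟨i, rfl⟩ : τ.lang.Functions (τ.funs.get i)) (fun j => v j.castSucc)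
          = v (Fin.last _)}) ++
    (List.finRange τ.rels.length).flatMap (fun i =>
      encodeRel {v : Fin (τ.rels.get i) → A.Dom |
        A.str.RelMap (⟨i, rfl⟩ : τ.lang.Relations (τ.rels.get i)) v})

/-! ### Parameterized problems and fpt-reductions -/

/-- A parameterized problem over the alphabet `α`: a set of instances `(x, k)`. -/
abbrev ParamProblem (α : Type) : Type := Set (List α × ℕ)

/-- The word on the input or output tape that presents an instance `(x, k)`: the parameter in unary
(by `k` copies of the extra symbol `none`), followed by `x`. -/
def encodeInstance {α : Type} (p : List α × ℕ) : List (Option α) :=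
  List.replicate p.2 none ++ p.1.map some

/-- A function on instances is fpt-computable if some Turing machine computes it within
`f(k) · (|x| + 1) ^ c` steps for a computable function `f` and a constant `c`. -/
def FPTComputable {α β : Type} (r : List α × ℕ → List β × ℕ) : Prop :=
  ∃ (M : Turing.TM2ComputableAux (Option α) (Option β)) (f : ℕ → ℕ) (c : ℕ), Computable f ∧
    ∀ (x : List α) (k : ℕ),
      Nonempty (Turing.TM2OutputsInTime M.tm
        ((encodeInstance (x, k)).map M.inputAlphabet.symm)
        (some ((encodeInstance (r (x, k))).map M.outputAlphabet.symm))
        (f k * (x.length + 1) ^ c))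

/-- `P` is fpt-reducible to `Q`. -/
def FPTReducible {α β : Type} (P : ParamProblem α) (Q : ParamProblem β) : Prop :=
  ∃ r : List α × ℕ → List β × ℕ, FPTComputable r ∧
    (∀ p, p ∈ P ↔ r p ∈ Q) ∧
    ∃ g : ℕ → ℕ, Computable g ∧ ∀ (x : List α) (k : ℕ), (r (x, k)).2 ≤ g k

/-! ### Weighted Fagin definability and the W-hierarchy -/

mutual

/-- `IsSigmaForm t φ`: the formula `φ` is in the prefix class `Σ_t`. -/
inductive IsSigmaForm {L : FirstOrder.Language.{0, 0}} :
    ℕ → ∀ {n : ℕ}, L.BoundedFormula Empty n → Prop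
  | qf {n : ℕ} {φ : L.BoundedFormula Empty n} : φ.IsQF → IsSigmaForm 0 φ
  | of_pi {t n : ℕ} {φ : L.BoundedFormula Empty n} : IsPiForm t φ → IsSigmaForm (t + 1) φ
  | ex {t n : ℕ} {φ : L.BoundedFormula Empty (n + 1)} :
      IsSigmaForm (t + 1) φ → IsSigmaForm (t + 1) φ.ex

/-- `IsPiForm t φ`: the formula `φ` is in the prefix class `Π_t`. -/
inductive IsPiForm {L : FirstOrder.Language.{0, 0}} :
    ℕ → ∀ {n : ℕ}, L.BoundedFormula Empty n → Prop
  | qf {n : ℕ} {φ : L.BoundedFormula Empty n} : φ.IsQF → IsPiForm 0 φ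
  | of_sigma {t n : ℕ} {φ : L.BoundedFormula Empty n} : IsSigmaForm t φ → IsPiForm (t + 1) φ
  | all {t n : ℕ} {φ : L.BoundedFormula Empty (n + 1)} :
      IsPiForm (t + 1) φ → IsPiForm (t + 1) φ.all

end

/-- The language that consists of one relation variable of arity `s`. -/
def relVarLang (s : ℕ) : FirstOrder.Language.{0, 0} where
  Functions _ := Empty
  Relations n := PLift (s = n)

/-- The interpretation of the relation variable by the relation `S`. -/
abbrev relVarStructure {s : ℕ} {M : Type} (S : Set (Fin s → M)) : (relVarLang s).Structure M where
  funMap f := f.elim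
  RelMap R v := (fun i => v (Fin.cast R.down i)) ∈ S

/-- The expansion of the finite structure `A` by the relation `S`. -/
abbrev FinStruct.expand {τ : Vocab} (A : FinStruct τ) {s : ℕ} (S : Set (Fin s → A.Dom)) :
    (τ.lang.sum (relVarLang s)).Structure A.Dom :=
  letI := relVarStructure S
  FirstOrder.Language.sumStructure τ.lang (relVarLang s) A.Dom

/-- `A ⊨ ψ(S)`: the relation `S` is a solution for `ψ` in `A`. -/
def FinStruct.IsSolution {τ : Vocab} (A : FinStruct τ) {s : ℕ}
    (ψ : (τ.lang.sum (relVarLang s)).Sentence) (S : Set (Fin s → A.Dom)) : Prop :=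
  letI := A.expand S
  A.Dom ⊨ ψ

/-- The parameterized problem `p-WD_ψ`: given a finite `τ`-structure `A` and `k`, with parameter `k`,
is there a solution `S` for `ψ` in `A` of cardinality `k`? -/
def pWD {τ : Vocab} {s : ℕ} (ψ : (τ.lang.sum (relVarLang s)).Sentence) : ParamProblem Bool :=
  {p | ∃ A : FinStruct τ, p.1 = A.encode ∧
    ∃ S : Set (Fin s → A.Dom), S.encard = p.2 ∧ A.IsSolution ψ S}

/-- Membership in `W[t] = [p-WD-Π_t]^fpt`, the closure under fpt-reductions of the problems `p-WD_ψ`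
for `Π_t`-sentences `ψ` over relational vocabularies with one relation variable. -/
def InW (t : ℕ) {α : Type} (P : ParamProblem α) : Prop :=
  ∃ (τ : Vocab) (s : ℕ) (ψ : (τ.lang.sum (relVarLang s)).Sentence),
    τ.IsRelational ∧ IsPiForm t ψ ∧ FPTReducible P (pWD ψ)

/-- `Q` is `W[t]`-hard (under fpt-reductions). -/
def WHard (t : ℕ) {β : Type} (Q : ParamProblem β) : Prop :=
  ∀ (α : Type) [Finite α] (P : ParamProblem α), InW t P → FPTReducible P Q

/-! ### Inclusion logic with team semantics -/

/-- Formulas of inclusion logic `FO(⊆)`, in negation normal form, with variables in `ℕ`. -/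
inductive IncFormula (L : FirstOrder.Language.{0, 0}) : Type
  | eq (t u : L.Term ℕ)
  | neq (t u : L.Term ℕ)
  | rel {n : ℕ} (R : L.Relations n) (ts : Fin n → L.Term ℕ)
  | nrel {n : ℕ} (R : L.Relations n) (ts : Fin n → L.Term ℕ)
  | inc {n : ℕ} (ts us : Fin n → L.Term ℕ)
  | and (φ ψ : IncFormula L)
  | or (φ ψ : IncFormula L)
  | ex (x : ℕ) (φ : IncFormula L)
  | all (x : ℕ) (φ : IncFormula L)

namespace IncFormula

variable {L : FirstOrder.Language.{0, 0}}

/-- No quantifier occurs in the formula. -/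
def QuantifierFree : IncFormula L → Prop
  | and φ ψ => φ.QuantifierFree ∧ ψ.QuantifierFree
  | or φ ψ => φ.QuantifierFree ∧ ψ.QuantifierFree
  | ex _ _ => False
  | all _ _ => False
  | _ => True

/-- No disjunction occurs in the formula. -/
def DisjunctionFree : IncFormula L → Prop
  | and φ ψ => φ.DisjunctionFree ∧ ψ.DisjunctionFree
  | or _ _ => False
  | ex _ φ => φ.DisjunctionFree
  | all _ φ => φ.DisjunctionFree
  | _ => True

/-- The set `Fr(φ)` of free variables. -/
def freeVars : IncFormula L → Finset ℕ
  | eq t u => t.varFinset ∪ u.varFinset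
  | neq t u => t.varFinset ∪ u.varFinset
  | rel _ ts => Finset.univ.biUnion fun i => (ts i).varFinset
  | nrel _ ts => Finset.univ.biUnion fun i => (ts i).varFinset
  | inc ts us => (Finset.univ.biUnion fun i => (ts i).varFinset) ∪
      Finset.univ.biUnion fun i => (us i).varFinset
  | and φ ψ => φ.freeVars ∪ ψ.freeVars
  | or φ ψ => φ.freeVars ∪ ψ.freeVars
  | ex x φ => φ.freeVars.erase x
  | all x φ => φ.freeVars.erase x

end IncFormula

/-- An assignment with domain `X`. A team with domain `X` is a set of such assignments. -/
abbrev Assignment (X : Finset ℕ) (A : Type) : Type := {x : ℕ // x ∈ X} → A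

namespace Assignment

variable {A : Type} {X : Finset ℕ}

/-- The value of a term under an assignment. A variable outside the domain gets an arbitrary value;
this is immaterial, since terms are only evaluated when all their variables are in the domain. -/
noncomputable def val {L : FirstOrder.Language.{0, 0}} [L.Structure A] [Nonempty A]
    (s : Assignment X A) (t : L.Term ℕ) : A :=
  t.realize fun x => if h : x ∈ X then s ⟨x, h⟩ else Classical.arbitrary A

/-- The assignment with domain `X ∪ {x}` that maps `x` to `a` and agrees with `s` elsewhere. -/
def update (s : Assignment X A) (x : ℕ) (a : A) : Assignment (insert x X) A :=
  fun y => if h : y.1 = x then a else s ⟨y.1, Finset.mem_of_mem_insert_of_ne y.2 h⟩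

/-- The supplemented team `T[f/x]`. -/
def supplement (T : Set (Assignment X A)) (x : ℕ) (f : Assignment X A → Set A) :
    Set (Assignment (insert x X) A) :=
  {s' | ∃ s ∈ T, ∃ a ∈ f s, s' = s.update x a}

end Assignment

/-- (Lax) team semantics of inclusion logic: the team `T` with domain `X` satisfies the formula
in the structure `A`. It is meant for formulas whose free variables lie in `X`. -/
def IncFormula.Sat {L : FirstOrder.Language.{0, 0}} (A : Type) [L.Structure A] [Nonempty A] :
    IncFormula L → ∀ X : Finset ℕ, Set (Assignment X A) → Prop
  | .eq t u, _, T => ∀ s ∈ T, s.val t = s.val u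
  | .neq t u, _, T => ∀ s ∈ T, s.val t ≠ s.val u
  | .rel R ts, _, T => ∀ s ∈ T, FirstOrder.Language.Structure.RelMap R fun i => s.val (ts i)
  | .nrel R ts, _, T => ∀ s ∈ T, ¬ FirstOrder.Language.Structure.RelMap R fun i => s.val (ts i)
  | .inc ts us, _, T => ∀ s₁ ∈ T, ∃ s₂ ∈ T, ∀ i, s₁.val (ts i) = s₂.val (us i)
  | .and φ ψ, X, T => φ.Sat A X T ∧ ψ.Sat A X T
  | .or φ ψ, X, T => ∃ T₀ T₁, T₀ ∪ T₁ = T ∧ φ.Sat A X T₀ ∧ ψ.Sat A X T₁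
  | .ex x φ, X, T => ∃ f : Assignment X A → Set A, (∀ s ∈ T, (f s).Nonempty) ∧
      φ.Sat A (insert x X) (Assignment.supplement T x f)
  | .all x φ, X, T => φ.Sat A (insert x X) (Assignment.supplement T x fun _ => Set.univ)

/-- The parameterized problem `p-WT_φ`: given a finite `τ`-structure `A` and `k`, with parameter `k`,
is there a team `T` with domain `Fr(φ)` in `A` with `|T| = k` that satisfies `φ`? -/
def pWT {τ : Vocab} (φ : IncFormula τ.lang) : ParamProblem Bool :=
  {p | ∃ A : FinStruct τ, p.1 = A.encode ∧
    ∃ T : Set (Assignment φ.freeVars A.Dom), T.encard = p.2 ∧ φ.Sat A.Dom φ.freeVars T}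

-- Membership in `W[2]`. Without quantifiers and disjunctions, a formula is a conjunction of
-- literals and inclusions. Each of these says that for every assignment in the team there are
-- values of the terms involved, and for an inclusion a second assignment in the team, such that a
-- quantifier-free condition holds. With the team as the relation `S` and every function replaced by
-- its graph, this has the form `∀⋯∀∃⋯∃` (`IncFormula.allExDef_sat`), and so has the condition that
-- the graphs belong to functions. The encoding lists the graphs of the functions before the
-- relations, so a structure and its relational version are the same word, and the identity is the
-- reduction (`inW_pWT`).
--
-- Hardness for `W[1]`. The formula is `E(x, y) ∧ xy ⊆ yx ∧ x d(y) ⊆ x c(y)`, where `c` gives the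
-- colour of a vertex, one of `K`, and `d` the cyclically next colour. A nonempty team that
-- satisfies it is a symmetric set of edges in which every occurring vertex has neighbours of all
-- colours. If the team has only `K ^ 2` pairs, counting leaves no room for anything but a complete
-- graph, with loops, on one vertex of each colour (`exists_transversal`). So the team problem
-- expresses the search for a clique with one vertex of each colour.
--
-- Such cliques encode weighted definability by a `Π₁`-sentence `∀ y₁ ⋯ y_l α`. Let `m = l ^ s` be
-- the number of possible atoms of the relation variable, `X = n ^ l` the number of assignments, and
-- `w₀, …, w_(k-1)` the codes of the tuples in `S`. Membership of a code in `S` has indicator `∑ i,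
-- [code = w i]`, and non-membership has `1 - ∑ i, [code = w i]`. Multiplying out over the atoms
-- turns the number of violating assignments into a signed sum of `K = (2k+1) ^ m` terms, each of
-- which involves at most `m` of the `w i` (`sum_violCount`). A vertex has the index of a term as
-- its colour and stores the codes that the term needs together with a partial sum modulo `X + 1`.
-- Edges enforce that the stored codes agree and that cyclically consecutive partial sums differ by
-- the right term. Around the cycle the total must vanish modulo `X + 1`; as the number of
-- violations is at most `X`, it is zero (`exists_clique_iff`). There are `K (X + 1) n ^ (s m)`
-- vertices with `l`, `s`, `m` fixed, so this is an fpt-reduction.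
--
-- To run the reduction on a machine, it is enough that the length of the output and its symbol at
-- every position are given by arithmetic expressions with bounded sums. These are evaluated in
-- unary by stack programs in polynomial time (`UExpr.polyTime`), and such a program can be run
-- after any fpt-computable function (`FPTComputable.generate`).

/-! ### Structured stack programs and their execution by a stack machine -/

/-- The symbols on the stacks of a stack program. -/
abbrev TapeSym : Type := Option Bool

/-- Structured programs that act on stacks numbered by natural numbers. -/
inductive StackProg : Type
  | skip
  | push (i : ℕ) (a : TapeSym)
  | pop (i : ℕ)
  | mv (i j : ℕ)
  | seq (p q : StackProg)
  | ite (i : ℕ) (f : Option TapeSym → Bool) (p q : StackProg)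
  | loop (i : ℕ) (p : StackProg)

/-- The contents of all stacks. -/
abbrev Store : Type := ℕ → List TapeSym

namespace StackProg

open Function Turing

/-- The control points of a program. -/
def Label : StackProg → Type
  | skip => Unit
  | push _ _ => Unit
  | pop _ => Unit
  | mv _ _ => Unit
  | seq p q => p.Label ⊕ q.Label
  | ite _ _ p q => Option (p.Label ⊕ q.Label)
  | loop _ p => Option p.Label

/-- The entry point of a program. -/
def start : (p : StackProg) → p.Label
  | skip => ()
  | push _ _ => ()
  | pop _ => ()
  | mv _ _ => ()
  | seq p _ => Sum.inl p.start
  | ite _ _ _ _ => none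
  | loop _ _ => none

theorem finite_label : ∀ p : StackProg, Finite p.Label
  | skip => inferInstanceAs (Finite Unit)
  | push _ _ => inferInstanceAs (Finite Unit)
  | pop _ => inferInstanceAs (Finite Unit)
  | mv _ _ => inferInstanceAs (Finite Unit)
  | seq p q => by
      have := p.finite_label
      have := q.finite_label
      exact inferInstanceAs (Finite (p.Label ⊕ q.Label))
  | ite _ _ p q => by
      have := p.finite_label
      have := q.finite_label
      exact inferInstanceAs (Finite (Option (p.Label ⊕ q.Label)))
  | loop _ p => by
      have := p.finite_label
      exact inferInstanceAs (Finite (Option p.Label))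

/-- A strict upper bound on the numbers of the stacks that a program uses. -/
def width : StackProg → ℕ
  | skip => 0
  | push i _ => i + 1
  | pop i => i + 1
  | mv i j => max (i + 1) (j + 1)
  | seq p q => max p.width q.width
  | ite i _ p q => max (i + 1) (max p.width q.width)
  | loop i p => max (i + 1) p.width

/-- The effect of moving the top symbol of stack `i` to stack `j`. -/
def mvStore (i j : ℕ) (T : Store) : Store :=
  match T i with
  | [] => T
  | a :: l => update (update T i l) j (a :: update T i l j)

/-- `Exec p T T' t`: the program `p` transforms the store `T` into `T'` in `t` steps. -/
inductive Exec : StackProg → Store → Store → ℕ → Prop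
  | skip (T : Store) : Exec skip T T 1
  | push (i : ℕ) (a : TapeSym) (T : Store) : Exec (push i a) T (update T i (a :: T i)) 1
  | pop (i : ℕ) (T : Store) : Exec (pop i) T (update T i (T i).tail) 1
  | mv (i j : ℕ) (T : Store) : Exec (mv i j) T (mvStore i j T) 1
  | seq {p q : StackProg} {T T' T'' : Store} {t t' : ℕ} :
      Exec p T T' t → Exec q T' T'' t' → Exec (seq p q) T T'' (t + t')
  | ite_true {i : ℕ} {f : Option TapeSym → Bool} {p q : StackProg} {T T' : Store} {t : ℕ} :
      f (T i).head? = true → Exec p T T' t → Exec (ite i f p q) T T' (1 + t)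
  | ite_false {i : ℕ} {f : Option TapeSym → Bool} {p q : StackProg} {T T' : Store} {t : ℕ} :
      f (T i).head? = false → Exec q T T' t → Exec (ite i f p q) T T' (1 + t)
  | loop_done {i : ℕ} {p : StackProg} {T : Store} : T i = [] → Exec (loop i p) T T 1
  | loop_step {i : ℕ} {p : StackProg} {T T' T'' : Store} {t t' : ℕ} :
      T i ≠ [] → Exec p T T' t → Exec (loop i p) T' T'' t' → Exec (loop i p) T T'' (1 + (t + t'))

end StackProg

-- Exact step counts for stack machines.

namespace Turing.TM2

variable {K : Type} [DecidableEq K] {Γ : K → Type} {Λ σ : Type}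

/-- The machine passes from `c` to `c'` in exactly `t` steps. -/
def StepsTo (m : Λ → Stmt Γ Λ σ) (t : ℕ) (c c' : Cfg Γ Λ σ) : Prop :=
  (flip bind (step m))^[t] (some c) = some c'

theorem StepsTo.refl (m : Λ → Stmt Γ Λ σ) (c : Cfg Γ Λ σ) : StepsTo m 0 c c := rfl

theorem StepsTo.trans {m : Λ → Stmt Γ Λ σ} {t t' : ℕ} {c c' c'' : Cfg Γ Λ σ}
    (h : StepsTo m t c c') (h' : StepsTo m t' c' c'') : StepsTo m (t + t') c c'' := by
  unfold StepsTo at *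
  rw [add_comm, Function.iterate_add_apply, h, h']

theorem StepsTo.single {m : Λ → Stmt Γ Λ σ} {l : Λ} {v : σ} {S : ∀ k, List (Γ k)}
    {c' : Cfg Γ Λ σ} {q : Stmt Γ Λ σ} (hq : m l = q) (h : stepAux q v S = c') :
    StepsTo m 1 ⟨some l, v, S⟩ c' := by
  subst h hq; rfl

end Turing.TM2

namespace StackProg

open Function Turing

section Code

variable {K₁ : Type} {Γ₁ : K₁ → Type} {σ₁ : Type} {W : ℕ} {Λ : Type}

/-- The stack alphabets of a machine with the extra stacks of a stack program. -/
abbrev StackFam (Γ₁ : K₁ → Type) (W : ℕ) (k : K₁ ⊕ Fin W) : Type :=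
  Sum.rec Γ₁ (fun _ => TapeSym) k

/-- The joint contents of the stacks of a machine and of a stack program. -/
def joinStk (S : ∀ k, List (Γ₁ k)) (T : Fin W → List TapeSym) : ∀ k, List (StackFam Γ₁ W k)
  | .inl k => S k
  | .inr i => T i

variable [NeZero W]

/-- The first `W` stacks of a store. -/
def restrict (W : ℕ) (T : Store) : Fin W → List TapeSym := fun i => T i

/-- The machine statement at a control point of a program; `exit` is where the program leaves to. -/
def code : (p : StackProg) → (p.Label → Λ) → Λ → p.Label →
    TM2.Stmt (StackFam Γ₁ W) Λ (σ₁ × Option TapeSym)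
  | skip, _, exit, _ => .goto fun _ => exit
  | push i a, _, exit, _ => .push (.inr (Fin.ofNat W i)) (fun _ => a) (.goto fun _ => exit)
  | pop i, _, exit, _ => .pop (.inr (Fin.ofNat W i)) (fun v _ => v) (.goto fun _ => exit)
  | mv i j, _, exit, _ => .pop (.inr (Fin.ofNat W i)) (fun v x => (v.1, x))
      (.branch (fun v => v.2.isSome)
        (.push (.inr (Fin.ofNat W j)) (fun v => v.2.getD none)
          (.load (fun v => (v.1, none)) (.goto fun _ => exit)))
        (.goto fun _ => exit))
  | seq p q, emb, exit, l =>
      match l with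
      | .inl l => p.code (fun l => emb (.inl l)) (emb (.inr q.start)) l
      | .inr l => q.code (fun l => emb (.inr l)) exit l
  | ite i f p q, emb, exit, l =>
      match l with
      | none => .peek (.inr (Fin.ofNat W i)) (fun v x => (v.1, x))
          (.branch (fun v => f v.2)
            (.load (fun v => (v.1, none)) (.goto fun _ => emb (some (.inl p.start))))
            (.load (fun v => (v.1, none)) (.goto fun _ => emb (some (.inr q.start)))))
      | some (.inl l) => p.code (fun l => emb (some (.inl l))) exit l
      | some (.inr l) => q.code (fun l => emb (some (.inr l))) exit l
  | loop i p, emb, exit, l =>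
      match l with
      | none => .peek (.inr (Fin.ofNat W i)) (fun v x => (v.1, x))
          (.branch (fun v => v.2.isSome)
            (.load (fun v => (v.1, none)) (.goto fun _ => emb (some p.start)))
            (.load (fun v => (v.1, none)) (.goto fun _ => exit)))
      | some l => p.code (fun l => emb (some l)) (emb none) l

/-- The bound `i < W` ensures that the reduction modulo `W` in `Fin.ofNat` does not change the
number of the stack. -/
theorem joinStk_ofNat {S : ∀ k, List (Γ₁ k)} {T : Store} {i : ℕ} (hi : i < W) :
    joinStk S (restrict W T) (.inr (Fin.ofNat W i)) = T i := by
  simp [joinStk, restrict, Nat.mod_eq_of_lt hi]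

theorem update_joinStk [DecidableEq K₁] {S : ∀ k, List (Γ₁ k)} {T : Store} {i : ℕ} (hi : i < W) (l : List TapeSym) :
    update (joinStk S (restrict W T)) (.inr (Fin.ofNat W i)) l
      = joinStk S (restrict W (update T i l)) := by
  funext k
  rcases k with k | j
  · rw [update_of_ne (by simp)]; rfl
  · by_cases h : j = Fin.ofNat W i
    · subst h
      rw [update_self]
      simp [joinStk, restrict, Nat.mod_eq_of_lt hi]
    · rw [update_of_ne (by simpa using h)]
      have : (j : ℕ) ≠ i := fun h' => h (Fin.ext (by simp [h', Nat.mod_eq_of_lt hi]))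
      simp [joinStk, restrict, this]

/-- Each basic command and each test is one machine step, and the scratch component of the state is
`none` again at every control point. The exit is general in the induction because it varies with the
subprogram: in a sequence the first part leaves to the start of the second, and the body of a loop
leaves to the test. -/
theorem Exec.stepsTo [DecidableEq K₁] {p : StackProg} {T T' : Store} {t : ℕ} (h : Exec p T T' t)
    (hW : p.width ≤ W) (m : Λ → TM2.Stmt (StackFam Γ₁ W) Λ (σ₁ × Option TapeSym))
    (emb : p.Label → Λ) (exit : Λ) (hm : ∀ l, m (emb l) = p.code emb exit l)
    (v : σ₁) (S : ∀ k, List (Γ₁ k)) :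
    TM2.StepsTo m t ⟨some (emb p.start), (v, none), joinStk S (restrict W T)⟩
      ⟨some exit, (v, none), joinStk S (restrict W T')⟩ := by
  induction h generalizing exit with
  | skip T => exact .single (hm _) rfl
  | push i a T =>
    refine .single (hm _) ?_
    simp only [code, TM2.stepAux]
    rw [joinStk_ofNat hW, update_joinStk hW]
  | pop i T =>
    refine .single (hm _) ?_
    simp only [code, TM2.stepAux]
    rw [joinStk_ofNat hW, update_joinStk hW]
  | mv i j T =>
    have hi : i < W := lt_of_lt_of_le (Nat.lt_succ_self i) ((le_max_left _ _).trans hW)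
    have hj : j < W := lt_of_lt_of_le (Nat.lt_succ_self j) ((le_max_right _ _).trans hW)
    refine .single (hm _) ?_
    simp only [code, TM2.stepAux]
    rw [joinStk_ofNat hi, update_joinStk hi, joinStk_ofNat hj, update_joinStk hj]
    unfold mvStore
    cases hT : T i with
    | nil =>
      have : update T i [] = T := by rw [← hT]; exact update_eq_self _ _
      simp [this]
    | cons a l => simp
  | @seq p q T T' T'' t t' _ _ ih ih' =>
    have hW' := max_le_iff.1 hW
    exact (ih hW'.1 (fun l => emb (.inl l)) _ (fun l => hm (.inl l))).trans
      (ih' hW'.2 (fun l => emb (.inr l)) exit (fun l => hm (.inr l)))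
  | @ite_true i f p q T T' t hf _ ih =>
    have hi : i < W := lt_of_lt_of_le (Nat.lt_succ_self i) ((le_max_left _ _).trans hW)
    have hW' := max_le_iff.1 ((le_max_right _ _).trans hW)
    refine .trans (.single (hm _) ?_) (ih hW'.1 (fun l => emb (some (.inl l))) exit
      (fun l => hm (some (.inl l))))
    simp only [code, start, TM2.stepAux]
    rw [joinStk_ofNat hi, hf]
    rfl
  | @ite_false i f p q T T' t hf _ ih =>
    have hi : i < W := lt_of_lt_of_le (Nat.lt_succ_self i) ((le_max_left _ _).trans hW)
    have hW' := max_le_iff.1 ((le_max_right _ _).trans hW)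
    refine .trans (.single (hm _) ?_) (ih hW'.2 (fun l => emb (some (.inr l))) exit
      (fun l => hm (some (.inr l))))
    simp only [code, start, TM2.stepAux]
    rw [joinStk_ofNat hi, hf]
    rfl
  | @loop_done i p T hT =>
    have hi : i < W := lt_of_lt_of_le (Nat.lt_succ_self i) ((le_max_left _ _).trans hW)
    refine .single (hm _) ?_
    simp only [code, start, TM2.stepAux]
    rw [joinStk_ofNat hi, hT]
    rfl
  | @loop_step i p T T' T'' t t' hT _ _ ih ih' =>
    have hi : i < W := lt_of_lt_of_le (Nat.lt_succ_self i) ((le_max_left _ _).trans hW)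
    have hW' := (le_max_right _ _).trans hW
    refine .trans (.single (hm _) ?_) (.trans (ih hW' (fun l => emb (some l)) (emb none)
      (fun l => hm (some l))) (ih' hW emb exit hm))
    simp only [code, start, TM2.stepAux]
    rw [joinStk_ofNat hi]
    cases h : T i with
    | nil => exact absurd h hT
    | cons a l => rfl

end Code

end StackProg

/-! ### Bounded arithmetic expressions and their evaluation in polynomial time -/

/-- Arithmetic expressions over natural numbers, with bounded sums and with access to the bits of
a word; variables are de Bruijn indices. -/
inductive UExpr : Type
  | var (i : ℕ)
  | const (c : ℕ)
  | add (a b : UExpr)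
  | monus (a b : UExpr)
  | sum (a b : UExpr)
  | bit (a : UExpr)

/-- The number `n` in unary. -/
abbrev unary (n : ℕ) : List TapeSym := List.replicate n none

namespace UExpr

open Function StackProg

/-- The value of an expression. -/
def eval (w : List Bool) : UExpr → List ℕ → ℕ
  | var i, v => v.getD i 0
  | const c, _ => c
  | add a b, v => a.eval w v + b.eval w v
  | monus a b, v => a.eval w v - b.eval w v
  | sum a b, v => ∑ i ∈ Finset.range (a.eval w v), b.eval w (i :: v)
  | bit a, v => if w.getD (a.eval w v) false then 1 else 0

/-- A program that computes the value of an expression on stack `r`, when the word is on stack `0`,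
the variables are on the stacks `ρ`, and all stacks from `r` on are empty. -/
def compile : UExpr → List ℕ → ℕ → StackProg
  | var i, ρ, r => match ρ[i]? with
    | some s => seq (loop s (seq (mv s r) (push (r + 1) none))) (loop (r + 1) (mv (r + 1) s))
    | none => skip
  | const c, _, r => Nat.rec skip (fun _ p => seq p (push r none)) c
  | add a b, ρ, r => seq (a.compile ρ r) (seq (b.compile ρ (r + 1)) (loop (r + 1) (mv (r + 1) r)))
  | monus a b, ρ, r => seq (a.compile ρ r)
      (seq (b.compile ρ (r + 1)) (loop (r + 1) (seq (pop (r + 1)) (pop r))))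
  | sum a b, ρ, r => seq (a.compile ρ (r + 1))
      (seq (loop (r + 1) (seq (pop (r + 1)) (seq (b.compile ((r + 2) :: ρ) (r + 3))
          (seq (loop (r + 3) (mv (r + 3) r)) (push (r + 2) none)))))
        (loop (r + 2) (pop (r + 2))))
  | bit a, ρ, r => seq (a.compile ρ r) (seq (loop r (seq (pop r) (mv 0 (r + 1))))
      (seq (ite 0 (fun x => decide (x = some (some true))) (push r none) skip)
        (loop (r + 1) (mv (r + 1) 0))))

end UExpr

-- Step counts of the elementary loops.

namespace StackProg

open Function

theorem Exec.cast {p : StackProg} {T T' T'' : Store} {t t' : ℕ} (h : Exec p T T' t)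
    (hT : T' = T'') (ht : t = t') : Exec p T T'' t' := by
  subst hT ht; exact h

theorem mvStore_cons {i j : ℕ} (hij : i ≠ j) {T : Store} {a : TapeSym} {l : List TapeSym}
    (h : T i = a :: l) : mvStore i j T = update (update T i l) j (a :: T j) := by
  simp [mvStore, h, hij.symm]

theorem exec_move {i j : ℕ} (hij : i ≠ j) (l : List TapeSym) (T : Store) (h : T i = l) :
    Exec (loop i (mv i j)) T (update (update T i []) j (l.reverse ++ T j)) (2 * l.length + 1) := by
  induction l generalizing T with
  | nil =>
    refine (Exec.loop_done h).cast ?_ rfl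
    simp only [List.reverse_nil, List.nil_append]
    rw [← h, update_eq_self, update_eq_self]
  | cons a l ih =>
    refine (Exec.loop_step (by simp [h]) (Exec.mv i j T) (ih _ ?_)).cast ?_ ?_
    · simp [mvStore_cons hij h, hij]
    · rw [mvStore_cons hij h]
      funext k
      simp only [update_apply]
      split_ifs <;> simp_all
    · simp; ring

theorem exec_clear {i : ℕ} (l : List TapeSym) (T : Store) (h : T i = l) :
    Exec (loop i (pop i)) T (update T i []) (2 * l.length + 1) := by
  induction l generalizing T with
  | nil => exact (Exec.loop_done h).cast (by rw [← h, update_eq_self]) rfl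
  | cons a l ih =>
    refine (Exec.loop_step (by simp [h]) (Exec.pop i T) (ih _ ?_)).cast ?_ ?_
    · simp [h]
    · simp
    · simp; ring

/-- Moving empties the source, so a second copy is produced on `k` from which the source can be
restored. The targets start with a common content `m` to make the induction go through. -/
theorem exec_copy {i j k : ℕ} (hij : i ≠ j) (hik : i ≠ k) (hjk : j ≠ k) (n m : ℕ) (T : Store)
    (hi : T i = unary n) (hj : T j = unary m) (hk : T k = unary m) :
    Exec (loop i (seq (mv i j) (push k none))) T
      (update (update (update T i []) j (unary (n + m))) k (unary (n + m))) (3 * n + 1) := by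
  induction n generalizing T m with
  | zero =>
    refine (Exec.loop_done hi).cast ?_ rfl
    simp only [zero_add, ← hj]
    funext x
    simp only [update_apply]
    split_ifs <;> simp_all
  | succ n ih =>
    have h1 : mvStore i j T = update (update T i (unary n)) j (unary (m + 1)) := by
      rw [mvStore_cons hij (a := none) (l := unary n) (by rw [hi]; rfl), hj]; rfl
    refine (Exec.loop_step (by simp [hi]) ((Exec.mv i j T).seq (Exec.push k none _))
      (ih (m + 1) _ ?_ ?_ ?_)).cast ?_ ?_
    · simp [h1, hij, hik, update_apply]
    · simp [h1, hjk, update_apply]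
    · simp [h1, hik.symm, hjk.symm, hk, List.replicate_succ]
    · rw [h1, show n + (m + 1) = n + 1 + m by ring]
      funext x
      simp only [update_apply]
      split_ifs <;> simp_all
    · ring

/-- Popping an empty stack does nothing, exactly as subtraction on `ℕ` stops at `0`. -/
theorem exec_monus {i j : ℕ} (hij : i ≠ j) (n m : ℕ) (T : Store)
    (hi : T i = unary n) (hj : T j = unary m) :
    Exec (loop j (seq (pop j) (pop i))) T
      (update (update T j []) i (unary (n - m))) (3 * m + 1) := by
  induction m generalizing T n with
  | zero =>
    refine (Exec.loop_done hj).cast ?_ rfl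
    funext x
    simp only [update_apply]
    split_ifs <;> simp_all
  | succ m ih =>
    refine (Exec.loop_step (by simp [hj]) ((Exec.pop j T).seq (Exec.pop i _))
      (ih (n - 1) _ ?_ ?_)).cast ?_ ?_
    · simp [hij, hi]
    · simp [hij.symm, hj]
    · rw [show n - 1 - m = n - (m + 1) by omega]
      funext x
      simp only [update_apply]
      split_ifs <;> simp_all
    · ring

/-- Moving from an empty stack does nothing, so positions beyond the end of the word need no
separate treatment. -/
theorem exec_scan {i k : ℕ} (hik : i ≠ k) (hi0 : i ≠ 0) (hk0 : k ≠ 0) (n : ℕ) (T : Store)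
    (hi : T i = unary n) :
    Exec (loop i (seq (pop i) (mv 0 k))) T
      (update (update (update T i []) 0 ((T 0).drop n)) k (((T 0).take n).reverse ++ T k))
      (3 * n + 1) := by
  induction n generalizing T with
  | zero =>
    refine (Exec.loop_done hi).cast ?_ rfl
    funext x
    simp only [update_apply]
    split_ifs <;> simp_all
  | succ n ih =>
    refine (Exec.loop_step (by simp [hi]) ((Exec.pop i T).seq (Exec.mv 0 k _))
      (ih _ ?_)).cast ?_ ?_
    · have : update T i (T i).tail i = unary n := by simp [hi]
      generalize update T i (T i).tail = T' at this ⊢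
      cases h0 : T' 0 with
      | nil => simpa [mvStore, h0] using this
      | cons a l => simp [mvStore, h0, hik, hi0, this]
    · cases h0 : T 0 with
      | nil =>
        have : mvStore 0 k (update T i (T i).tail) = update T i (T i).tail := by
          simp [mvStore, hi0.symm, h0]
        rw [this]
        funext x
        simp only [update_apply]
        split_ifs <;> simp_all
      | cons a l =>
        rw [mvStore_cons (a := a) (l := l) hk0.symm (by simp [hi0.symm, h0])]
        funext x
        simp only [update_apply]
        split_ifs <;> simp_all
    · ring

end StackProg

namespace UExpr

open Function StackProg

/-- The index of a sum is below the value of its upper limit, so the body is evaluated with a power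
of `X` as the new bound, and polynomial bounds compose. The assumption `2 ≤ X` bounds a constant `c`
by `2 ^ c ≤ X ^ c`. -/
theorem eval_le_pow (e : UExpr) : ∃ c, ∀ X, 2 ≤ X → ∀ (w : List Bool) (v : List ℕ),
    (∀ n ∈ v, n ≤ X) → e.eval w v ≤ X ^ c := by
  induction e with
  | var i =>
    refine ⟨1, fun X hX w v hv => ?_⟩
    simp only [eval, pow_one, List.getD_eq_getElem?_getD]
    cases h : v[i]? with
    | none => simp
    | some n => exact hv n (List.mem_of_getElem? h)
  | const c =>
    exact ⟨c, fun X hX w v hv => (Nat.lt_two_pow_self.le).trans (Nat.pow_le_pow_left hX c)⟩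
  | add a b iha ihb =>
    obtain ⟨ca, ha⟩ := iha
    obtain ⟨cb, hb⟩ := ihb
    refine ⟨max ca cb + 1, fun X hX w v hv => ?_⟩
    have h1 := (ha X hX w v hv).trans (Nat.pow_le_pow_right (by omega) (le_max_left ca cb))
    have h2 := (hb X hX w v hv).trans (Nat.pow_le_pow_right (by omega) (le_max_right ca cb))
    simp only [eval, pow_succ]
    nlinarith
  | monus a b iha ihb =>
    obtain ⟨ca, ha⟩ := iha
    exact ⟨ca, fun X hX w v hv => (Nat.sub_le _ _).trans (ha X hX w v hv)⟩
  | sum a b iha ihb =>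
    obtain ⟨ca, ha⟩ := iha
    obtain ⟨cb, hb⟩ := ihb
    refine ⟨ca + (ca + 1) * cb, fun X hX w v hv => ?_⟩
    have hX1 : X ^ ca ≤ X ^ (ca + 1) := Nat.pow_le_pow_right (by omega) (by omega)
    have hX2 : X ≤ X ^ (ca + 1) := Nat.le_self_pow (by omega) X
    calc eval w (sum a b) v ≤ ∑ i ∈ Finset.range (a.eval w v), (X ^ (ca + 1)) ^ cb := by
          refine Finset.sum_le_sum fun i hi => hb _ (hX.trans hX2) _ _ ?_
          intro n hn
          rcases List.mem_cons.1 hn with rfl | hn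
          · exact (Finset.mem_range.1 hi).le.trans ((ha X hX w v hv).trans hX1)
          · exact (hv n hn).trans hX2
      _ = a.eval w v * (X ^ (ca + 1)) ^ cb := by simp
      _ ≤ X ^ ca * (X ^ (ca + 1)) ^ cb := Nat.mul_le_mul_right _ (ha X hX w v hv)
      _ = X ^ (ca + (ca + 1) * cb) := by rw [← pow_mul, ← pow_add]
  | bit a _ =>
    refine ⟨0, fun X hX w v hv => ?_⟩
    simp only [eval, pow_zero]
    split_ifs <;> simp

/-- The store `T` presents the word `w` and the values `v` of the variables on the stacks `ρ`,
and its stacks from `r` on are empty. -/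
structure Presents (T : Store) (w : List Bool) (ρ v : List ℕ) (r : ℕ) : Prop where
  pos : 0 < r
  word : T 0 = w.map some
  vars : List.Forall₂ (fun s n => T s = unary n ∧ 0 < s ∧ s < r) ρ v
  empty : ∀ j, r ≤ j → T j = []

theorem Presents.of_agree {T T' : Store} {w : List Bool} {ρ v : List ℕ} {r r' : ℕ}
    (h : Presents T w ρ v r) (hr : r ≤ r') (hT : ∀ j, j < r → T' j = T j)
    (h' : ∀ j, r' ≤ j → T' j = []) : Presents T' w ρ v r' where
  pos := h.pos.trans_le hr
  word := (hT 0 h.pos).trans h.word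
  vars := h.vars.imp fun s _ ⟨h1, h2, h3⟩ => ⟨(hT s h3).trans h1, h2, h3.trans_le hr⟩
  empty := h'

/-- A store with three unary registers at the stacks `r`, `r + 1` and `r + 2`. -/
def setThree (T : Store) (r a n i : ℕ) : Store :=
  update (update (update T r (unary a)) (r + 1) (unary n)) (r + 2) (unary i)

/-- Stack `r` accumulates the sum, `r + 1` counts the remaining rounds, `r + 2` holds the current
index, and the body leaves its value on `r + 3`. A round takes at most `B` steps for the body, `2 *
B + 1` for moving its value to `r`, and three more for the test, the pop and the push. -/
theorem exec_sum_loop {p : StackProg} {r B : ℕ} {f : ℕ → ℕ} {T : Store} {N : ℕ}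
    (hT : ∀ j, r ≤ j → T j = [])
    (hp : ∀ i < N, ∀ T', (∀ j, j < r → T' j = T j) → T' (r + 2) = unary i →
      (∀ j, r + 3 ≤ j → T' j = []) →
      f i ≤ B ∧ ∃ t ≤ B, Exec p T' (update T' (r + 3) (unary (f i))) t)
    (n i a : ℕ) (hi : i + n = N) :
    ∃ t ≤ n * (4 + 3 * B) + 1,
      Exec (loop (r + 1) (seq (pop (r + 1)) (seq p
          (seq (loop (r + 3) (mv (r + 3) r)) (push (r + 2) none)))))
        (setThree T r a n i)
        (setThree T r (a + ∑ j ∈ Finset.range n, f (i + j)) 0 (i + n)) t := by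
  induction n generalizing i a with
  | zero => exact ⟨1, by simp, (Exec.loop_done (by simp [setThree])).cast (by simp) rfl⟩
  | succ n ih =>
    have hpop : Exec (pop (r + 1)) (setThree T r a (n + 1) i) (setThree T r a n i) 1 := by
      refine (Exec.pop _ _).cast ?_ rfl
      funext x
      simp only [setThree, update_apply]
      split_ifs <;> simp_all
    obtain ⟨hB, t1, ht1, h1⟩ := hp i (by omega) (setThree T r a n i)
      (fun j hj => by simp [setThree, show j ≠ r by omega, show j ≠ r + 1 by omega,
        show j ≠ r + 2 by omega]) (by simp [setThree])
      (fun j hj => by simp [setThree, show j ≠ r by omega,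
        show j ≠ r + 1 by omega, show j ≠ r + 2 by omega, hT j (by omega)])
    have h3 := exec_move (show r + 3 ≠ r by omega) (unary (f i)) _ (update_self (r + 3)
      (unary (f i)) (setThree T r a n i))
    have h4 : Exec (push (r + 2) none) (update (update (update (setThree T r a n i) (r + 3)
        (unary (f i))) (r + 3) []) r ((unary (f i)).reverse ++
          update (setThree T r a n i) (r + 3) (unary (f i)) r))
        (setThree T r (a + f i) n (i + 1)) 1 := by
      refine (Exec.push _ _ _).cast ?_ rfl
      funext x
      have h5 := hT (r + 3) (by omega)
      simp only [setThree, update_apply, List.reverse_replicate]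
      split_ifs <;> first | omega | (subst_vars; simp [h5, List.replicate_succ, add_comm])
    obtain ⟨t2, ht2, h2⟩ := ih (i + 1) (a + f i) (by omega)
    refine ⟨_, ?_, (Exec.loop_step (by simp [setThree, List.replicate_succ])
      (hpop.seq (h1.seq (h3.seq h4))) h2).cast ?_ rfl⟩
    · simp only [List.length_replicate]
      nlinarith
    · congr 1
      · rw [Finset.sum_range_succ']
        have hs : ∀ k, f (i + (k + 1)) = f (i + 1 + k) := fun k => congrArg f (by ring)
        simp only [add_zero, hs]
        ring
      · ring

/-- The expression `e` is evaluated by its program in time polynomial in the length of the word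
and the values of the variables. -/
def PolyTime (e : UExpr) : Prop :=
  ∃ c, ∀ X, 2 ≤ X → ∀ (w : List Bool) (v ρ : List ℕ) (r : ℕ)
    (T : Store), w.length ≤ X → (∀ n ∈ v, n ≤ X) → Presents T w ρ v r →
    ∃ t ≤ X ^ c, Exec (e.compile ρ r) T (update T r (unary (e.eval w v))) t

/-- The value is copied to `r` and `r + 1`, and the second copy is moved back. This takes at most `5
* X + 2 ≤ 8 * X ≤ X ^ 4` steps. -/
theorem polyTime_var (i : ℕ) : (var i).PolyTime := by
  refine ⟨4, fun X hX w v ρ r T hw hv hP => ?_⟩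
  have hX4 : X ^ 4 = X ^ 3 * X := pow_succ X 3
  have hX3 : 2 ^ 3 ≤ X ^ 3 := Nat.pow_le_pow_left hX 3
  cases hs : ρ[i]? with
  | none =>
    have hv0 : v[i]? = none := by
      rw [List.getElem?_eq_none_iff] at hs ⊢
      rw [← hP.vars.length_eq]; exact hs
    simp only [compile, hs, eval, List.getD_eq_getElem?_getD, hv0]
    refine ⟨1, by nlinarith, (Exec.skip T).cast ?_ rfl⟩
    simp only [Option.getD_none, List.replicate_zero]
    rw [← hP.empty r le_rfl, update_eq_self]
  | some s =>
    have hi : i < ρ.length := (List.getElem?_eq_some_iff.1 hs).1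
    have hi' : i < v.length := hP.vars.length_eq ▸ hi
    have hsρ : ρ[i] = s := (List.getElem?_eq_some_iff.1 hs).2
    have hall := (List.forall₂_iff_get.1 hP.vars).2 i hi hi'
    simp only [List.get_eq_getElem, hsρ] at hall
    obtain ⟨h1, h2, h3⟩ := hall
    have hle : v[i] ≤ X := hv _ (List.getElem_mem hi')
    simp only [compile, hs, eval, List.getD_eq_getElem?_getD, List.getElem?_eq_getElem hi',
      Option.getD_some]
    have hc := exec_copy (show s ≠ r by omega) (show s ≠ r + 1 by omega)
      (show r ≠ r + 1 by omega) v[i] 0 T h1 (hP.empty r le_rfl) (hP.empty _ (by omega))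
    refine ⟨_, ?_, (hc.seq (exec_move (show r + 1 ≠ s by omega) (unary (v[i] + 0)) _
      (update_self _ _ _))).cast ?_ rfl⟩
    · simp only [List.length_replicate]
      nlinarith
    · have h4 := hP.empty (r + 1) (by omega)
      funext x
      simp only [update_apply, List.reverse_replicate]
      split_ifs <;> simp_all

theorem polyTime_const (c : ℕ) : (const c).PolyTime := by
  refine ⟨c + 1, fun X hX w v ρ r T hw hv hP => ?_⟩
  have key : ∀ c, Exec ((const c).compile ρ r) T (update T r (unary c)) (c + 1) := by
    intro c
    induction c with
    | zero =>
      refine (Exec.skip T).cast ?_ rfl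
      rw [show unary 0 = T r from (hP.empty r le_rfl).symm, update_eq_self]
    | succ c ih => exact (ih.seq (Exec.push r none _)).cast (by simp [List.replicate_succ]) rfl
  exact ⟨_, (Nat.lt_two_pow_self.le).trans (Nat.pow_le_pow_left hX _), key c⟩

theorem polyTime_add {a b : UExpr} (iha : a.PolyTime) (ihb : b.PolyTime) : (add a b).PolyTime := by
  obtain ⟨ca, ha⟩ := iha
  obtain ⟨cb, hb⟩ := ihb
  obtain ⟨cb', hb'⟩ := b.eval_le_pow
  refine ⟨ca + cb + cb' + 3, fun X hX w v ρ r T hw hv hP => ?_⟩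
  obtain ⟨t1, ht1, h1⟩ := ha X hX w v ρ r T hw hv hP
  obtain ⟨t2, ht2, h2⟩ := hb X hX w v ρ (r + 1) (update T r (unary (a.eval w v))) hw hv
    (hP.of_agree (by omega) (fun j hj => by simp [show j ≠ r by omega])
      (fun j hj => by simp [show j ≠ r by omega, hP.empty j (by omega)]))
  have h3 := exec_move (show r + 1 ≠ r by omega) (unary (b.eval w v)) _ (update_self (r + 1)
    (unary (b.eval w v)) (update T r (unary (a.eval w v))))
  refine ⟨_, ?_, (h1.seq (h2.seq h3)).cast ?_ rfl⟩
  · have h4 := hb' X hX w v hv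
    have hA : 1 ≤ X ^ ca := Nat.one_le_pow _ _ (by omega)
    have hB : 1 ≤ X ^ cb := Nat.one_le_pow _ _ (by omega)
    have hC : 1 ≤ X ^ cb' := Nat.one_le_pow _ _ (by omega)
    have hX3 : 2 ^ 3 ≤ X ^ 3 := Nat.pow_le_pow_left hX 3
    simp only [List.length_replicate, pow_add]
    have e1 : X ^ ca ≤ X ^ ca * X ^ cb * X ^ cb' := by
      rw [mul_assoc]; exact Nat.le_mul_of_pos_right _ (by positivity)
    have e2 : X ^ cb ≤ X ^ ca * X ^ cb * X ^ cb' := by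
      rw [mul_comm (X ^ ca), mul_assoc]; exact Nat.le_mul_of_pos_right _ (by positivity)
    have e3 : X ^ cb' ≤ X ^ ca * X ^ cb * X ^ cb' := Nat.le_mul_of_pos_left _ (by positivity)
    nlinarith
  · have h5 := hP.empty (r + 1) (by omega)
    funext x
    simp only [update_apply, List.reverse_replicate, eval]
    split_ifs <;> first | omega | (subst_vars; simp [h5, add_comm])

theorem polyTime_monus {a b : UExpr} (iha : a.PolyTime) (ihb : b.PolyTime) : (monus a b).PolyTime := by
  obtain ⟨ca, ha⟩ := iha
  obtain ⟨cb, hb⟩ := ihb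
  obtain ⟨cb', hb'⟩ := b.eval_le_pow
  refine ⟨ca + cb + cb' + 3, fun X hX w v ρ r T hw hv hP => ?_⟩
  obtain ⟨t1, ht1, h1⟩ := ha X hX w v ρ r T hw hv hP
  obtain ⟨t2, ht2, h2⟩ := hb X hX w v ρ (r + 1) (update T r (unary (a.eval w v))) hw hv
    (hP.of_agree (by omega) (fun j hj => by simp [show j ≠ r by omega])
      (fun j hj => by simp [show j ≠ r by omega, hP.empty j (by omega)]))
  have h3 := exec_monus (show r ≠ r + 1 by omega) (a.eval w v) (b.eval w v)
    (update (update T r (unary (a.eval w v))) (r + 1) (unary (b.eval w v)))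
    (by simp) (by simp)
  refine ⟨_, ?_, (h1.seq (h2.seq h3)).cast ?_ rfl⟩
  · have h4 := hb' X hX w v hv
    have hA : 1 ≤ X ^ ca := Nat.one_le_pow _ _ (by omega)
    have hB : 1 ≤ X ^ cb := Nat.one_le_pow _ _ (by omega)
    have hC : 1 ≤ X ^ cb' := Nat.one_le_pow _ _ (by omega)
    have hX3 : 2 ^ 3 ≤ X ^ 3 := Nat.pow_le_pow_left hX 3
    simp only [pow_add]
    have e1 : X ^ ca ≤ X ^ ca * X ^ cb * X ^ cb' := by
      rw [mul_assoc]; exact Nat.le_mul_of_pos_right _ (by positivity)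
    have e2 : X ^ cb ≤ X ^ ca * X ^ cb * X ^ cb' := by
      rw [mul_comm (X ^ ca), mul_assoc]; exact Nat.le_mul_of_pos_right _ (by positivity)
    have e3 : X ^ cb' ≤ X ^ ca * X ^ cb * X ^ cb' := Nat.le_mul_of_pos_left _ (by positivity)
    nlinarith
  · have h5 := hP.empty (r + 1) (by omega)
    funext x
    simp only [update_apply, eval]
    split_ifs <;> simp_all

theorem polyTime_sum {a b : UExpr} (iha : a.PolyTime) (ihb : b.PolyTime) : (sum a b).PolyTime := by
  obtain ⟨ca, ha⟩ := iha
  obtain ⟨ca', ha'⟩ := a.eval_le_pow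
  obtain ⟨cb, hb⟩ := ihb
  obtain ⟨cb', hb'⟩ := b.eval_le_pow
  -- The body is run with indices up to the value of `a`, hence with the bound `X ^ (ca' + 1)` in
  -- place of `X`. The power with exponent `cb + cb'` of this bound dominates both its running time
  -- and its value.
  refine ⟨ca + ca' + (ca' + 1) * (cb + cb') + 4, fun X hX w v ρ r T hw hv hP => ?_⟩
  have hX1 : X ^ ca' ≤ X ^ (ca' + 1) := Nat.pow_le_pow_right (by omega) (by omega)
  have hX2 : X ≤ X ^ (ca' + 1) := Nat.le_self_pow (by omega) X
  have hn := ha' X hX w v hv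
  obtain ⟨t1, ht1, h1⟩ := ha X hX w v ρ (r + 1) T hw hv
    (hP.of_agree (by omega) (fun j hj => rfl) (fun j hj => hP.empty j (by omega)))
  set n := a.eval w v with hn_def
  set B := (X ^ (ca' + 1)) ^ (cb + cb') with hB_def
  have hT0 : update T (r + 1) (unary n) = setThree T r 0 n 0 := by
    have h2 := hP.empty r le_rfl
    have h3 := hP.empty (r + 2) (by omega)
    funext x
    simp only [setThree, update_apply]
    split_ifs <;> simp_all
  obtain ⟨t2, ht2, h2⟩ := exec_sum_loop (p := b.compile ((r + 2) :: ρ) (r + 3)) (r := r) (B := B)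
    (f := fun i => b.eval w (i :: v)) (T := T) (N := n) hP.empty (fun i hi T' hT1 hT2 hT3 => by
      have hv' : ∀ m ∈ i :: v, m ≤ X ^ (ca' + 1) := by
        intro m hm
        rcases List.mem_cons.1 hm with rfl | hm
        · exact hi.le.trans (hn.trans hX1)
        · exact (hv m hm).trans hX2
      refine ⟨(hb' _ (hX.trans hX2) _ _ hv').trans
        (Nat.pow_le_pow_right (by omega) (by omega)), ?_⟩
      obtain ⟨t, ht, h⟩ := hb _ (hX.trans hX2) w (i :: v) ((r + 2) :: ρ) (r + 3) T'
        (hw.trans hX2) hv' (by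
          have := hP.of_agree (r' := r + 3) (T' := T') (by omega) hT1 hT3
          exact ⟨this.pos, this.word, .cons ⟨hT2, by omega, by omega⟩ this.vars, hT3⟩)
      exact ⟨t, ht.trans (Nat.pow_le_pow_right (by omega) (by omega)), h⟩) n 0 0 (by omega)
  have h3 := exec_clear (i := r + 2) (unary (0 + n)) _ (show setThree T r (0 + ∑ j ∈
    Finset.range n, b.eval w ((0 + j) :: v)) 0 (0 + n) (r + 2) = unary (0 + n) by simp [setThree])
  refine ⟨_, ?_, ((h1.cast hT0 rfl).seq (h2.seq h3)).cast ?_ rfl⟩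
  · have hA : 1 ≤ X ^ ca := Nat.one_le_pow _ _ (by omega)
    have hA' : 1 ≤ X ^ ca' := Nat.one_le_pow _ _ (by omega)
    have hB : 1 ≤ B := Nat.one_le_pow _ _ (by positivity)
    have hX4 : 2 ^ 4 ≤ X ^ 4 := Nat.pow_le_pow_left hX 4
    have hpow : X ^ (ca + ca' + (ca' + 1) * (cb + cb') + 4) = X ^ ca * X ^ ca' * B * X ^ 4 := by
      rw [pow_add, pow_add, pow_add, hB_def, ← pow_mul]
    rw [hpow]
    simp only [List.length_replicate]
    have e1 : X ^ ca ≤ X ^ ca * X ^ ca' * B := by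
      rw [mul_assoc]; exact Nat.le_mul_of_pos_right _ (by positivity)
    have e2 : X ^ ca' * B ≤ X ^ ca * X ^ ca' * B := by
      rw [mul_assoc]; exact Nat.le_mul_of_pos_left _ (by positivity)
    have e3 : X ^ ca' ≤ X ^ ca' * B := Nat.le_mul_of_pos_right _ (by positivity)
    have e4 : n * B ≤ X ^ ca' * B := Nat.mul_le_mul_right _ hn
    have e5 : 16 * (X ^ ca * X ^ ca' * B) ≤ X ^ ca * X ^ ca' * B * X ^ 4 := by
      rw [mul_comm]; exact Nat.mul_le_mul_left _ hX4
    have e6 : n * (4 + 3 * B) = 4 * n + 3 * (n * B) := by ring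
    rw [e6] at ht2
    omega
  · have h5 := hP.empty (r + 1) (by omega)
    have h6 := hP.empty (r + 2) (by omega)
    funext x
    simp only [setThree, update_apply, eval, zero_add, ← hn_def]
    split_ifs <;> simp_all

/-- The first `n` symbols of the word are moved aside, the top symbol is tested, and the symbols are
moved back; the two reversals cancel. Beyond the end the test sees an empty stack, which matches the
default bit `false`. -/
theorem polyTime_bit {a : UExpr} (iha : a.PolyTime) : (bit a).PolyTime := by
  obtain ⟨ca, ha⟩ := iha
  obtain ⟨ca', ha'⟩ := a.eval_le_pow
  refine ⟨ca + ca' + 4, fun X hX w v ρ r T hw hv hP => ?_⟩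
  obtain ⟨t1, ht1, h1⟩ := ha X hX w v ρ r T hw hv hP
  have hn := ha' X hX w v hv
  set n := a.eval w v with hn_def
  have hr := hP.pos
  have h2 := exec_scan (show r ≠ r + 1 by omega) (by omega) (by omega) n
    (update T r (unary n)) (by simp)
  set T2 : Store := update (update (update T r []) 0 ((w.map some).drop n)) (r + 1)
    (((w.map some).take n).reverse) with hT2_def
  have h2' : Exec (loop r (seq (pop r) (mv 0 (r + 1)))) (update T r (unary n)) T2
      (3 * n + 1) := by
    refine h2.cast ?_ rfl
    have h5 := hP.empty (r + 1) (by omega)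
    have h6 := hP.word
    rw [hT2_def]
    funext x
    simp only [update_apply]
    split_ifs <;> first | omega | simp_all
  set T3 : Store := update T2 r (unary ((bit a).eval w v)) with hT3_def
  have h3 : ∃ t ≤ 2, Exec (ite 0 (fun x => decide (x = some (some true))) (push r none) skip)
      T2 T3 t := by
    have hh : (T2 0).head? = (w[n]?).map some := by
      rw [hT2_def]
      simp [List.head?_drop]
    have hr2 : T2 r = [] := by
      rw [hT2_def]; simp [show r ≠ 0 by omega]
    have hget : w.getD n false = true ↔ w[n]? = some true := by
      rw [List.getD_eq_getElem?_getD]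
      cases w[n]? <;> simp
    by_cases hb : w[n]? = some true
    · refine ⟨_, le_rfl, (Exec.ite_true ?_ (Exec.push r none T2)).cast ?_ rfl⟩
      · simp [hh, hb]
      · rw [hT3_def, hr2, eval, ← hn_def, if_pos (hget.2 hb)]; rfl
    · refine ⟨_, le_rfl, (Exec.ite_false ?_ (Exec.skip T2)).cast ?_ rfl⟩
      · simp [hh, hb]
      · rw [hT3_def, eval, ← hn_def, if_neg (fun h => hb (hget.1 h)), show unary 0 = T2 r from hr2.symm,
          update_eq_self]
  obtain ⟨t3, ht3, h3⟩ := h3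
  have h4 := exec_move (show r + 1 ≠ 0 by omega) (((w.map some).take n).reverse) T3 (by
    rw [hT3_def, hT2_def]; simp)
  refine ⟨_, ?_, (h1.seq (h2'.seq (h3.seq h4))).cast ?_ rfl⟩
  · have hA : 1 ≤ X ^ ca := Nat.one_le_pow _ _ (by omega)
    have hA' : 1 ≤ X ^ ca' := Nat.one_le_pow _ _ (by omega)
    have hX4 : 2 ^ 4 ≤ X ^ 4 := Nat.pow_le_pow_left hX 4
    have hl : ((w.map some).take n).reverse.length ≤ n := by simp
    have e1 : X ^ ca ≤ X ^ ca * X ^ ca' := Nat.le_mul_of_pos_right _ (by positivity)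
    have e2 : X ^ ca' ≤ X ^ ca * X ^ ca' := Nat.le_mul_of_pos_left _ (by positivity)
    rw [pow_add, pow_add]
    have e5 : 16 * (X ^ ca * X ^ ca') ≤ X ^ ca * X ^ ca' * X ^ 4 := by
      rw [mul_comm]; exact Nat.mul_le_mul_left _ hX4
    omega
  · have h5 := hP.empty (r + 1) (by omega)
    have h6 := hP.word
    rw [hT3_def, hT2_def]
    funext x
    simp only [update_apply, List.reverse_reverse]
    split_ifs <;> first | omega | simp_all

theorem polyTime : ∀ e : UExpr, e.PolyTime
  | var i => polyTime_var i
  | const c => polyTime_const c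
  | add a b => polyTime_add a.polyTime b.polyTime
  | monus a b => polyTime_monus a.polyTime b.polyTime
  | sum a b => polyTime_sum a.polyTime b.polyTime
  | bit a => polyTime_bit a.polyTime

end UExpr

/-! ### Generating a word symbol by symbol -/

namespace StackProg

open Function

/-- The tape symbol with a given number. -/
def symOfNat : ℕ → TapeSym
  | 0 => none
  | 1 => some false
  | _ => some true

/-- Split the instance on stack `3` into its word, its length and its parameter. -/
def splitProg : StackProg :=
  loop 3 (ite 3 (fun x => decide (x = some none)) (mv 3 2) (seq (mv 3 0) (push 1 none)))

theorem unary_append_cons (n : ℕ) (l : List TapeSym) :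
    unary n ++ none :: l = none :: (unary n ++ l) := by
  induction n with
  | zero => rfl
  | succ n ih =>
    change none :: (unary n ++ none :: l) = none :: none :: (unary n ++ l)
    rw [ih]

/-- Each symbol is moved to the top of its target, so the word part comes out reversed. This suits
an instance that already lies reversed on stack `3`. -/
theorem exec_splitProg (l : List TapeSym) (T : Store) (h : T 3 = l) :
    ∃ t ≤ 4 * l.length + 1, Exec splitProg T (update (update (update (update T 3 [])
      0 ((l.filter Option.isSome).reverse ++ T 0))
      1 (unary (l.countP Option.isSome) ++ T 1))
      2 (unary (l.countP Option.isNone) ++ T 2)) t := by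
  induction l generalizing T with
  | nil =>
    refine ⟨1, by simp, (Exec.loop_done h).cast ?_ rfl⟩
    funext x
    simp only [update_apply]
    split_ifs <;> simp_all
  | cons a l ih =>
    have hne : T 3 ≠ [] := by simp [h]
    cases a with
    | none =>
      have hb : Exec _ T _ _ := (Exec.mv 3 2 T)
      rw [mvStore_cons (by omega) h] at hb
      obtain ⟨t, ht, h2⟩ := ih (update (update T 3 l) 2 (none :: T 2)) (by simp)
      refine ⟨_, ?_, (Exec.loop_step hne (Exec.ite_true (by simp [h]) hb) h2).cast ?_ rfl⟩
      · simp only [List.length_cons]; omega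
      · funext i
        match i with
        | 0 | 1 | 2 | 3 => simp [List.replicate_succ, unary_append_cons]
        | i + 4 => simp
    | some a =>
      have hb : Exec _ T _ _ := (Exec.mv 3 0 T)
      rw [mvStore_cons (by omega) h] at hb
      obtain ⟨t, ht, h2⟩ := ih (update (update (update T 3 l) 0 (some a :: T 0)) 1 (none :: T 1))
        (by simp)
      refine ⟨_, ?_, (Exec.loop_step hne (Exec.ite_false (by simp [h])
        (hb.seq ((Exec.push 1 none _).cast ?_ rfl))) h2).cast ?_ rfl⟩
      · simp only [List.length_cons]; omega
      · simp
      · funext i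
        match i with
        | 0 | 1 | 2 | 3 => simp [List.replicate_succ, unary_append_cons]
        | i + 4 => simp

/-- Push the symbol whose number is on stack `6` to stack `4`, and clear stack `6`. -/
def emitProg : StackProg :=
  seq (ite 6 Option.isNone (push 4 none)
    (seq (pop 6) (ite 6 Option.isNone (push 4 (some false)) (push 4 (some true)))))
    (loop 6 (pop 6))

theorem exec_emitProg (c : ℕ) (T : Store) (h : T 6 = []) :
    ∃ t ≤ 2 * c + 6, Exec emitProg (update T 6 (unary c)) (update T 4 (symOfNat c :: T 4)) t := by
  have hclear : ∀ n s, Exec (loop 6 (pop 6)) (update (update T 6 (unary n)) 4 s)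
      (update T 4 s) (2 * n + 1) := fun n s =>
    (exec_clear (unary n) _ (by simp)).cast (by
      funext x
      simp only [update_apply]
      split_ifs <;> first | omega | simp_all) (by simp)
  match c with
  | 0 =>
    refine ⟨_, ?_, Exec.seq (Exec.ite_true (by simp) ((Exec.push 4 none _).cast ?_ rfl))
      (hclear 0 _)⟩
    · simp
    · simp [symOfNat]
  | 1 =>
    have hpop : Exec (pop 6) (update T 6 (unary 1)) (update T 6 (unary 0)) 1 :=
      (Exec.pop _ _).cast (by simp) rfl
    refine ⟨_, ?_, Exec.seq (Exec.ite_false (by simp) (hpop.seq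
      (Exec.ite_true (by simp) ((Exec.push 4 (some false) _).cast ?_ rfl)))) (hclear 0 _)⟩
    · simp
    · simp [symOfNat]
  | n + 2 =>
    have hpop : Exec (pop 6) (update T 6 (unary (n + 2))) (update T 6 (unary (n + 1))) 1 :=
      (Exec.pop _ _).cast (by simp) rfl
    refine ⟨_, ?_, Exec.seq (Exec.ite_false (by simp) (hpop.seq
      (Exec.ite_false (by simp) ((Exec.push 4 (some true) _).cast ?_ rfl)))) (hclear (n + 1) _)⟩
    · omega
    · simp [symOfNat]

/-- Generate a word whose length is given by `a` and whose symbols are given by `b`. -/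
def generateProg (a b : UExpr) : StackProg :=
  seq splitProg (seq (a.compile [1, 2] 5)
    (seq (loop 5 (seq (pop 5) (seq (b.compile [5, 1, 2] 6) emitProg)))
      (seq (loop 0 (pop 0)) (seq (loop 1 (pop 1)) (loop 2 (pop 2))))))

/-- The store that presents a word and its parameter, an output `o` and a counter `n`. -/
def genStore (x : List Bool) (k : ℕ) (o : List TapeSym) (n : ℕ) : Store
  | 0 => x.map some
  | 1 => unary x.length
  | 2 => unary k
  | 4 => o
  | 5 => unary n
  | _ => []

theorem genStore_update_four (x : List Bool) (k : ℕ) (o o' : List TapeSym) (n : ℕ) :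
    update (genStore x k o n) 4 o' = genStore x k o' n := by
  funext i
  match i with
  | 0 | 1 | 2 | 3 | 4 | 5 => rfl
  | i + 6 => simp [genStore]

theorem genStore_update_five (x : List Bool) (k : ℕ) (o : List TapeSym) (n m : ℕ) :
    update (genStore x k o n) 5 (unary m) = genStore x k o m := by
  funext i
  match i with
  | 0 | 1 | 2 | 3 | 4 | 5 => rfl
  | i + 6 => simp [genStore]

theorem genStore_of_six_le (x : List Bool) (k : ℕ) (o : List TapeSym) (n : ℕ) {j : ℕ}
    (h : 6 ≤ j) : genStore x k o n j = [] := by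
  obtain ⟨j, rfl⟩ := Nat.exists_eq_add_of_le' h
  rfl

/-- The counter runs downwards, and it is popped before the body, so that it then equals the
position to be computed. The last symbol is thus pushed first, and the finished word reads from the
top in the right order. -/
theorem exec_generate_loop {p : StackProg} {B : ℕ} {f : ℕ → ℕ} {x : List Bool} {k N : ℕ}
    (hp : ∀ i < N, ∀ o, f i ≤ B ∧
      ∃ t ≤ B, Exec p (genStore x k o i) (update (genStore x k o i) 6 (unary (f i))) t)
    (n : ℕ) (hn : n ≤ N) (o : List TapeSym) :
    ∃ t ≤ n * (8 + 3 * B) + 1, Exec (loop 5 (seq (pop 5) (seq p emitProg))) (genStore x k o n)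
      (genStore x k ((List.range n).map (fun i => symOfNat (f i)) ++ o) 0) t := by
  induction n generalizing o with
  | zero => exact ⟨1, by simp, Exec.loop_done rfl⟩
  | succ n ih =>
    obtain ⟨hB, t1, ht1, h1⟩ := hp n (by omega) o
    obtain ⟨t2, ht2, h2⟩ := exec_emitProg (f n) (genStore x k o n) rfl
    rw [genStore_update_four] at h2
    obtain ⟨t3, ht3, h3⟩ := ih (by omega) (symOfNat (f n) :: o)
    have hpop : Exec (pop 5) (genStore x k o (n + 1)) (genStore x k o n) 1 :=
      (Exec.pop 5 _).cast (genStore_update_five x k o (n + 1) n) rfl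
    refine ⟨_, ?_, (Exec.loop_step (by simp [genStore]) (hpop.seq (h1.seq h2)) h3).cast ?_ rfl⟩
    · nlinarith
    · rw [List.range_succ]
      simp

theorem length_encodeInstance {α : Type} (x : List α) (k : ℕ) :
    (encodeInstance (x, k)).length = k + x.length := by
  simp [encodeInstance]

theorem exec_generateProg (a b : UExpr) : ∃ c, ∀ (x : List Bool) (k : ℕ),
    ∃ t ≤ (x.length + k + 2) ^ c, Exec (generateProg a b)
      (update (fun _ => []) 3 (encodeInstance (x, k)).reverse)
      (update (fun _ => []) 4 ((List.range (a.eval x [x.length, k])).map fun i =>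
        symOfNat (b.eval x [i, x.length, k]))) t := by
  obtain ⟨ca, ha⟩ := a.polyTime
  obtain ⟨ca', ha'⟩ := a.eval_le_pow
  obtain ⟨cb, hb⟩ := b.polyTime
  obtain ⟨cb', hb'⟩ := b.eval_le_pow
  refine ⟨ca + ca' + (ca' + 1) * (cb + cb') + 6, fun x k => ?_⟩
  set X := x.length + k + 2 with hX_def
  have hX : 2 ≤ X := by omega
  have hX1 : X ^ ca' ≤ X ^ (ca' + 1) := Nat.pow_le_pow_right (by omega) (by omega)
  have hX2 : X ≤ X ^ (ca' + 1) := Nat.le_self_pow (by omega) X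
  obtain ⟨t1, ht1, h1⟩ := exec_splitProg (encodeInstance (x, k)).reverse
    (update (fun _ => []) 3 (encodeInstance (x, k)).reverse) (by simp)
  have h1' : Exec splitProg (update (fun _ => []) 3 (encodeInstance (x, k)).reverse)
      (genStore x k [] 0) t1 := by
    refine h1.cast ?_ rfl
    have e1 : (encodeInstance (x, k)).filter Option.isSome = x.map some := by
      rw [encodeInstance, List.filter_append, List.filter_eq_nil_iff.2 (by simp),
        List.filter_eq_self.2 (by simp only [List.mem_map]; rintro _ ⟨a, -, rfl⟩; rfl), List.nil_append]
    have e2 : (encodeInstance (x, k)).countP Option.isSome = x.length := by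
      rw [List.countP_eq_length_filter, e1, List.length_map]
    have e3 : (encodeInstance (x, k)).countP Option.isNone = k := by
      rw [encodeInstance, List.countP_append, List.countP_eq_length.2 (by simp),
        List.countP_eq_zero.2 (by simp only [List.mem_map]; rintro _ ⟨a, -, rfl⟩; simp),
        List.length_replicate, add_zero]
    simp only [List.filter_reverse, List.countP_reverse, e1, e2, e3]
    funext i
    match i with
    | 0 | 1 | 2 | 3 | 4 | 5 => simp [genStore]
    | i + 6 => simp [genStore]
  have hv : ∀ n ∈ [x.length, k], n ≤ X := by simp; omega
  obtain ⟨t2, ht2, h2⟩ := ha X hX x [x.length, k] [1, 2] 5 (genStore x k [] 0) (by omega) hv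
    ⟨by omega, rfl, .cons ⟨rfl, by omega, by omega⟩ (.cons ⟨rfl, by omega, by omega⟩ .nil),
      fun j hj => by
        rcases hj.eq_or_lt with rfl | hj
        · rfl
        · exact genStore_of_six_le _ _ _ _ hj⟩
  rw [genStore_update_five] at h2
  have hN := ha' X hX x _ hv
  set N := a.eval x [x.length, k] with hN_def
  set B := (X ^ (ca' + 1)) ^ (cb + cb') with hB_def
  obtain ⟨t3, ht3, h3⟩ := exec_generate_loop (p := b.compile [5, 1, 2] 6) (B := B)
    (f := fun i => b.eval x [i, x.length, k]) (x := x) (k := k) (N := N) (fun i hi o => by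
      have hv' : ∀ m ∈ [i, x.length, k], m ≤ X ^ (ca' + 1) := by
        intro m hm
        rcases List.mem_cons.1 hm with rfl | hm
        · exact hi.le.trans (hN.trans hX1)
        · exact (hv m hm).trans hX2
      refine ⟨(hb' _ (hX.trans hX2) _ _ hv').trans
          (Nat.pow_le_pow_right (by omega) (by omega)), ?_⟩
      obtain ⟨t, ht, h⟩ := hb _ (hX.trans hX2) x [i, x.length, k] [5, 1, 2] 6
        (genStore x k o i) ((show x.length ≤ X by omega).trans hX2) hv'
        ⟨by omega, rfl, .cons ⟨rfl, by omega, by omega⟩ (.cons ⟨rfl, by omega, by omega⟩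
          (.cons ⟨rfl, by omega, by omega⟩ .nil)), fun j hj => genStore_of_six_le _ _ _ _ hj⟩
      exact ⟨t, ht.trans (Nat.pow_le_pow_right (by omega) (by omega)), h⟩) N le_rfl []
  rw [List.append_nil] at h3
  set o := (List.range N).map fun i => symOfNat (b.eval x [i, x.length, k]) with ho
  -- The halting convention requires every stack except the output stack to be empty, so the word,
  -- its length and the parameter are erased.
  have h4 := exec_clear (i := 0) _ (genStore x k o 0) rfl
  have h5 := exec_clear (i := 1) (unary x.length) (update (genStore x k o 0) 0 [])
    (by simp [genStore])
  have h6 := exec_clear (i := 2) (unary k) (update (update (genStore x k o 0) 0 []) 1 [])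
    (by simp [genStore])
  refine ⟨_, ?_, (h1'.seq (h2.seq (h3.seq (h4.seq (h5.seq h6))))).cast ?_ rfl⟩
  · have hA : 1 ≤ X ^ ca := Nat.one_le_pow _ _ (by omega)
    have hA' : 1 ≤ X ^ ca' := Nat.one_le_pow _ _ (by omega)
    have hB : 1 ≤ B := Nat.one_le_pow _ _ (by positivity)
    have hX6 : 2 ^ 5 * X ≤ X ^ 6 := by
      rw [pow_succ]; exact Nat.mul_le_mul_right _ (Nat.pow_le_pow_left hX 5)
    have hpow : X ^ (ca + ca' + (ca' + 1) * (cb + cb') + 6) = X ^ ca * X ^ ca' * B * X ^ 6 := by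
      rw [pow_add, pow_add, pow_add, hB_def, ← pow_mul]
    rw [hpow]
    have e1 : X ^ ca ≤ X ^ ca * X ^ ca' * B := by
      rw [mul_assoc]; exact Nat.le_mul_of_pos_right _ (by positivity)
    have e2 : X ^ ca' * B ≤ X ^ ca * X ^ ca' * B := by
      rw [mul_assoc]; exact Nat.le_mul_of_pos_left _ (by positivity)
    have e3 : X ^ ca' ≤ X ^ ca' * B := Nat.le_mul_of_pos_right _ (by positivity)
    have e4 : N * B ≤ X ^ ca' * B := Nat.mul_le_mul_right _ hN
    set P := X ^ ca * X ^ ca' * B with hP_def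
    have hP : 1 ≤ P := hA.trans e1
    have e5 : P * (2 ^ 5 * X) ≤ P * X ^ 6 := Nat.mul_le_mul_left _ hX6
    have e6 : N * (8 + 3 * B) = 8 * N + 3 * (N * B) := by ring
    have e7 : P * (2 ^ 5 * X) = 32 * (P * X) := by ring
    have e8 : X ≤ P * X := Nat.le_mul_of_pos_left _ hP
    have e9 : P * 2 ≤ P * X := Nat.mul_le_mul_left _ hX
    rw [List.length_reverse, length_encodeInstance] at ht1
    have e10 : (genStore x k o 0 0).length = x.length := by simp [genStore]
    simp only [List.length_replicate, e10]
    rw [e6] at ht3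
    omega
  · funext i
    match i with
    | 0 | 1 | 2 | 3 | 4 | 5 => simp [genStore]
    | i + 6 => simp [genStore]

end StackProg

/-! ### Running a stack program after a machine -/

namespace Turing.TM2

open Function StackProg

variable {K₁ : Type} [DecidableEq K₁] {Γ₁ : K₁ → Type} {σ₁ Λ₁ Λ : Type} {W : ℕ} [NeZero W]

/-- A statement of a machine as a statement of a machine with further stacks; halting is replaced
by a jump to `exit`. -/
def Stmt.extend (emb : Λ₁ → Λ) (exit : Λ) :
    Stmt Γ₁ Λ₁ σ₁ → Stmt (StackFam Γ₁ W) Λ (σ₁ × Option TapeSym)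
  | .push k f q => .push (.inl k) (fun v => f v.1) (q.extend emb exit)
  | .peek k f q => .peek (.inl k) (fun v x => (f v.1 x, v.2)) (q.extend emb exit)
  | .pop k f q => .pop (.inl k) (fun v x => (f v.1 x, v.2)) (q.extend emb exit)
  | .load f q => .load (fun v => (f v.1, v.2)) (q.extend emb exit)
  | .branch f q q' => .branch (fun v => f v.1) (q.extend emb exit) (q'.extend emb exit)
  | .goto l => .goto fun v => emb (l v.1)
  | .halt => .goto fun _ => exit

theorem update_joinStk_inl {W : ℕ} (S : ∀ k, List (Γ₁ k)) (T : Fin W → List TapeSym) (k : K₁)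
    (l : List (Γ₁ k)) :
    update (joinStk S T) (.inl k) l = joinStk (update S k l) T := by
  funext x
  rcases x with x | x
  · by_cases h : x = k
    · subst h
      simp [joinStk]
    · rw [update_of_ne (by simpa using h)]
      simp [joinStk, h]
  · rw [update_of_ne (by simp)]
    rfl

/-- A configuration of a machine as a configuration of a machine with further stacks. -/
def Cfg.extend (emb : Λ₁ → Λ) (exit : Λ) (T : Fin W → List TapeSym) (c : Cfg Γ₁ Λ₁ σ₁) :
    Cfg (StackFam Γ₁ W) Λ (σ₁ × Option TapeSym) :=
  ⟨some (c.l.elim exit emb), (c.var, none), joinStk c.stk T⟩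

/-- The statement never touches the added stacks or the added scratch component. Halting, which has
no label, corresponds to the label `exit`. -/
theorem stepAux_extend {W : ℕ} (emb : Λ₁ → Λ) (exit : Λ) (T : Fin W → List TapeSym)
    (q : Stmt Γ₁ Λ₁ σ₁) (v : σ₁) (S : ∀ k, List (Γ₁ k)) :
    stepAux (q.extend emb exit) (v, none) (joinStk S T) = (stepAux q v S).extend emb exit T := by
  induction q generalizing v S with
  | push k f q ih =>
    simp only [Stmt.extend, stepAux]
    rw [update_joinStk_inl]; exact ih _ _
  | peek k f q ih => exact ih _ _
  | pop k f q ih =>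
    simp only [Stmt.extend, stepAux]
    rw [update_joinStk_inl]; exact ih _ _
  | load f q ih => exact ih _ _
  | branch f q q' ih ih' =>
    simp only [Stmt.extend, stepAux]
    cases f v
    · exact ih' _ _
    · exact ih _ _
  | goto l => rfl
  | halt => rfl

theorem iterate_none {m : Λ₁ → Stmt Γ₁ Λ₁ σ₁} (t : ℕ) :
    (flip bind (step m))^[t] none = none := by
  induction t with
  | zero => rfl
  | succ t ih => rw [iterate_succ_apply]; exact ih

theorem stepsTo_succ {m : Λ₁ → Stmt Γ₁ Λ₁ σ₁} {t : ℕ} {c c' : Cfg Γ₁ Λ₁ σ₁} :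
    StepsTo m (t + 1) c c' ↔ ∃ c₁, step m c = some c₁ ∧ StepsTo m t c₁ c' := by
  unfold StepsTo
  rw [iterate_succ_apply]
  change (flip bind (step m))^[t] (step m c) = some c' ↔ _
  cases h : step m c with
  | none =>
    rw [iterate_none]
    simp
  | some c₁ => simp

theorem StepsTo.extend {W : ℕ} {m : Λ₁ → Stmt Γ₁ Λ₁ σ₁}
    {m' : Λ → Stmt (StackFam Γ₁ W) Λ (σ₁ × Option TapeSym)} {emb : Λ₁ → Λ} {exit : Λ}
    (hm : ∀ l, m' (emb l) = (m l).extend emb exit) (T : Fin W → List TapeSym)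
    {t : ℕ} {c c' : Cfg Γ₁ Λ₁ σ₁} (h : StepsTo m t c c') :
    StepsTo m' t (c.extend emb exit T) (c'.extend emb exit T) := by
  induction t generalizing c with
  | zero =>
    cases Option.some_injective _ h
    exact .refl _ _
  | succ t ih =>
    obtain ⟨c₁, h1, h2⟩ := stepsTo_succ.1 h
    refine stepsTo_succ.2 ⟨_, ?_, ih h2⟩
    rcases c with ⟨_ | l, v, S⟩
    · simp [step] at h1
    · cases Option.some_injective _ h1
      change some (stepAux (m' (emb l)) (v, none) (joinStk S T)) = _
      rw [hm, stepAux_extend]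

-- Growth of the stacks during a run.

/-- The number of push operations in a statement. -/
def Stmt.pushes : Stmt Γ₁ Λ₁ σ₁ → ℕ
  | .push _ _ q => q.pushes + 1
  | .peek _ _ q => q.pushes
  | .pop _ _ q => q.pushes
  | .load _ q => q.pushes
  | .branch _ q q' => q.pushes + q'.pushes
  | .goto _ => 0
  | .halt => 0

theorem length_stk_stepAux_le (q : Stmt Γ₁ Λ₁ σ₁) (v : σ₁) (S : ∀ k, List (Γ₁ k)) (k : K₁) :
    ((stepAux q v S).stk k).length ≤ (S k).length + q.pushes := by
  induction q generalizing v S with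
  | push k' f q ih =>
    refine (ih _ _).trans ?_
    by_cases h : k = k'
    · subst h; simp only [Function.update_self, List.length_cons, Stmt.pushes]; omega
    · simp [h, Stmt.pushes]
  | peek k' f q ih => exact ih _ _
  | pop k' f q ih =>
    refine (ih _ _).trans ?_
    by_cases h : k = k'
    · subst h; simp [Stmt.pushes]
    · simp [h, Stmt.pushes]
  | load f q ih => exact ih _ _
  | branch f q q' ih ih' =>
    simp only [stepAux, Stmt.pushes]
    cases f v
    · exact (ih' _ _).trans (by omega)
    · exact (ih _ _).trans (by omega)
  | goto l => simp [Stmt.pushes]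
  | halt => simp [Stmt.pushes]

/-- This bounds the output of a machine by its input and its running time, and therefore the input
of whatever is run afterwards. -/
theorem StepsTo.length_stk_le {m : Λ₁ → Stmt Γ₁ Λ₁ σ₁} {C : ℕ} (hC : ∀ l, (m l).pushes ≤ C)
    {t : ℕ} {c c' : Cfg Γ₁ Λ₁ σ₁} (h : StepsTo m t c c') (k : K₁) :
    (c'.stk k).length ≤ (c.stk k).length + C * t := by
  induction t generalizing c with
  | zero =>
    cases Option.some_injective _ h
    simp
  | succ t ih =>
    obtain ⟨c₁, h1, h2⟩ := stepsTo_succ.1 h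
    refine (ih h2).trans ?_
    rcases c with ⟨_ | l, v, S⟩
    · simp [step] at h1
    · cases Option.some_injective _ h1
      have := (length_stk_stepAux_le (m l) v S k).trans (Nat.add_le_add_left (hC l) _)
      rw [mul_add]
      simp only
      omega

end Turing.TM2

namespace Turing

open Function StackProg

variable {α : Type} (M : TM2ComputableAux (Option α) TapeSym) (p : StackProg)

/-- The number of stacks that are added to a machine in order to run a program afterwards. -/
abbrev extraStacks (p : StackProg) : ℕ := p.width + 5

/-- The statements of the machine that runs `M`, moves its output to stack `3`, and runs `p`. -/
def thenProgStmt : M.tm.Λ ⊕ (Bool ⊕ p.Label) →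
    TM2.Stmt (StackFam M.tm.Γ (extraStacks p)) (M.tm.Λ ⊕ (Bool ⊕ p.Label))
      (M.tm.σ × Option TapeSym)
  | .inl l => TM2.Stmt.extend (fun l => .inl l) (.inr (.inl true)) (M.tm.m l)
  | .inr (.inl true) => .pop (.inl M.tm.k₁) (fun v x => (v.1, x.map M.outputAlphabet))
      (.branch (fun v => v.2.isSome)
        (.push (.inr (Fin.ofNat _ 3)) (fun v => v.2.getD none)
          (.load (fun v => (v.1, none)) (.goto fun _ => .inr (.inl true))))
        (.goto fun _ => .inr (.inr p.start)))
  | .inr (.inl false) => .halt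
  | .inr (.inr l) => p.code (fun l => .inr (.inr l)) (.inr (.inl false)) l

/-- The machine that runs `M`, moves its output to stack `3`, and runs `p`; its output is what `p`
leaves on stack `4`. -/
noncomputable def thenProgMachine : FinTM2 :=
  letI := p.finite_label
  letI : Fintype p.Label := Fintype.ofFinite _
  letI := M.tm.kDecidableEq
  letI := M.tm.kFin
  letI := M.tm.ΛFin
  letI := M.tm.σFin
  letI : Fintype (StackFam M.tm.Γ (extraStacks p) (.inl M.tm.k₀)) := M.tm.Γk₀Fin
  { K := M.tm.K ⊕ Fin (extraStacks p)
    k₀ := .inl M.tm.k₀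
    k₁ := .inr (Fin.ofNat _ 4)
    Γ := StackFam M.tm.Γ (extraStacks p)
    Λ := M.tm.Λ ⊕ (Bool ⊕ p.Label)
    main := .inl M.tm.main
    σ := M.tm.σ × Option TapeSym
    initialState := (M.tm.initialState, none)
    m := thenProgStmt M p }

/-- `thenProgMachine` with its alphabets. -/
noncomputable def thenProg : TM2ComputableAux (Option α) TapeSym where
  tm := thenProgMachine M p
  inputAlphabet := M.inputAlphabet
  outputAlphabet := Equiv.refl _

/-- One step is used for each symbol and one more to notice that the stack is empty. The symbols
arrive in reverse order. -/
theorem stepsTo_transfer (l : List TapeSym) (v : M.tm.σ) (S : ∀ k, List (M.tm.Γ k)) (T : Store)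
    (hS : S M.tm.k₁ = l.map M.outputAlphabet.symm) :
    TM2.StepsTo (thenProgStmt M p) (l.length + 1)
      ⟨some (.inr (.inl true)), (v, none), joinStk S (restrict (extraStacks p) T)⟩
      ⟨some (.inr (.inr p.start)), (v, none), joinStk (update S M.tm.k₁ [])
        (restrict (extraStacks p) (update T 3 (l.reverse ++ T 3)))⟩ := by
  induction l generalizing S T with
  | nil =>
    refine .single rfl ?_
    simp only [thenProgStmt, TM2.stepAux]
    rw [TM2.update_joinStk_inl]
    simp [joinStk, hS]
  | cons a l ih =>
    have h := ih (update S M.tm.k₁ (l.map M.outputAlphabet.symm)) (update T 3 (a :: T 3)) (by simp)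
    have h' : l.reverse ++ a :: T 3 = (a :: l).reverse ++ T 3 := by simp
    rw [update_idem, update_idem, update_self, h'] at h
    rw [List.length_cons, add_comm]
    refine .trans (.single rfl ?_) h
    simp only [thenProgStmt, TM2.stepAux]
    rw [TM2.update_joinStk_inl, joinStk_ofNat (Nat.lt_add_left _ (by omega)),
      update_joinStk (Nat.lt_add_left _ (by omega))]
    simp [joinStk, hS]

theorem initList_stk_self (tm : FinTM2) (s : List (tm.Γ tm.k₀)) :
    (initList tm s).stk tm.k₀ = s :=
  dif_pos rfl

theorem initList_stk_of_ne (tm : FinTM2) (s : List (tm.Γ tm.k₀)) {k : tm.K} (h : k ≠ tm.k₀) :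
    (initList tm s).stk k = [] :=
  dif_neg h

theorem haltList_stk_self (tm : FinTM2) (s : List (tm.Γ tm.k₁)) :
    (haltList tm s).stk tm.k₁ = s :=
  dif_pos rfl

theorem haltList_stk_of_ne (tm : FinTM2) (s : List (tm.Γ tm.k₁)) {k : tm.K} (h : k ≠ tm.k₁) :
    (haltList tm s).stk k = [] :=
  dif_neg h

theorem initList_thenProg (s : List (M.tm.Γ M.tm.k₀)) :
    initList (thenProgMachine M p) s = (initList M.tm s).extend (fun l => .inl l)
      (.inr (.inl true)) (restrict (extraStacks p) fun _ => []) := by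
  have hstk : (initList (thenProgMachine M p) s).stk
      = joinStk (initList M.tm s).stk (restrict (extraStacks p) fun _ => []) := by
    funext k
    rcases k with k | k
    · by_cases h : k = M.tm.k₀
      · subst h
        exact (initList_stk_self (thenProgMachine M p) s).trans (initList_stk_self M.tm s).symm
      · exact (initList_stk_of_ne (thenProgMachine M p) s fun h' => h (Sum.inl_injective h')).trans
          (initList_stk_of_ne M.tm s h).symm
    · exact initList_stk_of_ne (thenProgMachine M p) s fun h' => Sum.inr_ne_inl h'
  exact congrArg (fun S => (⟨some (Sum.inl M.tm.main), (M.tm.initialState, none), S⟩ :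
    TM2.Cfg _ _ _)) hstk

theorem haltList_thenProg (s : List TapeSym) :
    haltList (thenProgMachine M p) s = ⟨none, (M.tm.initialState, none),
      joinStk (fun _ => []) (restrict (extraStacks p) (update (fun _ => []) 4 s))⟩ := by
  have hstk : (haltList (thenProgMachine M p) s).stk
      = joinStk (fun _ => []) (restrict (extraStacks p) (update (fun _ => []) 4 s)) := by
    funext k
    rcases k with k | k
    · exact haltList_stk_of_ne (thenProgMachine M p) s fun h' => Sum.inl_ne_inr h'
    · have h4 : 4 % (p.width + 5) = 4 := Nat.mod_eq_of_lt (by omega)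
      by_cases h : k = Fin.ofNat _ 4
      · subst h
        refine (haltList_stk_self (thenProgMachine M p) s).trans ?_
        simp [joinStk, restrict, h4]
        rfl
      · have h4' : (k : ℕ) ≠ 4 := fun h' => h (Fin.ext (by simp [h', h4]))
        refine (haltList_stk_of_ne (thenProgMachine M p) s
          fun h' => h (Sum.inr_injective h')).trans ?_
        simp [joinStk, restrict, h4']
        rfl
  exact congrArg (fun S => (⟨none, (M.tm.initialState, none), S⟩ : TM2.Cfg _ _ _)) hstk

/-- The three phases are the run of `M`, the transfer of its output to stack `3`, and the program
followed by one halting step. After the transfer all stacks of `M` are empty, as the final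
configuration demands. -/
theorem thenProg_outputs {x : List (M.tm.Γ M.tm.k₀)} {y z : List TapeSym} {t t' : ℕ}
    (h : TM2.StepsTo M.tm.m t (initList M.tm x) (haltList M.tm (y.map M.outputAlphabet.symm)))
    (h' : Exec p (update (fun _ => []) 3 y.reverse) (update (fun _ => []) 4 z) t') :
    TM2.StepsTo (thenProgStmt M p) (t + (y.length + 1 + (t' + 1)))
      (initList (thenProgMachine M p) x) (haltList (thenProgMachine M p) z) := by
  rw [initList_thenProg, haltList_thenProg]
  refine (h.extend (m' := thenProgStmt M p) (fun _ => rfl) _).trans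
    (.trans (stepsTo_transfer M p y _ _ _ (haltList_stk_self _ _)) ?_)
  have hS : update (haltList M.tm (y.map M.outputAlphabet.symm)).stk M.tm.k₁ []
      = fun _ => [] := by
    funext k
    by_cases hk : k = M.tm.k₁
    · subst hk; simp
    · rw [update_of_ne hk]
      exact haltList_stk_of_ne _ _ hk
  rw [hS, List.append_nil]
  exact (h'.stepsTo (Nat.le_add_right _ _) (thenProgStmt M p) (fun l => .inr (.inr l)) (.inr (.inl false))
    (fun _ => rfl) _ _).trans (.single rfl rfl)

end Turing

namespace Primrec

theorem pow_const {α : Type} [Primcodable α] {f : α → ℕ} (hf : Primrec f) (c : ℕ) :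
    Primrec fun n => f n ^ c := by
  induction c with
  | zero => simpa using Primrec.const (α := α) 1
  | succ c ih => simpa only [pow_succ] using Primrec.nat_mul.comp ih hf

end Primrec

-- Closure of fpt-computability under generated words.

section FPT

open Turing StackProg

theorem fptComputable_id {α : Type} [Finite α] :
    FPTComputable (fun p : List α × ℕ => p) := by
  have := Fintype.ofFinite α
  refine ⟨⟨idComputer (Option α), Equiv.refl _, Equiv.refl _⟩, fun _ => 1, 0, Computable.const 1,
    fun x k => ⟨⟨⟨1, rfl⟩, by simp⟩⟩⟩

/-- A function whose values can be generated symbol by symbol is fpt-computable after any other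
fpt-computable function. -/
theorem FPTComputable.generate {α : Type} {r₁ : List α × ℕ → List Bool × ℕ}
    (h : FPTComputable r₁) {r : List Bool × ℕ → List Bool × ℕ} (a b : UExpr)
    (hr : ∀ x k, encodeInstance (r (x, k)) = (List.range (a.eval x [x.length, k])).map fun i =>
      symOfNat (b.eval x [i, x.length, k])) :
    FPTComputable fun p => r (r₁ p) := by
  obtain ⟨M, f, c, hf, hM⟩ := h
  obtain ⟨c', hc'⟩ := exec_generateProg a b
  let M' := thenProg M (generateProg a b)
  have := M.tm.ΛFin
  let C := ∑ l, (M.tm.m l).pushes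
  have hC : ∀ l, (M.tm.m l).pushes ≤ C := fun l =>
    Finset.single_le_sum (f := fun l => (M.tm.m l).pushes) (fun _ _ => Nat.zero_le _)
      (Finset.mem_univ l)
  -- The output of `M` satisfies `|y| + k' + 2 ≤ G * N ^ (c + 1)` for `G = k + 2 + C * f k` and `N =
  -- |x| + 1`. The program takes at most the `c'`-th power of the left side; the exponent `c' + 1`
  -- and the factor `2` also cover the transfer.
  refine ⟨M', fun k => f k + 2 * (k + 2 + C * f k) ^ (c' + 1), (c + 1) * (c' + 1), ?_, ?_⟩
  · have h1 : Computable fun p : ℕ × ℕ => p.2 + 2 * (p.1 + 2 + C * p.2) ^ (c' + 1) := by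
      have h2 : Primrec fun p : ℕ × ℕ => p.1 + 2 + C * p.2 :=
        Primrec.nat_add.comp (Primrec.nat_add.comp Primrec.fst (Primrec.const 2))
          (Primrec.nat_mul.comp (Primrec.const C) Primrec.snd)
      exact (Primrec.nat_add.comp Primrec.snd
        (Primrec.nat_mul.comp (Primrec.const 2) (Primrec.pow_const h2 (c' + 1)))).to_comp
    exact h1.comp (Computable.id.pair hf)
  · intro x k
    obtain ⟨⟨⟨t, ht⟩, htle⟩⟩ := hM x k
    rcases hyk : r₁ (x, k) with ⟨y, k'⟩
    rw [hyk] at ht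
    obtain ⟨t', ht', hexec⟩ := hc' y k'
    rw [← hr] at hexec
    have hrun := thenProg_outputs M (generateProg a b) ht hexec
    have hlen : k' + y.length ≤ k + x.length + C * t := by
      have h1 := TM2.StepsTo.length_stk_le hC (c' := haltList M.tm _) ht M.tm.k₁
      rw [haltList_stk_self, List.length_map, length_encodeInstance] at h1
      refine h1.trans (Nat.add_le_add_right ?_ _)
      -- The output stack may be the input stack, and otherwise it is empty at the start.
      by_cases hk : M.tm.k₁ = M.tm.k₀
      · have h2 : ∀ k₁ (hk : k₁ = M.tm.k₀) s, ((initList M.tm s).stk k₁).length = s.length := by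
          rintro _ rfl s
          rw [initList_stk_self]
        rw [h2 _ hk, List.length_map, length_encodeInstance]
      · rw [initList_stk_of_ne _ _ hk]; simp
    refine ⟨⟨⟨t + ((encodeInstance (y, k')).length + 1 + (t' + 1)), ?_⟩, ?_⟩⟩
    · simp only [hyk]
      have hid : (encodeInstance (r (y, k'))).map M'.outputAlphabet.symm
          = encodeInstance (r (y, k')) := List.map_id _
      rw [hid]
      exact hrun
    · change t + ((encodeInstance (y, k')).length + 1 + (t' + 1)) ≤
        (f k + 2 * (k + 2 + C * f k) ^ (c' + 1)) * (x.length + 1) ^ ((c + 1) * (c' + 1))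
      change t ≤ f k * (x.length + 1) ^ c at htle
      rw [length_encodeInstance]
      set N := x.length + 1 with hN
      have hN1 : 1 ≤ N := by omega
      set G := k + 2 + C * f k with hG
      have hNc : 1 ≤ N ^ c := Nat.one_le_pow _ _ hN1
      have hL : y.length + k' + 2 ≤ G * N ^ (c + 1) := by
        have e1 : C * t ≤ C * f k * N ^ c := by
          rw [mul_assoc]; exact Nat.mul_le_mul_left _ htle
        have e2 : N ^ c ≤ N ^ (c + 1) := Nat.pow_le_pow_right hN1 (by omega)
        have e3 : N ≤ N ^ (c + 1) := Nat.le_self_pow (by omega) N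
        have e4 : C * f k * N ^ c ≤ C * f k * N ^ (c + 1) := Nat.mul_le_mul_left _ e2
        have e5 : k + x.length + 2 ≤ (k + 2) * N := by
          rw [hN]; nlinarith
        have e6 : (k + 2) * N ≤ (k + 2) * N ^ (c + 1) := Nat.mul_le_mul_left _ e3
        rw [hG, add_mul]
        omega
      set L := y.length + k' + 2 with hL_def
      have e1 : L ≤ L ^ (c' + 1) := Nat.le_self_pow (by omega) L
      have e2 : L ^ c' ≤ L ^ (c' + 1) := Nat.pow_le_pow_right (by omega) (by omega)
      have e3 : L ^ (c' + 1) ≤ G ^ (c' + 1) * N ^ ((c + 1) * (c' + 1)) := by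
        rw [pow_mul, ← mul_pow]
        exact Nat.pow_le_pow_left hL _
      have e4 : N ^ c ≤ N ^ ((c + 1) * (c' + 1)) := Nat.pow_le_pow_right hN1 (by nlinarith)
      have e5 : t ≤ f k * N ^ ((c + 1) * (c' + 1)) := htle.trans (Nat.mul_le_mul_left _ e4)
      have e6 : (f k + 2 * G ^ (c' + 1)) * N ^ ((c + 1) * (c' + 1))
          = f k * N ^ ((c + 1) * (c' + 1))
            + 2 * (G ^ (c' + 1) * N ^ ((c + 1) * (c' + 1))) := by ring
      rw [e6]
      omega

end FPT

/-! ### Functions of a word, a parameter and further numbers that are given by expressions -/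

/-- A word together with a parameter. -/
structure WordInst : Type where
  word : List Bool
  param : ℕ

/-- A type of contexts in which expressions are evaluated. -/
class ExprCtx (X : Type) where
  word : X → List Bool
  env : X → List ℕ

instance : ExprCtx WordInst where
  word := WordInst.word
  env p := [p.word.length, p.param]

instance {X : Type} [ExprCtx X] : ExprCtx (X × ℕ) where
  word p := ExprCtx.word p.1
  env p := p.2 :: ExprCtx.env p.1

/-- The function `F` is given by an expression. -/
def Expressible {X : Type} [ExprCtx X] (F : X → ℕ) : Prop :=
  ∃ e : UExpr, ∀ x, e.eval (ExprCtx.word x) (ExprCtx.env x) = F x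

/-- The predicate `P` is given by an expression, whose value is nonzero where `P` holds. -/
def ExpressibleP {X : Type} [ExprCtx X] (P : X → Prop) : Prop :=
  ∃ F, Expressible F ∧ ∀ x, F x ≠ 0 ↔ P x

namespace UExpr

/-- Make room for a new variable with index `c`. -/
def lift : UExpr → ℕ → UExpr
  | var i, c => if i < c then var i else var (i + 1)
  | const n, _ => const n
  | add a b, c => add (a.lift c) (b.lift c)
  | monus a b, c => monus (a.lift c) (b.lift c)
  | sum a b, c => sum (a.lift c) (b.lift (c + 1))
  | bit a, c => bit (a.lift c)

/-- The new variable is inserted at an arbitrary depth, because the body of a sum lies under one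
more binder. -/
theorem eval_lift (w : List Bool) (e : UExpr) (v v' : List ℕ) (n : ℕ) :
    (e.lift v.length).eval w (v ++ n :: v') = e.eval w (v ++ v') := by
  induction e generalizing v with
  | var i =>
    simp only [lift]
    split_ifs with h
    · simp only [eval]
      rw [List.getD_append _ _ _ _ h, List.getD_append _ _ _ _ h]
    · simp only [eval]
      rw [List.getD_append_right _ _ _ _ (by omega), List.getD_append_right _ _ _ _ (by omega),
        show i + 1 - v.length = (i - v.length) + 1 by omega]
      rfl
  | const c => rfl
  | add a b iha ihb => simp only [lift, eval, iha, ihb]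
  | monus a b iha ihb => simp only [lift, eval, iha, ihb]
  | sum a b iha ihb =>
    simp only [lift, eval, iha]
    exact Finset.sum_congr rfl fun i _ => ihb (i :: v)
  | bit a iha => simp only [lift, eval, iha]

end UExpr

section Expressible

variable {X : Type} [ExprCtx X]

theorem Expressible.congr {F G : X → ℕ} (h : Expressible F) (hFG : ∀ x, F x = G x) :
    Expressible G := funext hFG ▸ h

theorem ExpressibleP.congr {P Q : X → Prop} (h : ExpressibleP P) (hPQ : ∀ x, P x ↔ Q x) :
    ExpressibleP Q := (funext fun x => propext (hPQ x) : P = Q) ▸ h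

theorem expressible_const (c : ℕ) : Expressible fun _ : X => c := ⟨.const c, fun _ => rfl⟩

theorem expressible_param : Expressible WordInst.param := ⟨.var 1, fun _ => rfl⟩

theorem expressible_length : Expressible fun x : WordInst => x.word.length :=
  ⟨.var 0, fun _ => rfl⟩

theorem expressible_snd : Expressible fun p : X × ℕ => p.2 := ⟨.var 0, fun _ => rfl⟩

theorem Expressible.weaken {F : X → ℕ} (h : Expressible F) : Expressible fun p : X × ℕ => F p.1 := by
  obtain ⟨e, he⟩ := h
  exact ⟨e.lift 0, fun p => (e.eval_lift _ [] _ _).trans (he p.1)⟩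

theorem Expressible.add {F G : X → ℕ} (hF : Expressible F) (hG : Expressible G) :
    Expressible fun x => F x + G x := by
  obtain ⟨e, he⟩ := hF
  obtain ⟨e', he'⟩ := hG
  exact ⟨.add e e', fun x => by rw [UExpr.eval, he, he']⟩

theorem Expressible.sub {F G : X → ℕ} (hF : Expressible F) (hG : Expressible G) :
    Expressible fun x => F x - G x := by
  obtain ⟨e, he⟩ := hF
  obtain ⟨e', he'⟩ := hG
  exact ⟨.monus e e', fun x => by rw [UExpr.eval, he, he']⟩

theorem Expressible.sum {F : X → ℕ} {G : X → ℕ → ℕ} (hF : Expressible F)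
    (hG : Expressible fun p : X × ℕ => G p.1 p.2) :
    Expressible fun x => ∑ i ∈ Finset.range (F x), G x i := by
  obtain ⟨e, he⟩ := hF
  obtain ⟨e', he'⟩ := hG
  exact ⟨.sum e e', fun x => by
    rw [UExpr.eval, he]
    exact Finset.sum_congr rfl fun i _ => he' (x, i)⟩

/-- A product is a sum of `F x` equal terms. -/
theorem Expressible.mul {F G : X → ℕ} (hF : Expressible F) (hG : Expressible G) :
    Expressible fun x => F x * G x :=
  (Expressible.sum hF (G := fun x _ => G x) hG.weaken).congr fun x => by simp

theorem Expressible.pow {F : X → ℕ} (hF : Expressible F) (c : ℕ) :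
    Expressible fun x => F x ^ c := by
  induction c with
  | zero => exact (expressible_const 1).congr fun x => by simp
  | succ c ih => exact (ih.mul hF).congr fun x => by rw [pow_succ]

/-- Truncated subtraction turns any nonzero value into `1`, since `1 - (1 - F)` is the sign of `F`.
-/
theorem ExpressibleP.indicator {P : X → Prop} (h : ExpressibleP P) [∀ x, Decidable (P x)] :
    Expressible fun x => if P x then 1 else 0 := by
  obtain ⟨F, hF, h⟩ := h
  refine ((expressible_const 1).sub ((expressible_const 1).sub hF)).congr fun x => ?_
  have := h x
  split_ifs with hx
  · have := this.2 hx; omega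
  · have : F x = 0 := by by_contra h'; exact hx (this.1 h')
    omega

theorem ExpressibleP.not {P : X → Prop} (h : ExpressibleP P) : ExpressibleP fun x => ¬ P x := by
  obtain ⟨F, hF, h⟩ := h
  refine ⟨_, (expressible_const 1).sub hF, fun x => ?_⟩
  change _ ↔ ¬ P x
  rw [← h x]; omega

theorem ExpressibleP.and {P Q : X → Prop} (hP : ExpressibleP P) (hQ : ExpressibleP Q) :
    ExpressibleP fun x => P x ∧ Q x := by
  obtain ⟨F, hF, hP⟩ := hP
  obtain ⟨G, hG, hQ⟩ := hQ
  exact ⟨_, hF.mul hG, fun x => by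
    change _ ↔ P x ∧ Q x
    rw [← hP, ← hQ]; exact mul_ne_zero_iff⟩

theorem ExpressibleP.or {P Q : X → Prop} (hP : ExpressibleP P) (hQ : ExpressibleP Q) :
    ExpressibleP fun x => P x ∨ Q x :=
  (hP.not.and hQ.not).not.congr fun x => by tauto

theorem ExpressibleP.imp {P Q : X → Prop} (hP : ExpressibleP P) (hQ : ExpressibleP Q) :
    ExpressibleP fun x => P x → Q x :=
  (hP.not.or hQ).congr fun x => by tauto

theorem ExpressibleP.iff {P Q : X → Prop} (hP : ExpressibleP P) (hQ : ExpressibleP Q) :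
    ExpressibleP fun x => (P x ↔ Q x) :=
  ((hP.imp hQ).and (hQ.imp hP)).congr fun x => by tauto

theorem expressibleP_const (P : Prop) : ExpressibleP fun _ : X => P := by
  by_cases h : P
  · exact ⟨_, expressible_const 1, fun x => by simp [h]⟩
  · exact ⟨_, expressible_const 0, fun x => by simp [h]⟩

theorem Expressible.le {F G : X → ℕ} (hF : Expressible F) (hG : Expressible G) :
    ExpressibleP fun x => F x ≤ G x :=
  (ExpressibleP.not (P := fun x => F x - G x ≠ 0)
    ⟨_, hF.sub hG, fun _ => Iff.rfl⟩).congr fun x => by omega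

theorem Expressible.lt {F G : X → ℕ} (hF : Expressible F) (hG : Expressible G) :
    ExpressibleP fun x => F x < G x :=
  (hG.le hF).not.congr fun x => by omega

theorem Expressible.eq {F G : X → ℕ} (hF : Expressible F) (hG : Expressible G) :
    ExpressibleP fun x => F x = G x :=
  ((hF.le hG).and (hG.le hF)).congr fun x => by omega

theorem Expressible.bit {F : X → ℕ} (hF : Expressible F) :
    ExpressibleP fun x => (ExprCtx.word x).getD (F x) false = true := by
  obtain ⟨e, he⟩ := hF
  refine ⟨fun x => if (ExprCtx.word x).getD (F x) false then 1 else 0,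
    ⟨.bit e, fun x => by rw [UExpr.eval, he]⟩, fun x => ?_⟩
  simp

theorem ExpressibleP.ball {F : X → ℕ} {P : X → ℕ → Prop} (hF : Expressible F)
    (hP : ExpressibleP fun p : X × ℕ => P p.1 p.2) :
    ExpressibleP fun x => ∀ i < F x, P x i := by
  classical
  refine ((Expressible.sum hF (G := fun x i => if ¬ P x i then 1 else 0)
    hP.not.indicator).eq (expressible_const 0)).congr fun x => ?_
  simp

theorem ExpressibleP.ite {P : X → Prop} {F G : X → ℕ} (hP : ExpressibleP P) (hF : Expressible F)
    (hG : Expressible G) [∀ x, Decidable (P x)] :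
    Expressible fun x => if P x then F x else G x := by
  classical
  refine ((hP.indicator.mul hF).add (hP.not.indicator.mul hG)).congr fun x => ?_
  by_cases h : P x <;> simp [h]

/-- The quotient is the number of `i` with `(i + 1) * G ≤ F`. The condition `0 < G` makes this
number `0` for a zero divisor, in accordance with division on `ℕ`. -/
theorem Expressible.div {F G : X → ℕ} (hF : Expressible F) (hG : Expressible G) :
    Expressible fun x => F x / G x := by
  have h : ExpressibleP fun p : X × ℕ => 0 < G p.1 ∧ (p.2 + 1) * G p.1 ≤ F p.1 :=
    ((expressible_const 0).lt hG.weaken).and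
      (((expressible_snd.add (expressible_const 1)).mul hG.weaken).le hF.weaken)
  refine (Expressible.sum hF (G := fun x i => if 0 < G x ∧ (i + 1) * G x ≤ F x then 1 else 0)
    h.indicator).congr fun x => ?_
  rw [Finset.sum_boole, Nat.cast_id]
  rcases Nat.eq_zero_or_pos (G x) with h0 | h0
  · simp [h0]
  · have : (Finset.range (F x)).filter (fun i => 0 < G x ∧ (i + 1) * G x ≤ F x)
        = Finset.range (F x / G x) := by
      ext i
      simp only [Finset.mem_filter, Finset.mem_range]
      rw [← Nat.le_div_iff_mul_le h0]
      have := Nat.div_le_self (F x) (G x)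
      constructor
      · rintro ⟨-, -, h⟩; omega
      · intro h; exact ⟨by omega, h0, h⟩
    rw [this, Finset.card_range]

theorem Expressible.mod {F G : X → ℕ} (hF : Expressible F) (hG : Expressible G) :
    Expressible fun x => F x % G x :=
  (hF.sub (hG.mul (hF.div hG))).congr fun x => by
    have := Nat.div_add_mod (F x) (G x)
    omega

theorem expressible_finset_sum {ι : Type} (s : Finset ι) {F : ι → X → ℕ}
    (h : ∀ i, Expressible (F i)) : Expressible fun x => ∑ i ∈ s, F i x := by
  classical
  induction s using Finset.induction_on with
  | empty => exact (expressible_const 0).congr fun x => by simp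
  | insert i s hi ih => exact ((h i).add ih).congr fun x => by rw [Finset.sum_insert hi]

theorem expressibleP_forall {ι : Type} [Finite ι] {P : ι → X → Prop}
    (h : ∀ i, ExpressibleP (P i)) : ExpressibleP fun x => ∀ i, P i x := by
  classical
  have := Fintype.ofFinite ι
  refine ((expressible_finset_sum Finset.univ fun i => (h i).not.indicator).eq
    (expressible_const 0)).congr fun x => ?_
  simp

end Expressible

/-! ### Teams of minimal size and transversal cliques -/

/-- A symmetric relation of size `K ^ 2` in which the colours of the neighbours of every vertex run
through all `K` colours cyclically is complete on a transversal of the colours. -/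
theorem exists_transversal {V : Type} [Finite V] (P : Set (V × V)) (col : V → ℕ) {K : ℕ}
    (hK : 0 < K) (hcol : ∀ v, col v < K) (hsymm : ∀ x y, (x, y) ∈ P → (y, x) ∈ P)
    (hnext : ∀ x y, (x, y) ∈ P → ∃ z, (x, z) ∈ P ∧ col z = (col y + 1) % K)
    (hcard : P.encard = (K ^ 2 : ℕ)) :
    ∃ U : Fin K → V, (∀ c, col (U c) = c) ∧ ∀ c c', (U c, U c') ∈ P := by
  have hall : ∀ x y, (x, y) ∈ P → ∀ c : Fin K, ∃ z, (x, z) ∈ P ∧ col z = c := by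
    intro x y hxy c
    have hstep : ∀ i, ∃ z, (x, z) ∈ P ∧ col z = (col y + i) % K := by
      intro i
      induction i with
      | zero => exact ⟨y, hxy, by rw [add_zero, Nat.mod_eq_of_lt (hcol y)]⟩
      | succ i ih =>
        obtain ⟨z, hz, hz'⟩ := ih
        obtain ⟨z', h1, h2⟩ := hnext x z hz
        exact ⟨z', h1, by rw [h2, hz', Nat.mod_add_mod, add_assoc]⟩
    -- Starting from the colour of `y`, this number of cyclic steps ends at the colour `c`; the
    -- subtraction is exact because `col y < K`.
    obtain ⟨z, hz, hz'⟩ := hstep (c + (K - col y))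
    refine ⟨z, hz, ?_⟩
    have := hcol y
    rw [hz', show col y + (c + (K - col y)) = c + K by omega, Nat.add_mod_right,
      Nat.mod_eq_of_lt c.2]
  have hne : P.Nonempty := by
    rw [← Set.encard_pos, hcard]
    exact_mod_cast Nat.pow_pos hK
  obtain ⟨⟨x₀, y₀⟩, h0⟩ := hne
  choose z hz hzc using hall x₀ y₀ h0
  have hz' : ∀ c, (z c, x₀) ∈ P := fun c => hsymm _ _ (hz c)
  choose y hy hyc using fun c => hall (z c) x₀ (hz' c)
  -- The vertex `x₀` has a neighbour `z a` of every colour `a`, and each `z a` has a neighbour `y a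
  -- b` of every colour `b`. These `K ^ 2` pairs are distinct, as their colours show, so they
  -- exhaust `P`.
  let f : Fin K × Fin K → V × V := fun c => (z c.1, y c.1 c.2)
  have hf : Function.Injective f := by
    rintro ⟨a, b⟩ ⟨a', b'⟩ h
    obtain ⟨h1, h2⟩ := Prod.mk.inj h
    simp only at h1 h2
    have ha : a = a' := Fin.ext (by rw [← hzc a, ← hzc a', h1])
    subst ha
    exact Prod.ext rfl (Fin.ext (by rw [← hyc a b, ← hyc a b', h2]))
  have hrange : Set.range f = P := by
    refine Set.Finite.eq_of_subset_of_encard_le (Set.toFinite _) ?_ ?_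
    · rintro _ ⟨⟨a, b⟩, rfl⟩
      exact hy a b
    · rw [hcard, ← Set.image_univ, hf.encard_image, Set.encard_univ]
      simp [sq]
  refine ⟨z, hzc, fun c c' => ?_⟩
  -- By symmetry `y c c'` occurs as a first component in `P`, so it is some `z a`. Its colour gives
  -- `a = c'`, hence `z c` is joined to `z c'`.
  have h1 := hsymm _ _ (hy c c')
  rw [← hrange] at h1
  obtain ⟨⟨a, b⟩, hab⟩ := h1
  have h2 : z a = y c c' := (Prod.mk.inj hab).1
  have h3 : a = c' := Fin.ext (by rw [← hzc a, h2, hyc])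
  rw [← h3, h2]
  exact hy c c'

theorem encard_transversal {V : Type} (col : V → ℕ) {K : ℕ} (U : Fin K → V)
    (hU : ∀ c, col (U c) = c) :
    (Set.range fun c : Fin K × Fin K => (U c.1, U c.2)).encard = (K ^ 2 : ℕ) := by
  have hinj : Function.Injective U := fun a b h => Fin.ext (by rw [← hU a, h, hU])
  rw [← Set.image_univ, Function.Injective.encard_image, Set.encard_univ]
  · simp [sq]
  · exact hinj.prodMap hinj

/-! ### Counting violations by inclusion and exclusion -/

/-- Sort the words `g` by their bit patterns. For a fixed pattern `β` the sum of products factors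
over the positions into the indicators of `b a = β a`, so only the pattern `b` survives. -/
theorem sum_pattern {ι J : Type} [Fintype ι] [DecidableEq ι] [Fintype J]
    (bit : J → Bool) (Φ : (ι → Bool) → ℤ) (f : ι → J → ℤ) (b : ι → Bool)
    (h : ∀ a t, ∑ j, (if bit j = t then f a j else 0) = if b a = t then 1 else 0) :
    ∑ g : ι → J, Φ (fun a => bit (g a)) * ∏ a, f a (g a) = Φ b := by
  have h1 : ∀ g : ι → J, Φ (fun a => bit (g a)) * ∏ a, f a (g a)
      = ∑ β : ι → Bool, Φ β * ∏ a, (if bit (g a) = β a then f a (g a) else 0) := by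
    intro g
    rw [Finset.sum_eq_single fun a => bit (g a)]
    · simp
    · intro β _ hβ
      obtain ⟨a, ha⟩ := Function.ne_iff.1 hβ
      rw [Finset.prod_eq_zero (Finset.mem_univ a) (if_neg fun h => ha h.symm), mul_zero]
    · simp
  simp only [h1]
  rw [Finset.sum_comm]
  have h2 : ∀ β : ι → Bool,
      ∑ g : ι → J, Φ β * ∏ a, (if bit (g a) = β a then f a (g a) else 0)
        = if b = β then Φ β else 0 := by
    intro β
    have h3 := Finset.prod_univ_sum (fun _ : ι => (Finset.univ : Finset J))
      (fun a j => if bit j = β a then f a j else 0)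
    rw [Fintype.piFinset_univ] at h3
    rw [← Finset.mul_sum, ← h3]
    simp only [h]
    rw [Finset.prod_boole]
    simp [funext_iff]
  simp only [h2]
  simp

/-- The bit that is encoded by a digit below `2 * k + 1`. -/
def digitBit (k d : ℕ) : Bool := decide (1 ≤ d ∧ d ≤ k)

/-- The index below `k` that is encoded by a positive digit below `2 * k + 1`. -/
def digitIdx (k d : ℕ) : ℕ := if d ≤ k then d - 1 else d - 1 - k

/-- As the `w i` are distinct, `∑ i, [x = w i]` is the indicator of membership. The digits `1, …, k`
carry its terms for the bit `true`; the digit `0` carries `1` and the digits `k + 1, …, 2 * k` carry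
the negated terms for the bit `false`. -/
theorem sum_digit {k x : ℕ} {w : ℕ → ℕ} (hw : Set.InjOn w (Set.Iio k)) (t : Bool) :
    ∑ j : Fin (2 * k + 1), (if digitBit k j = t then
      (if (j : ℕ) ≠ 0 then (if x = w (digitIdx k j) then (if k < j then (-1 : ℤ) else 1) else 0)
        else 1) else 0) = if decide (∃ i < k, x = w i) = t then 1 else 0 := by
  have hS : ∑ i ∈ Finset.range k, (if x = w i then (1 : ℤ) else 0)
      = if ∃ i < k, x = w i then 1 else 0 := by
    split_ifs with h
    · obtain ⟨i, hi, rfl⟩ := h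
      rw [Finset.sum_eq_single_of_mem i (Finset.mem_range.2 hi), if_pos rfl]
      intro j hj hji
      exact if_neg fun h => hji (hw (Finset.mem_range.1 hj) hi h.symm)
    · refine Finset.sum_eq_zero fun i hi => if_neg fun h' => h ⟨i, Finset.mem_range.1 hi, h'⟩
  rw [Fin.sum_univ_eq_sum_range (fun j => if digitBit k j = t then
      (if j ≠ 0 then (if x = w (digitIdx k j) then (if k < j then (-1 : ℤ) else 1) else 0)
        else 1) else 0), Finset.sum_range_succ', two_mul, Finset.sum_range_add]
  have h1 : ∀ i ∈ Finset.range k, (if digitBit k (i + 1) = t then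
      (if i + 1 ≠ 0 then (if x = w (digitIdx k (i + 1)) then
        (if k < i + 1 then (-1 : ℤ) else 1) else 0) else 1) else 0)
        = if t then (if x = w i then 1 else 0) else 0 := by
    intro i hi
    have hi := Finset.mem_range.1 hi
    have e1 : digitBit k (i + 1) = true := decide_eq_true ⟨by omega, by omega⟩
    have e2 : digitIdx k (i + 1) = i := by rw [digitIdx, if_pos (by omega)]; omega
    rw [e1, e2, if_pos (Nat.succ_ne_zero i), if_neg (show ¬ k < i + 1 by omega)]
    cases t <;> simp
  have h2 : ∀ i ∈ Finset.range k, (if digitBit k (k + i + 1) = t then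
      (if k + i + 1 ≠ 0 then (if x = w (digitIdx k (k + i + 1)) then
        (if k < k + i + 1 then (-1 : ℤ) else 1) else 0) else 1) else 0)
        = if t then 0 else -(if x = w i then 1 else 0) := by
    intro i hi
    have hi := Finset.mem_range.1 hi
    have e1 : digitBit k (k + i + 1) = false := decide_eq_false (by omega)
    have e2 : digitIdx k (k + i + 1) = i := by rw [digitIdx, if_neg (by omega)]; omega
    rw [e1, e2, if_pos (Nat.succ_ne_zero _), if_pos (show k < k + i + 1 by omega)]
    cases t <;> simp [apply_ite]
  have e0 : digitBit k 0 = false := decide_eq_false (by omega)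
  rw [Finset.sum_congr rfl h1, Finset.sum_congr rfl h2, e0]
  clear h1 h2
  by_cases h : ∃ i < k, x = w i
  · rw [if_pos h] at hS
    rw [decide_eq_true h]
    cases t <;> simp [hS]
  · rw [if_neg h] at hS
    rw [decide_eq_false h]
    cases t <;> simp [hS]

/-- The digit of `c` at position `a` in base `b`. -/
def digitAt (b c a : ℕ) : ℕ := c / b ^ a % b

theorem exists_digitAt {b m : ℕ} (v : Fin m → ℕ) (hv : ∀ a, v a < b) :
    ∃ q < b ^ m, ∀ a : Fin m, digitAt b q a = v a :=
  ⟨finFunctionFinEquiv fun a => ⟨v a, hv a⟩, Fin.is_lt _, fun a => by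
    have := finFunctionFinEquiv_symm_apply_val (finFunctionFinEquiv fun a => ⟨v a, hv a⟩) a
    rw [Equiv.symm_apply_apply] at this
    exact this.symm⟩

section Violations

variable (k m X : ℕ) (α : ℕ → (Fin m → Bool) → Prop) (code : ℕ → Fin m → ℕ)

open Classical in
/-- The number of `x < X` that violate the constraint `α` for the bits described by `c`, and whose
codes agree with `v` where `c` prescribes it. -/
noncomputable def violCount (c : ℕ) (v : Fin m → ℕ) : ℕ :=
  ∑ x ∈ Finset.range X, if ¬ α x (fun a => digitBit k (digitAt (2 * k + 1) c a)) ∧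
    ∀ a : Fin m, digitAt (2 * k + 1) c a ≠ 0 → code x a = v a then 1 else 0

/-- The number of digits of `c` that stand for a negative term. -/
def negDigits (c : ℕ) : ℕ := ∑ a : Fin m, if k < digitAt (2 * k + 1) c a then 1 else 0

open Classical in
-- The number of violations is expanded with one digit for each atom. The term for `c` involves `w`
-- only at the indices named by the nonzero digits of `c`, at most `m` of them, so it can be
-- computed from the vector `v c` alone. This locality is what a single vertex can store.
theorem sum_violCount {w : ℕ → ℕ} (hw : Set.InjOn w (Set.Iio k)) (v : ℕ → Fin m → ℕ)
    (hv : ∀ c < (2 * k + 1) ^ m, ∀ a : Fin m, digitAt (2 * k + 1) c a ≠ 0 →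
      v c a = w (digitIdx k (digitAt (2 * k + 1) c a))) :
    ∑ c ∈ Finset.range ((2 * k + 1) ^ m),
      (-1 : ℤ) ^ negDigits k m c * (violCount k m X α code c (v c) : ℤ)
      = ∑ x ∈ Finset.range X,
        if ¬ α x (fun a => decide (∃ i < k, code x a = w i)) then 1 else 0 := by
  let f : ℕ → Fin m → Fin (2 * k + 1) → ℤ := fun x a j =>
    if (j : ℕ) ≠ 0 then (if code x a = w (digitIdx k j) then (if k < j then (-1 : ℤ) else 1) else 0)
      else 1
  have h1 : ∀ c ∈ Finset.range ((2 * k + 1) ^ m),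
      (-1 : ℤ) ^ negDigits k m c * (violCount k m X α code c (v c) : ℤ)
      = ∑ x ∈ Finset.range X, (if ¬ α x (fun a => digitBit k (digitAt (2 * k + 1) c a))
        then 1 else 0) * ∏ a, f x a ⟨digitAt (2 * k + 1) c a, Nat.mod_lt _ (by omega)⟩ := by
    intro c hc
    rw [violCount, Nat.cast_sum, Finset.mul_sum]
    refine Finset.sum_congr rfl fun x _ => ?_
    by_cases h : α x (fun a => digitBit k (digitAt (2 * k + 1) c a))
    · simp [h]
    by_cases h' : ∀ a : Fin m, digitAt (2 * k + 1) c a ≠ 0 → code x a = v c a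
    · rw [if_pos ⟨h, h'⟩, if_pos h, negDigits, Finset.prod_pow_eq_pow_sum _ _ _ |>.symm, one_mul,
        Nat.cast_one, mul_one]
      refine Finset.prod_congr rfl fun a _ => ?_
      simp only [f]
      by_cases h0 : digitAt (2 * k + 1) c a = 0
      · simp [h0]
      · rw [if_pos h0, if_pos (show code x a = w (digitIdx k (digitAt (2 * k + 1) c a)) from
          (h' a h0).trans (hv c (Finset.mem_range.1 hc) a h0))]
        split_ifs <;> simp
    · rw [if_neg fun h'' => h' h''.2]
      push Not at h'
      obtain ⟨a, ha, ha'⟩ := h'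
      rw [Finset.prod_eq_zero (Finset.mem_univ a), mul_zero, Nat.cast_zero, mul_zero]
      simp only [f]
      rw [if_pos ha, if_neg (by rw [← hv c (Finset.mem_range.1 hc) a ha]; exact ha')]
  rw [Finset.sum_congr rfl h1, Finset.sum_comm]
  refine Finset.sum_congr rfl fun x _ => ?_
  -- The numbers `c` below `(2 * k + 1) ^ m` are identified with their strings of `m` digits, over
  -- which `sum_pattern` sums.
  rw [← sum_pattern (fun j : Fin (2 * k + 1) => digitBit k j)
    (fun β => if ¬ α x β then (1 : ℤ) else 0) (f x) _ fun a t => sum_digit hw t,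
    ← Fin.sum_univ_eq_sum_range (fun c => (if ¬ α x (fun a : Fin m =>
        digitBit k (digitAt (2 * k + 1) c a)) then (1 : ℤ) else 0) *
      ∏ a : Fin m, f x a ⟨digitAt (2 * k + 1) c a, Nat.mod_lt _ (by omega)⟩),
    ← finFunctionFinEquiv.symm.sum_comp]
  rfl

end Violations

-- The coloured graph of codes and partial sums.

section Clique

variable (k m X D : ℕ) (α : ℕ → (Fin m → Bool) → Prop) (code : ℕ → Fin m → ℕ)

/-- The colour of a vertex. -/
def vtxColour (u : ℕ) : ℕ := u % (2 * k + 1) ^ m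

/-- The partial sum stored in a vertex. -/
def vtxSum (u : ℕ) : ℕ := u / (2 * k + 1) ^ m % (X + 1)

/-- The codes stored in a vertex. -/
def vtxCode (u : ℕ) (a : Fin m) : ℕ := digitAt D (u / ((2 * k + 1) ^ m * (X + 1))) a

/-- The number of vertices. -/
def vtxCount : ℕ := (2 * k + 1) ^ m * (X + 1) * D ^ m

/-- The number of violations counted at a vertex. -/
noncomputable def vtxViol (u : ℕ) : ℕ :=
  violCount k m X α code (vtxColour k m u) (vtxCode k m X D u)

/-- The digits of the colour of a vertex. -/
def vtxDigit (u : ℕ) (a : Fin m) : ℕ := digitAt (2 * k + 1) (vtxColour k m u) a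

/-- The edges of the graph whose transversal cliques are the solutions of the constraints. -/
def CliqueEdge (u w : ℕ) : Prop :=
  (vtxColour k m u = vtxColour k m w → u = w) ∧
  (∀ a b : Fin m, vtxDigit k m u a ≠ 0 → vtxDigit k m w b ≠ 0 →
    (digitIdx k (vtxDigit k m u a) = digitIdx k (vtxDigit k m w b) ↔
      vtxCode k m X D u a = vtxCode k m X D w b)) ∧
  (vtxColour k m w = (vtxColour k m u + 1) % (2 * k + 1) ^ m →
    if negDigits k m (vtxColour k m u) % 2 = 1 then
      (vtxSum k m X w + vtxViol k m X D α code u) % (X + 1) = vtxSum k m X u % (X + 1)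
    else vtxSum k m X w % (X + 1) = (vtxSum k m X u + vtxViol k m X D α code u) % (X + 1))

variable {k m X D α code}

/-- The left side avoids signs by adding a negative term on the other side, which makes it an
arithmetic condition on natural numbers. The right side is the same recurrence for partial sums in
`ZMod (X + 1)`. -/
theorem vtx_step_iff (e a b c : ℕ) :
    (if e % 2 = 1 then (a + c) % (X + 1) = b % (X + 1) else a % (X + 1) = (b + c) % (X + 1)) ↔
      (a : ZMod (X + 1)) = b + (-1) ^ e * c := by
  split_ifs with h
  · rw [← ZMod.natCast_eq_natCast_iff', (Nat.odd_iff.2 h).neg_one_pow]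
    push_cast
    constructor
    · intro h; rw [← h]; ring
    · intro h; rw [h]; ring
  · rw [← ZMod.natCast_eq_natCast_iff', (Nat.even_iff.2 (by omega)).neg_one_pow]
    push_cast
    rw [one_mul]

/-- A vertex is a number in mixed radix: `u = c + K * (σ + (X + 1) * q)` with `K = (2 * k + 1) ^ m`,
where the base-`D` digits of `q` are the codes. -/
theorem exists_vertex {c σ : ℕ} {v : Fin m → ℕ} (hc : c < (2 * k + 1) ^ m) (hσ : σ < X + 1)
    (hv : ∀ a, v a < D) : ∃ u < vtxCount k m X D,
      vtxColour k m u = c ∧ vtxSum k m X u = σ ∧ vtxCode k m X D u = v := by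
  obtain ⟨q, hq, hqv⟩ := exists_digitAt v hv
  set K := (2 * k + 1) ^ m with hK
  have hK0 : 0 < K := by omega
  have h1 : (c + K * (σ + (X + 1) * q)) / K = σ + (X + 1) * q := by
    rw [Nat.add_mul_div_left _ _ hK0, Nat.div_eq_of_lt hc, zero_add]
  refine ⟨c + K * (σ + (X + 1) * q), ?_, ?_, ?_, ?_⟩
  · unfold vtxCount
    rw [← hK]
    calc c + K * (σ + (X + 1) * q) < K + K * (σ + (X + 1) * q) := by omega
      _ = K * (σ + 1 + (X + 1) * q) := by ring
      _ ≤ K * ((X + 1) * (q + 1)) := Nat.mul_le_mul_left _ (by nlinarith)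
      _ ≤ K * ((X + 1) * D ^ m) := Nat.mul_le_mul_left _ (Nat.mul_le_mul_left _ hq)
      _ = K * (X + 1) * D ^ m := by ring
  · unfold vtxColour
    rw [← hK, Nat.add_mul_mod_self_left, Nat.mod_eq_of_lt hc]
  · unfold vtxSum
    rw [← hK, h1, Nat.add_mul_mod_self_left, Nat.mod_eq_of_lt hσ]
  · funext a
    unfold vtxCode
    rw [← hK, ← Nat.div_div_eq_div_mul, h1, Nat.add_mul_div_left _ _ (by omega),
      Nat.div_eq_of_lt hσ, zero_add, hqv]

theorem sum_range_rotate {G : Type} [AddCommGroup G] {K : ℕ} (hK : 0 < K) (F : ℕ → G) :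
    ∑ c ∈ Finset.range K, F ((c + 1) % K) = ∑ c ∈ Finset.range K, F c := by
  obtain ⟨K, rfl⟩ := Nat.exists_eq_succ_of_ne_zero hK.ne'
  rw [Finset.sum_range_succ, Finset.sum_range_succ', Nat.succ_eq_add_one, Nat.mod_self]
  congr 1
  refine Finset.sum_congr rfl fun c hc => ?_
  rw [Nat.mod_eq_of_lt (by have := Finset.mem_range.1 hc; omega)]

theorem digitIdx_lt {d : ℕ} (hd : d < 2 * k + 1) (h0 : d ≠ 0) : digitIdx k d < k := by
  unfold digitIdx
  split_ifs <;> omega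

/-- The graph has a clique with one vertex of each colour if and only if the constraints have a
solution with `k` elements. -/
theorem exists_clique_iff (hm : 0 < m) (hD : 0 < D) :
    (∃ U : Fin ((2 * k + 1) ^ m) → ℕ, (∀ c, U c < vtxCount k m X D ∧ vtxColour k m (U c) = c) ∧
      ∀ c c', CliqueEdge k m X D α code (U c) (U c')) ↔
    ∃ w : ℕ → ℕ, (∀ i < k, w i < D) ∧ Set.InjOn w (Set.Iio k) ∧
      ∀ x < X, α x fun a => decide (∃ i < k, code x a = w i) := by
  classical
  set K := (2 * k + 1) ^ m with hK
  have hK0 : 0 < K := Nat.pow_pos (by omega)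
  constructor
  · rintro ⟨U, hU, hE⟩
    -- The colour `q i` has all its digits equal to `i + 1`, which stands for the index `i`. The
    -- vertex of this colour therefore names the `i`-th element of the solution.
    have hq : ∀ i : ℕ, ∃ q, i < k → ∃ hq : q < K, ∀ a : Fin m, digitAt (2 * k + 1) q a = i + 1 := by
      intro i
      by_cases hi : i < k
      · obtain ⟨q, hq, h⟩ := exists_digitAt (b := 2 * k + 1) (fun _ : Fin m => i + 1)
          (fun _ => by omega)
        exact ⟨q, fun _ => ⟨hq, h⟩⟩
      · exact ⟨0, fun h => absurd h hi⟩
    choose q hq using hq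
    let a₀ : Fin m := ⟨0, hm⟩
    have hdig : ∀ (c : Fin K) (a : Fin m), vtxDigit k m (U c) a = digitAt (2 * k + 1) c a :=
      fun c a => by rw [vtxDigit, (hU c).2]
    have hqd : ∀ i (hi : i < k) (a : Fin m),
        vtxDigit k m (U ⟨q i, (hq i hi).1⟩) a = i + 1 := fun i hi a => by
      rw [hdig]; exact (hq i hi).2 a
    have hidx : ∀ i < k, digitIdx k (i + 1) = i := fun i hi => by
      rw [digitIdx, if_pos (by omega)]; omega
    let w : ℕ → ℕ := fun i => if hi : i < k then vtxCode k m X D (U ⟨q i, (hq i hi).1⟩) a₀ else 0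
    have hw : ∀ i (hi : i < k), w i = vtxCode k m X D (U ⟨q i, (hq i hi).1⟩) a₀ :=
      fun i hi => dif_pos hi
    have hwinj : Set.InjOn w (Set.Iio k) := by
      intro i hi j hj hij
      have h := (hE ⟨q i, (hq i hi).1⟩ ⟨q j, (hq j hj).1⟩).2.1 a₀ a₀
      rw [hqd i hi, hqd j hj, hidx i hi, hidx j hj, ← hw i hi, ← hw j hj] at h
      exact (h (by omega) (by omega)).2 hij
    -- The edge to the vertex that defines `w i` forces the code stored for the index `i` at any
    -- other vertex to be `w i`.
    have hv : ∀ (c : Fin K) (a : Fin m), digitAt (2 * k + 1) c a ≠ 0 →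
        vtxCode k m X D (U c) a = w (digitIdx k (digitAt (2 * k + 1) c a)) := by
      intro c a h0
      have hi : digitIdx k (digitAt (2 * k + 1) c a) < k :=
        digitIdx_lt (Nat.mod_lt _ (by omega)) h0
      have h := (hE c ⟨q _, (hq _ hi).1⟩).2.1 a a₀
      rw [hqd _ hi, hidx _ hi, ← hw _ hi, hdig] at h
      exact (h h0 (by omega)).1 rfl
    refine ⟨w, fun i hi => ?_, hwinj, ?_⟩
    · rw [hw i hi]; exact Nat.mod_lt _ hD
    · let v : ℕ → Fin m → ℕ := fun c => if hc : c < K then vtxCode k m X D (U ⟨c, hc⟩) else 0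
      have hsum := sum_violCount k m X α code hwinj v (by
        intro c hc a h0
        simp only [v]
        rw [dif_pos hc]
        exact hv ⟨c, hc⟩ a h0)
      rw [← hK] at hsum
      let S : ℕ → ZMod (X + 1) := fun c => if hc : c < K then vtxSum k m X (U ⟨c, hc⟩) else 0
      have hstep : ∀ c ∈ Finset.range K,
          S ((c + 1) % K) - S c = (-1) ^ negDigits k m c * (violCount k m X α code c (v c) : ℕ) := by
        intro c hc
        have hc := Finset.mem_range.1 hc
        have hc' : (c + 1) % K < K := Nat.mod_lt _ hK0
        have h := (hE ⟨c, hc⟩ ⟨_, hc'⟩).2.2 (by rw [(hU _).2, (hU _).2])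
        rw [vtx_step_iff, vtxViol, (hU _).2] at h
        simp only [S, v]
        rw [dif_pos hc, dif_pos hc, dif_pos hc', h]
        ring
      have h0 := Finset.sum_congr rfl hstep
      -- The colours form a cycle, so the sum of the differences of consecutive partial sums
      -- vanishes.
      rw [Finset.sum_sub_distrib, sum_range_rotate hK0, sub_self] at h0
      have hcast := congrArg (fun z : ℤ => (z : ZMod (X + 1))) hsum
      push_cast at hcast
      rw [← h0] at hcast
      have hcard : ∑ x ∈ Finset.range X,
          (if ¬ α x (fun a => decide (∃ i < k, code x a = w i)) then 1 else 0) = 0 := by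
        -- The number of violations is divisible by `X + 1` but is at most `X`.
        refine Nat.eq_zero_of_dvd_of_lt (a := X + 1) ?_ ?_
        · rw [← ZMod.natCast_eq_zero_iff]
          push_cast
          exact hcast.symm
        · refine Nat.lt_succ_of_le ((Finset.sum_le_card_nsmul _ _ 1 fun x _ => ?_).trans ?_)
          · split_ifs <;> simp
          · simp
      intro x hx
      have := (Finset.sum_eq_zero_iff.1 hcard) x (Finset.mem_range.2 hx)
      by_contra h
      rw [if_pos h] at this
      exact one_ne_zero this
  · rintro ⟨w, hwD, hwinj, hα⟩
    -- Where the digit is `0` no code is prescribed, and the stored value `0` is arbitrary.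
    let v : ℕ → Fin m → ℕ := fun c a => if digitAt (2 * k + 1) c a ≠ 0 then
      w (digitIdx k (digitAt (2 * k + 1) c a)) else 0
    have hv : ∀ c (a : Fin m), digitAt (2 * k + 1) c a ≠ 0 →
        v c a = w (digitIdx k (digitAt (2 * k + 1) c a)) := fun c a h => if_pos h
    have hvD : ∀ c a, v c a < D := by
      intro c a
      simp only [v]
      split_ifs with h
      · exact hwD _ (digitIdx_lt (Nat.mod_lt _ (by omega)) h)
      · exact hD
    have hsum := sum_violCount k m X α code hwinj v (fun c _ a h => hv c a h)
    rw [Finset.sum_eq_zero (s := Finset.range X) (fun x hx => if_neg (not_not.2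
      (hα x (Finset.mem_range.1 hx)))), ← hK] at hsum
    -- The vertex of colour `c` stores the signed sum of the terms before `c`.
    let S : ℕ → ZMod (X + 1) := fun c => ∑ c' ∈ Finset.range c,
      (-1) ^ negDigits k m c' * (violCount k m X α code c' (v c') : ℕ)
    have hSK : S K = 0 := by
      have hcast := congrArg (fun z : ℤ => (z : ZMod (X + 1))) hsum
      push_cast at hcast
      exact hcast
    choose U hU1 hU2 hU3 hU4 using fun c : Fin K =>
      exists_vertex (k := k) (X := X) (c := c) (σ := (S c).val) c.2 (ZMod.val_lt _) (hvD c)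
    refine ⟨U, fun c => ⟨hU1 c, hU2 c⟩, fun c c' => ⟨?_, ?_, ?_⟩⟩
    · intro h
      rw [hU2, hU2] at h
      rw [Fin.ext h]
    · intro a b
      rw [vtxDigit, vtxDigit, hU2, hU2, hU4, hU4]
      intro ha hb
      rw [hv _ _ ha, hv _ _ hb]
      exact ⟨fun h => by rw [h], fun h => hwinj (digitIdx_lt (Nat.mod_lt _ (by omega)) ha)
        (digitIdx_lt (Nat.mod_lt _ (by omega)) hb) h⟩
    · rw [vtx_step_iff, vtxViol, hU2, hU2, hU3, hU3, hU4, ZMod.natCast_val, ZMod.natCast_val,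
        ZMod.cast_id, ZMod.cast_id]
      intro h
      -- Only the edge from the last colour back to the first is special. It is admissible because
      -- the total `S K` is `0`, as is the empty sum `S 0`.
      have hS : S ((c + 1) % K) = S (c + 1) := by
        by_cases hc : (c : ℕ) + 1 < K
        · rw [Nat.mod_eq_of_lt hc]
        · have : (c : ℕ) + 1 = K := by have := c.2; omega
          rw [this, Nat.mod_self, hSK]
          simp [S]
      rw [h, hS]
      exact Finset.sum_range_succ _ _

end Clique

/-! ### Quantifier-free formulas that are evaluated on words -/

/-- Quantifier-free formulas in the variables `Fin l` over a relational vocabulary with an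
additional `s`-ary relation variable. -/
inductive QFForm (τ : Vocab) (s l : ℕ) : Type
  | fls
  | eq (i j : Fin l)
  | rel (R : Fin τ.rels.length) (t : Fin (τ.rels.get R) → Fin l)
  | rvar (t : Fin s → Fin l)
  | imp (α β : QFForm τ s l)

/-- The number whose digits in base `n` are those of `x` at the positions `t`. -/
def digitCode (n x : ℕ) {l r : ℕ} (t : Fin r → Fin l) : ℕ :=
  ∑ j : Fin r, digitAt n x (t j) * n ^ (j : ℕ)

/-- The position where the bits of the relation `R` start in the encoding of a relational
structure of size `n`. -/
def relPos (τ : Vocab) (n R : ℕ) : ℕ := n + 1 + ∑ j ∈ Finset.range R, n ^ τ.rels.getD j 0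

namespace QFForm

variable {τ : Vocab} {s l : ℕ}

/-- The formula holds in a finite structure. -/
def Holds (A : FinStruct τ) (S : Set (Fin s → A.Dom)) (v : Fin l → A.Dom) : QFForm τ s l → Prop
  | fls => False
  | eq i j => v i = v j
  | rel R t => A.str.RelMap (⟨R, rfl⟩ : τ.lang.Relations (τ.rels.get R)) fun i => v (t i)
  | rvar t => (fun i => v (t i)) ∈ S
  | imp α β => α.Holds A S v → β.Holds A S v

/-- The formula holds in the structure of size `n` that is encoded by the word `w`, for the
variables given by the digits of `x`, and with the atoms of the relation variable given by `b`. -/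
def WordHolds (w : List Bool) (n x : ℕ) (b : Fin (l ^ s) → Bool) : QFForm τ s l → Prop
  | fls => False
  | eq i j => digitAt n x i = digitAt n x j
  | rel R t => w.getD (relPos τ n R + digitCode n x t) false = true
  | rvar t => b (finFunctionFinEquiv t) = true
  | imp α β => α.WordHolds w n x b → β.WordHolds w n x b

end QFForm

-- The edge relation and the size of a structure as arithmetic expressions.

section Expr

variable {Z : Type} [ExprCtx Z]

theorem Expressible.digitAt {b c : Z → ℕ} (hb : Expressible b) (hc : Expressible c) (a : ℕ) :
    Expressible fun z => digitAt (b z) (c z) a :=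
  (hc.div (hb.pow a)).mod hb

theorem Expressible.digitCode {n x : Z → ℕ} (hn : Expressible n) (hx : Expressible x) {l r : ℕ}
    (t : Fin r → Fin l) : Expressible fun z => digitCode (n z) (x z) t :=
  expressible_finset_sum _ fun _ => (hn.digitAt hx _).mul (hn.pow _)

theorem Expressible.relPos {n : Z → ℕ} (hn : Expressible n) (τ : Vocab) (R : ℕ) :
    Expressible fun z => relPos τ (n z) R :=
  (hn.add (expressible_const 1)).add (expressible_finset_sum _ fun _ => hn.pow _)

theorem expressibleP_wordHolds {τ : Vocab} {s l : ℕ} (α : QFForm τ s l) {n x : Z → ℕ}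
    (hn : Expressible n) (hx : Expressible x) {b : Z → Fin (l ^ s) → Bool}
    (hb : ∀ a, ExpressibleP fun z => b z a = true) :
    ExpressibleP fun z => α.WordHolds (ExprCtx.word z) (n z) (x z) (b z) := by
  induction α with
  | fls => exact expressibleP_const False
  | eq i j => exact (hn.digitAt hx i).eq (hn.digitAt hx j)
  | rel R t => exact ((hn.relPos τ R).add (hn.digitCode hx t)).bit
  | rvar t => exact hb _
  | imp α β hα hβ => exact hα.imp hβ

/-- The graph of cliques for the formula `α` and the word `w`. -/
def FormEdge {τ : Vocab} {s l : ℕ} (α : QFForm τ s l) (w : List Bool) (n k : ℕ) : ℕ → ℕ → Prop :=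
  CliqueEdge k (l ^ s) (n ^ l) (n ^ s) (fun x b => α.WordHolds w n x b)
    fun x a => digitCode n x (finFunctionFinEquiv.symm a : Fin s → Fin l)

variable {k n u v : Z → ℕ}

theorem expressible_base (hk : Expressible k) : Expressible fun z => 2 * k z + 1 :=
  ((expressible_const 2).mul hk).add (expressible_const 1)

theorem Expressible.vtxColour (hk : Expressible k) (hu : Expressible u) (m : ℕ) :
    Expressible fun z => vtxColour (k z) m (u z) :=
  hu.mod ((expressible_base hk).pow m)

theorem Expressible.vtxDigit (hk : Expressible k) (hu : Expressible u) (m : ℕ) (a : Fin m) :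
    Expressible fun z => vtxDigit (k z) m (u z) a :=
  (expressible_base hk).digitAt (hk.vtxColour hu m) a

theorem Expressible.vtxSum (hk : Expressible k) (hu : Expressible u)
    {X : Z → ℕ} (hX : Expressible X) (m : ℕ) :
    Expressible fun z => vtxSum (k z) m (X z) (u z) :=
  (hu.div ((expressible_base hk).pow m)).mod (hX.add (expressible_const 1))

theorem Expressible.vtxCode (hk : Expressible k) (hu : Expressible u)
    {X D : Z → ℕ} (hX : Expressible X) (hD : Expressible D) (m : ℕ)
    (a : Fin m) : Expressible fun z => vtxCode (k z) m (X z) (D z) (u z) a :=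
  hD.digitAt (hu.div (((expressible_base hk).pow m).mul (hX.add (expressible_const 1)))) a

theorem Expressible.vtxCount (hk : Expressible k)
    {X D : Z → ℕ} (hX : Expressible X) (hD : Expressible D) (m : ℕ) :
    Expressible fun z => vtxCount (k z) m (X z) (D z) :=
  (((expressible_base hk).pow m).mul (hX.add (expressible_const 1))).mul (hD.pow m)

theorem Expressible.digitIdx {d : Z → ℕ} (hk : Expressible k) (hd : Expressible d) :
    Expressible fun z => digitIdx (k z) (d z) :=
  (hd.le hk).ite (hd.sub (expressible_const 1)) ((hd.sub (expressible_const 1)).sub hk)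

theorem Expressible.negDigits {c : Z → ℕ} (hk : Expressible k) (hc : Expressible c) (m : ℕ) :
    Expressible fun z => negDigits (k z) m (c z) :=
  expressible_finset_sum _ fun a => (hk.lt ((expressible_base hk).digitAt hc a)).indicator

theorem Expressible.vtxViol (hk : Expressible k) (hn : Expressible n) (hu : Expressible u)
    {τ : Vocab} {s l : ℕ} (α : QFForm τ s l) :
    Expressible fun z => vtxViol (k z) (l ^ s) (n z ^ l) (n z ^ s)
      (fun x b => α.WordHolds (ExprCtx.word z) (n z) x b)
      (fun x a => _root_.digitCode (n z) x (finFunctionFinEquiv.symm a : Fin s → Fin l)) (u z) := by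
  classical
  refine Expressible.sum (hn.pow l) (ExpressibleP.indicator (ExpressibleP.and (ExpressibleP.not ?_)
    (expressibleP_forall fun a => ExpressibleP.imp (ExpressibleP.not ?_) ?_)))
  · refine expressibleP_wordHolds α hn.weaken expressible_snd fun a => ?_
    have hd := (expressible_base hk.weaken).digitAt (hk.vtxColour hu (l ^ s)).weaken a
    exact (((expressible_const 1).le hd).and (hd.le hk.weaken)).congr fun _ =>
      (decide_eq_true_iff).symm
  · exact ((expressible_base hk.weaken).digitAt (hk.vtxColour hu (l ^ s)).weaken a).eq
      (expressible_const 0)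
  · exact (hn.weaken.digitCode expressible_snd _).eq
      (hk.vtxCode hu (hn.pow l) (hn.pow s) (l ^ s) a).weaken

theorem expressibleP_formEdge {τ : Vocab} {s l : ℕ} (α : QFForm τ s l) (hk : Expressible k)
    (hn : Expressible n) (hu : Expressible u) (hv : Expressible v) :
    ExpressibleP fun z => FormEdge α (ExprCtx.word z) (n z) (k z) (u z) (v z) := by
  have hX := hn.pow l
  have hD := hn.pow s
  have hS := hk.vtxSum hu hX (l ^ s)
  have hS' := hk.vtxSum hv hX (l ^ s)
  have hV := hk.vtxViol hn hu α
  have hX1 := hX.add (expressible_const 1)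
  have hneg := ((hk.negDigits (hk.vtxColour hu (l ^ s)) (l ^ s)).mod (expressible_const 2)).eq
    (expressible_const 1)
  refine ExpressibleP.and (((hk.vtxColour hu _).eq (hk.vtxColour hv _)).imp (hu.eq hv))
    (ExpressibleP.and (expressibleP_forall fun a => expressibleP_forall fun b => ?_)
      (ExpressibleP.imp ((hk.vtxColour hv _).eq (((hk.vtxColour hu _).add
        (expressible_const 1)).mod ((expressible_base hk).pow _))) ?_))
  · have hda := hk.vtxDigit hu (l ^ s) a
    have hdb := hk.vtxDigit hv (l ^ s) b
    exact (hda.eq (expressible_const 0)).not.imp ((hdb.eq (expressible_const 0)).not.imp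
      (((hk.digitIdx hda).eq (hk.digitIdx hdb)).iff
        ((hk.vtxCode hu hX hD _ a).eq (hk.vtxCode hv hX hD _ b))))
  · refine ((hneg.imp (((hS'.add hV).mod hX1).eq (hS.mod hX1))).and
      (hneg.not.imp ((hS'.mod hX1).eq ((hS.add hV).mod hX1)))).congr fun z => ?_
    split_ifs with h
    · exact ⟨fun H => H.1 h, fun H => ⟨fun _ => H, fun h' => absurd h h'⟩⟩
    · exact ⟨fun H => H.2 h, fun H => ⟨fun h' => absurd h' h, fun _ => H⟩⟩

/-- The number of leading ones of a word. -/
noncomputable def leadingOnes (w : List Bool) : ℕ :=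
  ∑ i ∈ Finset.range w.length, open Classical in
    if ∀ j < i + 1, w.getD j false = true then 1 else 0

theorem expressible_leadingOnes : Expressible fun z : WordInst => leadingOnes z.word := by
  classical
  exact Expressible.sum expressible_length (ExpressibleP.indicator
    (ExpressibleP.ball (expressible_snd.add (expressible_const 1)) expressible_snd.bit))

theorem leadingOnes_replicate_append (n : ℕ) (w : List Bool) :
    leadingOnes (List.replicate n true ++ false :: w) = n := by
  classical
  unfold leadingOnes
  have h : ∀ i, (∀ j < i + 1, (List.replicate n true ++ false :: w).getD j false = true) ↔ i < n := by
    intro i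
    constructor
    · intro h
      by_contra hi
      have := h n (by omega)
      rw [List.getD_append_right _ _ _ _ (by simp)] at this
      simp at this
    · intro h j hj
      rw [List.getD_append _ _ _ _ (by simp; omega)]
      simp [show j < n by omega]
  simp only [h]
  rw [Finset.sum_boole, List.length_append, List.length_replicate, List.length_cons]
  have : (Finset.range (n + (w.length + 1))).filter (· < n) = Finset.range n := by
    ext i
    simp
    omega
  rw [this]
  simp

end Expr

/-! ### The encoding of structures -/

theorem List.length_flatMap_finRange {β : Type} {L : ℕ} {f : Fin L → List β} {len : ℕ → ℕ}
    (hlen : ∀ j, (f j).length = len j) :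
    ((List.finRange L).flatMap f).length = ∑ j ∈ Finset.range L, len j := by
  rw [List.length_flatMap, ← Fin.sum_univ_eq_sum_range, Fin.sum_univ_def]
  simp only [hlen]

theorem List.getD_flatMap_finRange {β : Type} (d : β) {L : ℕ} {f : Fin L → List β} {len : ℕ → ℕ}
    (hlen : ∀ j, (f j).length = len j) (i : Fin L) {p : ℕ} (hp : p < len i) :
    ((List.finRange L).flatMap f).getD (∑ j ∈ Finset.range i, len j + p) d = (f i).getD p d := by
  induction L with
  | zero => exact i.elim0
  | succ L ih =>
    rw [List.finRange_succ_last, List.flatMap_append, List.flatMap_map]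
    have h := List.length_flatMap_finRange (f := fun j : Fin L => f j.castSucc) (len := len)
      fun j => hlen _
    rcases Fin.eq_castSucc_or_eq_last i with ⟨i, rfl⟩ | rfl
    · rw [List.getD_append]
      · exact ih (f := fun j : Fin L => f j.castSucc) (fun j => hlen _) i hp
      · rw [h]
        calc ∑ j ∈ Finset.range i, len j + p < ∑ j ∈ Finset.range (i + 1), len j := by
              rw [Finset.sum_range_succ]; exact Nat.add_lt_add_left hp _
          _ ≤ _ := Finset.sum_le_sum_of_subset (Finset.range_subset_range.2 i.2)
    · rw [List.getD_append_right _ _ _ _ (by rw [h]; simp), h]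
      simp

theorem List.map_finRange_val {β : Type} (n : ℕ) (g : ℕ → β) :
    (List.finRange n).map (fun i : Fin n => g i) = (List.range n).map g := by
  rw [← List.map_coe_finRange_eq_range, List.map_map]
  rfl

theorem List.flatMap_finRange_eq_map_range {β : Type} (L : ℕ) (len : ℕ → ℕ) (g : ℕ → β) :
    ((List.finRange L).flatMap fun i : Fin L =>
      (List.range (len i)).map fun p => g (∑ j ∈ Finset.range i, len j + p))
      = (List.range (∑ j ∈ Finset.range L, len j)).map g := by
  induction L with
  | zero => rfl
  | succ L ih =>
    rw [List.finRange_succ_last, List.flatMap_append, List.flatMap_map, Finset.sum_range_succ,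
      List.range_add, List.map_append, ← ih]
    simp only [Fin.val_castSucc, List.flatMap_cons, List.flatMap_nil, List.append_nil, Fin.val_last,
      List.map_map, Function.comp_def]

theorem exists_eq_replicate_append {w : List Bool} (hw : leadingOnes w < w.length) :
    ∃ n w', w = List.replicate n true ++ false :: w' := by
  have h : false ∈ w := by
    by_contra h
    have hall : ∀ i < w.length, ∀ j < i + 1, w.getD j false = true := by
      intro i hi j hj
      rw [List.getD_eq_getElem _ _ (by omega)]
      by_contra hne
      exact h (Bool.eq_false_iff.2 hne ▸ List.getElem_mem _)
    rw [leadingOnes, Finset.sum_congr rfl fun i hi => if_pos (hall i (Finset.mem_range.1 hi))] at hw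
    simp at hw
  obtain ⟨l, w', rfl, hl⟩ := List.eq_append_cons_of_mem h
  exact ⟨l.length, w', by
    rw [← List.eq_replicate_of_mem (a := true) fun b hb => by
      cases b
      · exact absurd hb hl
      · rfl]⟩

theorem length_encodeRel {n r : ℕ} (R : Set (Fin r → Fin n)) : (encodeRel R).length = n ^ r := by
  simp [encodeRel]

theorem getD_encodeRel {n r : ℕ} (R : Set (Fin r → Fin n)) (v : Fin r → Fin n) :
    (encodeRel R).getD (finFunctionFinEquiv v : Fin (n ^ r)) false = true ↔ v ∈ R := by
  rw [List.getD_eq_getElem _ _ (by rw [length_encodeRel]; exact Fin.is_lt _)]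
  simp only [encodeRel, List.getElem_map, List.getElem_finRange, decide_eq_true_eq]
  rw [show (Fin.cast _ ⟨(finFunctionFinEquiv v : Fin (n ^ r)), _⟩ : Fin (n ^ r))
    = finFunctionFinEquiv v from rfl, Equiv.symm_apply_apply]

theorem encodeRel_eq_map_range {n r : ℕ} {R : Set (Fin r → Fin n)} {g : ℕ → Bool}
    (h : ∀ v, v ∈ R ↔ g (finFunctionFinEquiv v : Fin (n ^ r)) = true) :
    encodeRel R = (List.range (n ^ r)).map g := by
  rw [← List.map_finRange_val, encodeRel]
  refine List.map_congr_left fun i _ => ?_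
  classical
  rw [Bool.eq_iff_iff, decide_eq_true_iff (p := finFunctionFinEquiv.symm i ∈ R), h,
    Equiv.apply_symm_apply]

theorem encodeRel_injective {n r : ℕ} :
    Function.Injective (encodeRel : Set (Fin r → Fin n) → List Bool) := by
  intro R R' h
  ext v
  rw [← getD_encodeRel, h, getD_encodeRel]

namespace FinStruct

variable {τ : Vocab}

theorem leadingOnes_encode (A : FinStruct τ) : leadingOnes A.encode = A.size := by
  rw [encode, List.append_assoc, List.append_assoc, List.singleton_append,
    leadingOnes_replicate_append]

theorem length_encode (A : FinStruct τ) : A.encode.length =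
    A.size + 1 + ∑ j ∈ Finset.range τ.funs.length, A.size ^ (τ.funs.getD j 0 + 1) +
      ∑ j ∈ Finset.range τ.rels.length, A.size ^ τ.rels.getD j 0 := by
  rw [encode, List.length_append, List.length_append, List.length_append,
    List.length_flatMap_finRange (len := fun j => A.size ^ (τ.funs.getD j 0 + 1)),
    List.length_flatMap_finRange (len := fun j => A.size ^ τ.rels.getD j 0)]
  · simp
  · intro j
    rw [length_encodeRel, List.getD_eq_getElem _ _ j.2]
    rfl
  · intro j
    rw [length_encodeRel, List.getD_eq_getElem _ _ j.2]
    rfl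

/-- The leading ones give the size, and the size and the vocabulary give the lengths of all blocks.
The word therefore splits uniquely into characteristic strings, each of which determines its
relation or graph. -/
theorem encode_injective : Function.Injective (encode : FinStruct τ → List Bool) := by
  intro A B h
  have hs : A.size = B.size := by rw [← A.leadingOnes_encode, h, B.leadingOnes_encode]
  obtain ⟨n, hn, sA⟩ := A
  obtain ⟨n', hn', sB⟩ := B
  obtain rfl : n = n' := hs
  congr 1
  unfold encode at h
  obtain ⟨h1, h2⟩ := List.append_inj' h (by
    rw [List.length_flatMap_finRange (len := fun j => n ^ τ.rels.getD j 0),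
      List.length_flatMap_finRange (len := fun j => n ^ τ.rels.getD j 0)] <;>
    · intro j
      rw [length_encodeRel, List.getD_eq_getElem _ _ j.2]
      rfl)
  have h1 := (List.append_inj h1 (by simp)).2
  have hflat : ∀ {L : ℕ} (r : Fin L → ℕ) (F G : ∀ i, Set (Fin (r i) → Fin n)),
      ((List.finRange L).flatMap fun i => encodeRel (F i))
        = ((List.finRange L).flatMap fun i => encodeRel (G i)) → ∀ i, F i = G i := by
    intro L r F G h i
    apply encodeRel_injective
    let len : ℕ → ℕ := fun j => if hj : j < L then n ^ r ⟨j, hj⟩ else 0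
    have hF : ∀ j, (encodeRel (F j)).length = len j := fun j => by
      rw [length_encodeRel]; simp only [len]; rw [dif_pos j.2]
    have hG : ∀ j, (encodeRel (G j)).length = len j := fun j => by
      rw [length_encodeRel]; simp only [len]; rw [dif_pos j.2]
    refine List.ext_getElem (by rw [hF, hG]) fun p hp hp' => ?_
    rw [← List.getD_eq_getElem _ false hp, ← List.getD_eq_getElem _ false hp',
      ← List.getD_flatMap_finRange false hF i (by rw [← hF]; exact hp),
      ← List.getD_flatMap_finRange false hG i (by rw [← hF]; exact hp), h]
  refine Language.Structure.ext ?_ ?_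
  · funext r f v
    obtain ⟨i, rfl⟩ := f
    have := hflat _ _ _ h1 i
    -- The tuple `v` followed by the value of the function in the first structure lies in the common
    -- graph, so the second structure has the same value at `v`.
    have hm := (Set.ext_iff.1 this (Fin.snoc v (sA.funMap
      (⟨i, rfl⟩ : τ.lang.Functions (τ.funs.get i)) v))).1 (by
        change sA.funMap _ _ = _
        simp only [Fin.snoc_castSucc, Fin.snoc_last])
    change sB.funMap _ _ = _ at hm
    simp only [Fin.snoc_castSucc, Fin.snoc_last] at hm
    exact hm.symm
  · funext r R v
    obtain ⟨i, rfl⟩ := R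
    exact congrFun (hflat _ _ _ h2 i) v

theorem getD_encode (hτ : τ.IsRelational) (A : FinStruct τ) (R : Fin τ.rels.length)
    (v : Fin (τ.rels.get R) → A.Dom) :
    A.encode.getD (relPos τ A.size R + (finFunctionFinEquiv v : Fin _)) false = true ↔
      A.str.RelMap (⟨R, rfl⟩ : τ.lang.Relations (τ.rels.get R)) v := by
  obtain ⟨funs, rels⟩ := τ
  obtain rfl : funs = [] := hτ
  unfold encode
  have hlen : ∀ j : Fin rels.length, (encodeRel {v : Fin (rels.get j) → A.Dom |
      A.str.RelMap (⟨j, rfl⟩ : (Vocab.mk [] rels).lang.Relations (rels.get j)) v}).length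
        = A.size ^ rels.getD j 0 := by
    intro j
    rw [length_encodeRel, List.getD_eq_getElem _ _ j.2]
    rfl
  have h := List.getD_flatMap_finRange false (len := fun j => A.size ^ rels.getD j 0) hlen R
    (p := (finFunctionFinEquiv v : Fin _)) (by
      rw [← hlen, length_encodeRel]; exact Fin.is_lt _)
  rw [relPos, add_assoc, List.getD_append_right]
  · have h0 : ∀ x, A.size + 1 + x - (List.replicate A.size true ++ [false] ++
        (List.finRange ([] : List ℕ).length).flatMap (fun i =>
      encodeRel {v : Fin (([] : List ℕ).get i + 1) → A.Dom |
        A.str.funMap (⟨i, rfl⟩ : (Vocab.mk [] rels).lang.Functions (([] : List ℕ).get i))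
          (fun j => v j.castSucc) = v (Fin.last _)})).length = x := by
      intro x; simp
    erw [h0, h, getD_encodeRel]
    exact Iff.rfl
  · simp

/-- Without function symbols every bit string of the right length is a legitimate list of relations,
so encodings are recognised by their leading ones and their length. -/
theorem exists_encode_iff (hτ : τ.IsRelational) (w : List Bool) :
    (∃ A : FinStruct τ, w = A.encode) ↔
      0 < leadingOnes w ∧ w.length = relPos τ (leadingOnes w) τ.rels.length := by
  obtain ⟨funs, rels⟩ := τ
  obtain rfl : funs = [] := hτ
  constructor
  · rintro ⟨A, rfl⟩
    rw [leadingOnes_encode, length_encode]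
    exact ⟨A.size_pos, by simp [relPos]⟩
  · rintro ⟨h0, hl⟩
    obtain ⟨n, w', rfl⟩ := exists_eq_replicate_append (w := w) (by rw [hl, relPos]; omega)
    rw [leadingOnes_replicate_append] at h0 hl
    rw [relPos, List.length_append, List.length_replicate, List.length_cons] at hl
    refine ⟨⟨n, h0, ⟨fun {_} f => f.1.elim0, fun {_} R v => w'.getD
      (∑ j ∈ Finset.range R.1, n ^ rels.getD j 0 + (finFunctionFinEquiv v : Fin _)) false = true⟩⟩, ?_⟩
    have h : ∀ i : Fin rels.length, encodeRel {v : Fin (rels.get i) → Fin n | w'.getD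
        (∑ j ∈ Finset.range i, n ^ rels.getD j 0 + (finFunctionFinEquiv v : Fin _)) false = true}
        = (List.range (n ^ rels.getD i 0)).map fun p =>
          w'.getD (∑ j ∈ Finset.range i, n ^ rels.getD j 0 + p) false := by
      intro i
      rw [List.getD_eq_getElem _ _ i.2]
      exact encodeRel_eq_map_range (g := fun p =>
          w'.getD (∑ j ∈ Finset.range i, n ^ rels.getD j 0 + p) false) fun v => Iff.rfl
    have h2 := (List.finRange rels.length).flatMap_congr fun i _ => h i
    have h3 := List.flatMap_finRange_eq_map_range rels.length (fun j => n ^ rels.getD j 0)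
      fun p => w'.getD p false
    unfold encode
    refine Eq.trans ?_ (congrArg (List.replicate n true ++ [false] ++ [] ++ ·) (h2.trans h3).symm)
    simp only [List.append_nil, List.append_assoc, List.singleton_append]
    congr 2
    have hl' : w'.length = ∑ j ∈ Finset.range rels.length, n ^ rels.getD j 0 := by
      change _ = n + 1 + ∑ j ∈ Finset.range rels.length, n ^ rels.getD j 0 at hl
      omega
    refine List.ext_getElem (by rw [List.length_map, List.length_range, hl']) fun i hi hi' => ?_
    rw [List.getElem_map, List.getElem_range, List.getD_eq_getElem _ _ hi]

end FinStruct

/-! ### Normal forms of `Π₁`-sentences over relational vocabularies -/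

/-- A bounded formula holds in the expansion of a finite structure by a relation. -/
def FinStruct.Realizes {τ : Vocab} {s n : ℕ} (A : FinStruct τ) (S : Set (Fin s → A.Dom))
    (φ : (τ.lang.sum (relVarLang s)).BoundedFormula Empty n) (xs : Fin n → A.Dom) : Prop :=
  letI := A.expand S
  φ.Realize default xs

section NormalForm

variable {τ : Vocab} {s : ℕ}

theorem exists_eq_var_of_isRelational (hτ : τ.IsRelational) {n : ℕ}
    (t : (τ.lang.sum (relVarLang s)).Term (Empty ⊕ Fin n)) :
    ∃ i, t = Language.Term.var (Sum.inr i) := by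
  cases t with
  | var x =>
    rcases x with x | i
    · exact x.elim
    · exact ⟨i, rfl⟩
  | func f ts =>
    rcases f with f | f
    · exact absurd (f.1.2.trans_eq (congrArg List.length hτ)) (Nat.not_lt_zero _)
    · exact f.elim

theorem exists_qfForm (hτ : τ.IsRelational) {n l : ℕ} (e : Fin n → Fin l)
    {φ : (τ.lang.sum (relVarLang s)).BoundedFormula Empty n} (h : φ.IsQF) :
    ∃ α : QFForm τ s l, ∀ (A : FinStruct τ) (S : Set (Fin s → A.Dom)) (y : Fin l → A.Dom),
      A.Realizes S φ (fun i => y (e i)) ↔ α.Holds A S y := by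
  induction h with
  | falsum => exact ⟨.fls, fun A S y => Iff.rfl⟩
  | of_isAtomic h =>
    cases h with
    | equal t₁ t₂ =>
      obtain ⟨i, rfl⟩ := exists_eq_var_of_isRelational hτ t₁
      obtain ⟨j, rfl⟩ := exists_eq_var_of_isRelational hτ t₂
      exact ⟨.eq (e i) (e j), fun A S y => Iff.rfl⟩
    | rel R ts =>
      choose t ht using fun i => exists_eq_var_of_isRelational hτ (ts i)
      obtain rfl : ts = fun i => Language.Term.var (Sum.inr (t i)) := funext ht
      rcases R with ⟨R, rfl⟩ | R
      · exact ⟨.rel R fun i => e (t i), fun A S y => Iff.rfl⟩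
      · obtain rfl := PLift.down R
        exact ⟨.rvar fun i => e (t i), fun A S y => Iff.rfl⟩
  | imp _ _ h₁ h₂ =>
    obtain ⟨α, hα⟩ := h₁
    obtain ⟨β, hβ⟩ := h₂
    exact ⟨.imp α β, fun A S y => imp_congr (hα A S y) (hβ A S y)⟩

/-- The universal quantifiers are peeled off one by one. The strict inequality `n < l` is arranged
by a dummy variable around the kernel, which changes nothing over a nonempty domain and yields `0 <
l` for sentences. -/
theorem exists_normal_form (hτ : τ.IsRelational) {n : ℕ}
    (φ : (τ.lang.sum (relVarLang s)).BoundedFormula Empty n) (h : IsPiForm 1 φ) :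
    ∃ (l : ℕ) (hl : n < l) (α : QFForm τ s l), ∀ (A : FinStruct τ) (S : Set (Fin s → A.Dom))
      (xs : Fin n → A.Dom), A.Realizes S φ xs ↔
        ∀ y : Fin l → A.Dom, (∀ i : Fin n, y (i.castLE hl.le) = xs i) → α.Holds A S y := by
  have hqf : ∀ {n : ℕ} {φ : (τ.lang.sum (relVarLang s)).BoundedFormula Empty n}, φ.IsQF →
      ∃ (l : ℕ) (hl : n < l) (α : QFForm τ s l), ∀ (A : FinStruct τ) (S : Set (Fin s → A.Dom))
      (xs : Fin n → A.Dom), A.Realizes S φ xs ↔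
        ∀ y : Fin l → A.Dom, (∀ i : Fin n, y (i.castLE hl.le) = xs i) → α.Holds A S y := by
    intro n φ h
    obtain ⟨α, hα⟩ := exists_qfForm hτ (Fin.castLE (Nat.le_succ n)) h
    refine ⟨n + 1, n.lt_succ_self, α, fun A S xs => ⟨fun h y hy => ?_, fun h => ?_⟩⟩
    · rw [← hα, funext hy]
      exact h
    · have := h (Fin.snoc xs (Classical.arbitrary A.Dom)) fun i => Fin.snoc_castSucc _ _ i
      rw [← hα] at this
      convert this with i
      exact (Fin.snoc_castSucc (α := fun _ => A.Dom) _ _ i).symm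
  induction φ with
  | falsum => exact hqf .falsum
  | equal t₁ t₂ => exact hqf (.of_isAtomic (.equal t₁ t₂))
  | rel R ts => exact hqf (.of_isAtomic (.rel R ts))
  | imp φ ψ _ _ =>
    cases h with
    | of_sigma h => cases h with
      | qf h => exact hqf h
  | all φ ih =>
    cases h with
    | of_sigma h => cases h with
      | qf h => exact hqf h
    | all h =>
      obtain ⟨l, hl, α, hα⟩ := ih h
      refine ⟨l, Nat.lt_of_succ_lt hl, α, fun A S xs => ?_⟩
      constructor
      · intro h y hy
        refine (hα A S (Fin.snoc xs (y ⟨_, hl.le⟩))).1 (h _) y fun i => ?_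
        rcases Fin.eq_castSucc_or_eq_last i with ⟨i, rfl⟩ | rfl
        · rw [Fin.snoc_castSucc]
          exact hy i
        · rw [Fin.snoc_last]
          rfl
      · intro h a
        refine (hα A S _).2 fun y hy => h y fun i => ?_
        have := hy i.castSucc
        rw [Fin.snoc_castSucc] at this
        exact this

end NormalForm

/-! ### Weighted definability on words -/

theorem QFForm.wordHolds_iff {τ : Vocab} (hτ : τ.IsRelational) {s l : ℕ} (α : QFForm τ s l)
    (A : FinStruct τ) (S : Set (Fin s → A.Dom)) (v : Fin l → A.Dom) (b : Fin (l ^ s) → Bool)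
    (hb : ∀ t : Fin s → Fin l, b (finFunctionFinEquiv t) = true ↔ (fun i => v (t i)) ∈ S) :
    α.WordHolds A.encode A.size (finFunctionFinEquiv v : Fin _) b ↔ α.Holds A S v := by
  have hd : ∀ i : Fin l, digitAt A.size (finFunctionFinEquiv v : Fin _) i = v i := fun i => by
    rw [digitAt, ← finFunctionFinEquiv_symm_apply_val, Equiv.symm_apply_apply]
  induction α with
  | fls => exact Iff.rfl
  | eq i j =>
    change digitAt _ _ _ = digitAt _ _ _ ↔ v i = v j
    rw [hd, hd, Fin.val_inj]
  | rel R t =>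
    change _ ↔ A.str.RelMap _ _
    rw [← A.getD_encode hτ, WordHolds, digitCode]
    have h2 := Finset.sum_congr (rfl : (Finset.univ : Finset (Fin (τ.rels.get R))) = _)
      fun j _ => congrArg (· * A.size ^ (j : ℕ)) (hd (t j))
    rw [h2, finFunctionFinEquiv_apply]
  | rvar t => exact hb t
  | imp α β hα hβ => exact imp_congr hα hβ

/-- A set of `k` tuples is listed without repetition by `w`, each tuple being coded by the number
that it represents in base `n`. -/
theorem exists_set_encard_iff {n s k : ℕ} (P : Set (Fin s → Fin n) → Prop) :
    (∃ S : Set (Fin s → Fin n), S.encard = k ∧ P S) ↔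
      ∃ w : ℕ → ℕ, (∀ i < k, w i < n ^ s) ∧ Set.InjOn w (Set.Iio k) ∧
        P {t | ∃ i < k, (finFunctionFinEquiv t : Fin (n ^ s)) = w i} := by
  constructor
  · rintro ⟨S, hS, hP⟩
    have hcard : Nat.card S = k := by
      rw [Nat.card_coe_set_eq, Set.ncard, hS, ENat.toNat_natCast]
    have e := (Finite.equivFinOfCardEq hcard).symm
    let w : ℕ → ℕ := fun i => if hi : i < k then (finFunctionFinEquiv (e ⟨i, hi⟩).1 : Fin (n ^ s)) else 0
    have hw : ∀ i (hi : i < k), w i = (finFunctionFinEquiv (e ⟨i, hi⟩).1 : Fin (n ^ s)) :=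
      fun i hi => dif_pos hi
    refine ⟨w, fun i hi => ?_, fun i hi j hj hij => ?_, ?_⟩
    · rw [hw i hi]
      exact Fin.is_lt _
    · rw [hw i hi, hw j hj, Fin.val_inj, finFunctionFinEquiv.injective.eq_iff,
        Subtype.val_inj, e.injective.eq_iff] at hij
      exact congrArg Fin.val hij
    · convert hP
      ext t
      constructor
      · rintro ⟨i, hi, h⟩
        rw [hw i hi, Fin.val_inj, finFunctionFinEquiv.injective.eq_iff] at h
        rw [h]
        exact (e ⟨i, hi⟩).2
      · intro ht
        refine ⟨e.symm ⟨t, ht⟩, Fin.is_lt _, ?_⟩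
        rw [hw _ (Fin.is_lt _)]
        simp
  · rintro ⟨w, hw, hinj, hP⟩
    refine ⟨_, ?_, hP⟩
    let f : Fin k → Fin s → Fin n := fun i => finFunctionFinEquiv.symm ⟨w i, hw i i.2⟩
    have hf : Function.Injective f := by
      intro i j h
      have h := finFunctionFinEquiv.symm.injective h
      exact Fin.ext (hinj i.2 j.2 (congrArg Fin.val h))
    have : {t | ∃ i < k, (finFunctionFinEquiv t : Fin (n ^ s)) = w i} = Set.range f := by
      ext t
      constructor
      · rintro ⟨i, hi, h⟩
        refine ⟨⟨i, hi⟩, ?_⟩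
        rw [Equiv.symm_apply_eq]
        exact Fin.ext h.symm
      · rintro ⟨i, rfl⟩
        exact ⟨i, i.2, by rw [Equiv.apply_symm_apply]⟩
    rw [this, ← Set.image_univ, hf.encard_image, Set.encard_univ]
    simp

/-- The problem that is defined by a `Π₁`-sentence, expressed on words. -/
theorem exists_mem_pWD_iff {τ : Vocab} (hτ : τ.IsRelational) {s : ℕ}
    (ψ : (τ.lang.sum (relVarLang s)).Sentence) (hψ : IsPiForm 1 ψ) :
    ∃ (l : ℕ) (α : QFForm τ s l), 0 < l ∧ ∀ (x : List Bool) (k : ℕ), (x, k) ∈ pWD ψ ↔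
      0 < leadingOnes x ∧ x.length = relPos τ (leadingOnes x) τ.rels.length ∧
      ∃ w : ℕ → ℕ, (∀ i < k, w i < leadingOnes x ^ s) ∧ Set.InjOn w (Set.Iio k) ∧
        ∀ y < leadingOnes x ^ l, α.WordHolds x (leadingOnes x) y fun a =>
          decide (∃ i < k, digitCode (leadingOnes x) y
            (finFunctionFinEquiv.symm a : Fin s → Fin l) = w i) := by
  obtain ⟨l, hl, α, hα⟩ := exists_normal_form hτ ψ hψ
  refine ⟨l, α, hl, fun x k => ?_⟩
  rw [← and_assoc, ← FinStruct.exists_encode_iff hτ x]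
  have key : ∀ A : FinStruct τ, x = A.encode →
      ((∃ S : Set (Fin s → A.Dom), S.encard = k ∧ A.IsSolution ψ S) ↔
      ∃ w : ℕ → ℕ, (∀ i < k, w i < leadingOnes x ^ s) ∧ Set.InjOn w (Set.Iio k) ∧
        ∀ y < leadingOnes x ^ l, α.WordHolds x (leadingOnes x) y fun a =>
          decide (∃ i < k, digitCode (leadingOnes x) y
            (finFunctionFinEquiv.symm a : Fin s → Fin l) = w i)) := by
    rintro A rfl
    rw [exists_set_encard_iff, A.leadingOnes_encode]
    refine exists_congr fun w => and_congr_right fun _ => and_congr_right fun _ => ?_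
    refine Iff.trans (hα A _ default) ?_
    have hd : ∀ (v : Fin l → A.Dom) (i : Fin l), digitAt A.size (finFunctionFinEquiv v : Fin _) i = v i :=
      fun v i => by
        rw [digitAt, ← finFunctionFinEquiv_symm_apply_val, Equiv.symm_apply_apply]
    have hv : ∀ v : Fin l → A.Dom, α.WordHolds A.encode A.size (finFunctionFinEquiv v : Fin _)
        (fun a => decide (∃ i < k, digitCode A.size (finFunctionFinEquiv v : Fin (A.size ^ l))
            (finFunctionFinEquiv.symm a : Fin s → Fin l) = w i)) ↔
        α.Holds A {t | ∃ i < k, (finFunctionFinEquiv t : Fin (A.size ^ s)) = w i} v := by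
      intro v
      refine α.wordHolds_iff hτ A _ v _ fun t => ?_
      rw [decide_eq_true_iff, Equiv.symm_apply_apply, digitCode]
      simp only [hd]
      rw [Set.mem_ofPred_eq, finFunctionFinEquiv_apply]
    constructor
    · intro h y hy
      have := (hv (finFunctionFinEquiv.symm ⟨y, hy⟩)).2 (h _ fun i => i.elim0)
      rw [Equiv.apply_symm_apply] at this
      exact this
    · intro h v _
      exact (hv v).1 (h _ (Fin.is_lt _))
  constructor
  · rintro ⟨A, hA, h⟩
    exact ⟨⟨A, hA⟩, (key A hA).1 h⟩
  · rintro ⟨⟨A, hA⟩, h⟩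
    exact ⟨A, hA, (key A hA).2 h⟩

/-! ### Inclusion logic expresses transversal cliques -/

/-- The vocabulary with two unary functions and a binary relation. -/
def cliqueVocab : Vocab := ⟨[1, 1], [2]⟩

/-- The structure over `cliqueVocab` with the functions `c` and `d` and the relation `E`. -/
def cliqueStruct {N : ℕ} (hN : 0 < N) (c d : Fin N → Fin N) (E : Fin N → Fin N → Prop) :
    FinStruct cliqueVocab where
  size := N
  size_pos := hN
  str :=
    { funMap := fun {_} f v =>
        have h := f.2.symm.trans ((by decide : ∀ i : Fin 2, [1, 1].get i = 1) f.1)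
        if f.1.1 = 0 then c (v ⟨0, by omega⟩) else d (v ⟨0, by omega⟩)
      RelMap := fun {_} R v =>
        have h := R.2.symm.trans ((by decide : ∀ i : Fin 1, [2].get i = 2) R.1)
        E (v ⟨0, by omega⟩) (v ⟨1, by omega⟩) }

/-- The application of one of the two functions to the variable `1`. -/
def cliqueTerm (i : Fin 2) : cliqueVocab.lang.Term ℕ :=
  .func (l := 1) ⟨i, (by decide : ∀ i : Fin 2, [1, 1].get i = 1) i⟩ fun _ => .var 1

/-- The formula `E(x, y) ∧ xy ⊆ yx ∧ x d(y) ⊆ x c(y)`. -/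
def cliqueFormula : IncFormula cliqueVocab.lang :=
  .and (.rel (n := 2) ⟨(0 : Fin 1), rfl⟩ ![.var 0, .var 1])
    (.and (.inc (n := 2) ![.var 0, .var 1] ![.var 1, .var 0])
      (.inc (n := 2) ![.var 0, cliqueTerm 1] ![.var 0, cliqueTerm 0]))

theorem freeVars_cliqueFormula : cliqueFormula.freeVars = {0, 1} := by
  decide

theorem zero_mem_freeVars : 0 ∈ cliqueFormula.freeVars := by
  rw [freeVars_cliqueFormula]; decide

theorem one_mem_freeVars : 1 ∈ cliqueFormula.freeVars := by
  rw [freeVars_cliqueFormula]; decide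

/-- Assignments with domain `{0, 1}` are pairs. -/
def assignmentEquiv (A : Type) : Assignment cliqueFormula.freeVars A ≃ A × A where
  toFun s := (s ⟨0, zero_mem_freeVars⟩, s ⟨1, one_mem_freeVars⟩)
  invFun p x := if x.1 = 0 then p.1 else p.2
  left_inv s := by
    funext x
    obtain ⟨x, hx⟩ := x
    have h : x = 0 ∨ x = 1 := by
      rw [freeVars_cliqueFormula] at hx
      simpa using hx
    rcases h with rfl | rfl <;> rfl
  right_inv _ := rfl

theorem sat_cliqueFormula {A : Type} [cliqueVocab.lang.Structure A] [Nonempty A] {c d : A → A}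
    {E : A → A → Prop}
    (hc : ∀ (s : Assignment cliqueFormula.freeVars A),
      s.val (cliqueTerm 0) = c (s.val (.var 1 : cliqueVocab.lang.Term ℕ)))
    (hd : ∀ (s : Assignment cliqueFormula.freeVars A),
      s.val (cliqueTerm 1) = d (s.val (.var 1 : cliqueVocab.lang.Term ℕ)))
    (hE : ∀ v : Fin 2 → A, Language.Structure.RelMap
      (L := cliqueVocab.lang) ⟨(0 : Fin 1), rfl⟩ v ↔ E (v 0) (v 1))
    (T : Set (Assignment cliqueFormula.freeVars A)) :
    cliqueFormula.Sat A cliqueFormula.freeVars T ↔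
      (∀ p ∈ assignmentEquiv A '' T, E p.1 p.2) ∧
      (∀ p ∈ assignmentEquiv A '' T, ∃ q ∈ assignmentEquiv A '' T, p.1 = q.2 ∧ p.2 = q.1) ∧
      ∀ p ∈ assignmentEquiv A '' T, ∃ q ∈ assignmentEquiv A '' T, p.1 = q.1 ∧ d p.2 = c q.2 := by
  have h0 : ∀ s : Assignment cliqueFormula.freeVars A,
      s.val (.var 0 : cliqueVocab.lang.Term ℕ) = (assignmentEquiv A s).1 := by
    intro s
    rw [Assignment.val, Language.Term.realize_var, dif_pos zero_mem_freeVars]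
    rfl
  have h1 : ∀ s : Assignment cliqueFormula.freeVars A,
      s.val (.var 1 : cliqueVocab.lang.Term ℕ) = (assignmentEquiv A s).2 := by
    intro s
    rw [Assignment.val, Language.Term.realize_var, dif_pos one_mem_freeVars]
    rfl
  simp only [Set.forall_mem_image, Set.exists_mem_image]
  refine and_congr ?_ (and_congr ?_ ?_)
  · refine forall₂_congr fun s _ => ?_
    rw [← h0, ← h1]
    exact hE _
  · refine forall₂_congr fun s _ => exists_congr fun s' => and_congr_right fun _ => ?_
    rw [Fin.forall_fin_two, ← h0, ← h0, ← h1, ← h1]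
    exact Iff.rfl
  · refine forall₂_congr fun s _ => exists_congr fun s' => and_congr_right fun _ => ?_
    rw [Fin.forall_fin_two, ← h0, ← h0, ← h1, ← h1, ← hc, ← hd]
    exact Iff.rfl

section CliqueStruct

variable {N : ℕ} (hN : 0 < N) (c d : Fin N → Fin N) (E : Fin N → Fin N → Prop)

theorem mem_pWT_cliqueFormula (n : ℕ) :
    ((cliqueStruct hN c d E).encode, n) ∈ pWT cliqueFormula ↔
      ∃ P : Set (Fin N × Fin N), P.encard = n ∧ (∀ p ∈ P, E p.1 p.2) ∧
        (∀ p ∈ P, ∃ q ∈ P, p.1 = q.2 ∧ p.2 = q.1) ∧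
        ∀ p ∈ P, ∃ q ∈ P, p.1 = q.1 ∧ d p.2 = c q.2 := by
  constructor
  · rintro ⟨A, hA, T, hT, hs⟩
    obtain rfl := FinStruct.encode_injective hA
    exact ⟨_, ((assignmentEquiv (Fin N)).injective.encard_image T).trans hT,
      (sat_cliqueFormula (A := (cliqueStruct hN c d E).Dom) (c := c) (d := d) (E := E)
        (fun _ => rfl) (fun _ => rfl)
        (fun _ => Iff.rfl) T).1 hs⟩
  · rintro ⟨P, hP, h⟩
    refine ⟨_, rfl, (assignmentEquiv (Fin N)).symm '' P,
      ((assignmentEquiv (Fin N)).symm.injective.encard_image P).trans hP,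
      (sat_cliqueFormula (A := (cliqueStruct hN c d E).Dom) (c := c) (d := d) (E := E)
        (fun _ => rfl) (fun _ => rfl)
        (fun _ => Iff.rfl) _).2 ?_⟩
    have himg := (assignmentEquiv (Fin N)).image_symm_image P
    erw [himg]
    exact h

/-- The structure with the domain `{0, …, N - 1}` in which `u` has the colour `u % K`, and the two
functions yield the colour of a vertex and its cyclic successor. -/
def colourStruct {K : ℕ} (hK : 0 < K) (hKN : K ≤ N) (E : ℕ → ℕ → Prop) : FinStruct cliqueVocab :=
  cliqueStruct (hK.trans_le hKN) (fun u : Fin N => ⟨u % K, (Nat.mod_lt _ hK).trans_le hKN⟩)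
    (fun u => ⟨(u % K + 1) % K, (Nat.mod_lt _ hK).trans_le hKN⟩) fun u v => E u v

/-- A satisfying team of size `K ^ 2` is a relation of the kind that `exists_transversal` treats;
conversely all pairs of vertices of a transversal clique form such a team. The colours are
themselves elements of the domain, which is why `K ≤ N` is needed. -/
theorem mem_pWT_iff_exists_transversal {K : ℕ} (hK : 0 < K) (hKN : K ≤ N) (E : ℕ → ℕ → Prop) :
    ((colourStruct hK hKN E).encode, K ^ 2) ∈ pWT cliqueFormula ↔
      ∃ U : Fin K → ℕ, (∀ c, U c < N ∧ U c % K = c) ∧ ∀ c c', E (U c) (U c') := by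
  rw [colourStruct, mem_pWT_cliqueFormula]
  constructor
  · rintro ⟨P, hP, hE, hsymm, hnext⟩
    obtain ⟨U, hU, hUE⟩ := exists_transversal P (fun u => u % K) hK (fun _ => Nat.mod_lt _ hK)
      (fun x y hxy => by
        obtain ⟨q, hq, h1, h2⟩ := hsymm _ hxy
        simp only at h1 h2
        rw [h1, h2]
        exact hq)
      (fun x y hxy => by
        obtain ⟨q, hq, h1, h2⟩ := hnext _ hxy
        simp only at h1 h2
        exact ⟨q.2, by rw [h1]; exact hq, (congrArg Fin.val h2).symm⟩) hP
    exact ⟨fun c => U c, fun c => ⟨Fin.is_lt _, hU c⟩, fun c c' => hE _ (hUE c c')⟩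
  · rintro ⟨U, hU, hE⟩
    refine ⟨_, encard_transversal (fun u : Fin N => u % K) (fun c => ⟨U c, (hU c).1⟩)
      (fun c => (hU c).2), ?_, ?_, ?_⟩
    · rintro _ ⟨⟨a, b⟩, rfl⟩
      exact hE a b
    · rintro _ ⟨⟨a, b⟩, rfl⟩
      exact ⟨_, ⟨(b, a), rfl⟩, rfl, rfl⟩
    · rintro _ ⟨⟨a, b⟩, rfl⟩
      refine ⟨_, ⟨(a, ⟨(b + 1) % K, Nat.mod_lt _ hK⟩), rfl⟩, rfl, Fin.ext ?_⟩
      simp only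
      rw [(hU _).2, (hU _).2]

end CliqueStruct

/-! ### The word that presents the graph -/

theorem List.map_range_append {β : Type} (a b : ℕ) (f g : ℕ → β) :
    (List.range a).map f ++ (List.range b).map g =
      (List.range (a + b)).map fun p => if p < a then f p else g (p - a) := by
  rw [List.range_add, List.map_append, List.map_map]
  congr 1
  · refine List.map_congr_left fun p hp => ?_
    rw [if_pos (List.mem_range.1 hp)]
  · refine List.map_congr_left fun p _ => ?_
    rw [Function.comp_apply, if_neg (by omega), Nat.add_sub_cancel_left]

open Classical in
/-- The number of the symbol that presents a bit of a binary relation. -/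
noncomputable def pairSymbol (N : ℕ) (Q : ℕ → ℕ → Prop) (q : ℕ) : ℕ :=
  1 + if Q (q % N) (q / N) then 1 else 0

/-- A pair is listed at the position that has its first component as the lower digit in base `N`, so
position `q` belongs to the pair of `q % N` and `q / N`. -/
theorem map_encodeRel_two {N : ℕ} {R : Set (Fin 2 → Fin N)} {Q : ℕ → ℕ → Prop}
    (h : ∀ v, v ∈ R ↔ Q (v 0) (v 1)) :
    (encodeRel R).map some = (List.range (N ^ 2)).map fun q => StackProg.symOfNat (pairSymbol N Q q) := by
  classical
  rw [encodeRel_eq_map_range (g := fun q => decide (Q (q % N) (q / N))), List.map_map]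
  · refine List.map_congr_left fun q _ => ?_
    rw [Function.comp_apply, pairSymbol]
    split_ifs with hq
    · rw [decide_eq_true hq]; rfl
    · rw [decide_eq_false hq]; rfl
  · intro v
    have h0 := finFunctionFinEquiv_symm_apply_val (finFunctionFinEquiv v) 0
    have h1 := finFunctionFinEquiv_symm_apply_val (finFunctionFinEquiv v) 1
    rw [Equiv.symm_apply_apply] at h0 h1
    rw [h, decide_eq_true_iff, h0, h1]
    have hlt : (finFunctionFinEquiv v : Fin (N ^ 2)).1 / N < N := by
      rw [Nat.div_lt_iff_lt_mul (Fin.pos (v 0)), ← sq]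
      exact Fin.is_lt _
    simp only [Fin.val_zero, Fin.val_one, pow_zero, pow_one, Nat.div_one]
    rw [Nat.mod_eq_of_lt hlt]

/-- The symbol at the position `p` of the word that presents the structure with two functions and a
binary relation, whose graphs are `G₁`, `G₂` and `G₃`. -/
noncomputable def cliqueSymbol (N a : ℕ) (G₁ G₂ G₃ : ℕ → ℕ → Prop) (p : ℕ) : ℕ :=
  if p < a then 0 else if p - a < N then 2 else if p - a - N < 1 then 1 else
    if p - a - N - 1 < N ^ 2 then pairSymbol N G₁ (p - a - N - 1) else
      if p - a - N - 1 - N ^ 2 < N ^ 2 then pairSymbol N G₂ (p - a - N - 1 - N ^ 2) else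
        pairSymbol N G₃ (p - a - N - 1 - N ^ 2 - N ^ 2)

/-- There are six blocks: the parameter in unary, the size in unary, the separating bit, and three
tables of `N ^ 2` bits. In the numbering of symbols, `0` is the parameter mark, `1` is the bit
`false` and `2` is the bit `true`. -/
theorem encodeInstance_cliqueStruct {N : ℕ} (hN : 0 < N) (c d : Fin N → Fin N)
    (E : Fin N → Fin N → Prop) {G₁ G₂ G₃ : ℕ → ℕ → Prop} (h₁ : ∀ u v : Fin N, c u = v ↔ G₁ u v)
    (h₂ : ∀ u v : Fin N, d u = v ↔ G₂ u v) (h₃ : ∀ u v, E u v ↔ G₃ u v) (a : ℕ) :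
    encodeInstance ((cliqueStruct hN c d E).encode, a) =
      (List.range (a + (N + (1 + (N ^ 2 + (N ^ 2 + N ^ 2)))))).map fun p =>
        StackProg.symOfNat (cliqueSymbol N a G₁ G₂ G₃ p) := by
  have e : (cliqueStruct hN c d E).encode = List.replicate N true ++ ([false] ++
      (encodeRel {v : Fin 2 → Fin N | c (v 0) = v 1} ++
        (encodeRel {v : Fin 2 → Fin N | d (v 0) = v 1} ++
          encodeRel {v : Fin 2 → Fin N | E (v 0) (v 1)}))) := by
    unfold FinStruct.encode
    simp only [cliqueVocab, List.length_cons, List.length_nil, List.finRange_succ,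
      List.finRange_zero, List.map_nil, List.map_cons, List.flatMap_cons, List.flatMap_nil,
      List.append_nil, List.append_assoc]
    rfl
  have hrep : ∀ (b : ℕ) (x : Option Bool), List.replicate b x = (List.range b).map fun _ => x := by
    simp
  unfold encodeInstance
  rw [e]
  simp only [List.map_append, List.map_replicate]
  rw [map_encodeRel_two (R := {v : Fin 2 → Fin N | c (v 0) = v 1}) fun v => h₁ _ _,
    map_encodeRel_two (R := {v : Fin 2 → Fin N | d (v 0) = v 1}) fun v => h₂ _ _,
    map_encodeRel_two (R := {v : Fin 2 → Fin N | E (v 0) (v 1)}) fun v => h₃ _ _, hrep, hrep,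
    show List.map some [false] = (List.range 1).map fun _ => StackProg.symOfNat 1 from rfl]
  simp only [List.map_range_append]
  refine List.map_congr_left fun p _ => ?_
  unfold cliqueSymbol
  split_ifs <;> rfl

theorem encodeInstance_colourStruct {N K : ℕ} (hK : 0 < K) (hKN : K ≤ N) (E : ℕ → ℕ → Prop)
    (a : ℕ) : encodeInstance ((colourStruct hK hKN E).encode, a) =
      (List.range (a + (N + (1 + (N ^ 2 + (N ^ 2 + N ^ 2)))))).map fun p =>
        StackProg.symOfNat (cliqueSymbol N a (fun u v => u % K = v)
          (fun u v => (u % K + 1) % K = v) E p) := by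
  have h₁ : ∀ u v : Fin N, (⟨u % K, (Nat.mod_lt _ hK).trans_le hKN⟩ : Fin N) = v ↔ u % K = v :=
    fun _ _ => Fin.ext_iff
  have h₂ : ∀ u v : Fin N, (⟨(u % K + 1) % K, (Nat.mod_lt _ hK).trans_le hKN⟩ : Fin N) = v ↔
      (u % K + 1) % K = v := fun _ _ => Fin.ext_iff
  have h₃ : ∀ u v : Fin N, E u v ↔ E u v := fun _ _ => Iff.rfl
  rw [colourStruct]
  exact encodeInstance_cliqueStruct (hK.trans_le hKN) _ _ _ (G₁ := fun u v => u % K = v)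
    (G₂ := fun u v => (u % K + 1) % K = v) h₁ h₂ h₃ a

/-! ### The reduction of weighted definability by `Π₁`-sentences to inclusion logic -/

section Reduction

theorem Expressible.pairSymbol {Z : Type} [ExprCtx Z] {N q : Z → ℕ} (hN : Expressible N)
    (hq : Expressible q) {Q : Z → ℕ → ℕ → Prop}
    (hQ : ∀ {u v : Z → ℕ}, Expressible u → Expressible v → ExpressibleP fun z => Q z (u z) (v z)) :
    Expressible fun z => pairSymbol (N z) (Q z) (q z) := by
  classical
  exact (expressible_const 1).add (hQ (hq.mod hN) (hq.div hN)).indicator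

theorem Expressible.cliqueSymbol {Z : Type} [ExprCtx Z] {N a p : Z → ℕ} (hN : Expressible N)
    (ha : Expressible a) (hp : Expressible p) {G₁ G₂ G₃ : Z → ℕ → ℕ → Prop}
    (h₁ : ∀ {u v : Z → ℕ}, Expressible u → Expressible v → ExpressibleP fun z => G₁ z (u z) (v z))
    (h₂ : ∀ {u v : Z → ℕ}, Expressible u → Expressible v → ExpressibleP fun z => G₂ z (u z) (v z))
    (h₃ : ∀ {u v : Z → ℕ}, Expressible u → Expressible v → ExpressibleP fun z => G₃ z (u z) (v z)) :
    Expressible fun z => cliqueSymbol (N z) (a z) (G₁ z) (G₂ z) (G₃ z) (p z) := by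
  have hp1 := hp.sub ha
  have hp2 := hp1.sub hN
  have hp3 := hp2.sub (expressible_const 1)
  have hp4 := hp3.sub (hN.pow 2)
  have hp5 := hp4.sub (hN.pow 2)
  exact (hp.lt ha).ite (expressible_const 0) ((hp1.lt hN).ite (expressible_const 2)
    ((hp2.lt (expressible_const 1)).ite (expressible_const 1)
      ((hp3.lt (hN.pow 2)).ite (hN.pairSymbol hp3 h₁)
        ((hp4.lt (hN.pow 2)).ite (hN.pairSymbol hp4 h₂) (hN.pairSymbol hp5 h₃)))))

theorem colours_pos (k m : ℕ) : 0 < (2 * k + 1) ^ m := Nat.pow_pos (Nat.succ_pos _)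

theorem colours_le_vtxCount (k m X : ℕ) {D : ℕ} (hD : 0 < D) :
    (2 * k + 1) ^ m ≤ vtxCount k m X D := by
  unfold vtxCount
  rw [mul_assoc]
  exact Nat.le_mul_of_pos_right _ (Nat.mul_pos (Nat.succ_pos _) (Nat.pow_pos hD))

variable {τ : Vocab} {s l : ℕ} (β : QFForm τ s l)

/-- The structure over `cliqueVocab` that is constructed from a word. -/
def reductionStruct (x : List Bool) (k : ℕ) {n : ℕ} (hn : 0 < n) : FinStruct cliqueVocab :=
  colourStruct (colours_pos k (l ^ s))
    (colours_le_vtxCount k (l ^ s) (n ^ l) (Nat.pow_pos (n := s) hn)) (FormEdge β x n k)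

open Classical in
/-- The reduction of the problem that is defined by a `Π₁`-sentence with kernel `β` to the problem
for `cliqueFormula`. -/
noncomputable def cliqueReduction (p : List Bool × ℕ) : List Bool × ℕ :=
  if h : 0 < leadingOnes p.1 ∧ p.1.length = relPos τ (leadingOnes p.1) τ.rels.length then
    ((reductionStruct β p.1 p.2 h.1).encode, ((2 * p.2 + 1) ^ l ^ s) ^ 2)
  else ([], 0)

theorem cliqueReduction_mem_iff (hl : 0 < l) (x : List Bool) (k : ℕ) :
    cliqueReduction β (x, k) ∈ pWT cliqueFormula ↔
      0 < leadingOnes x ∧ x.length = relPos τ (leadingOnes x) τ.rels.length ∧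
      ∃ w : ℕ → ℕ, (∀ i < k, w i < leadingOnes x ^ s) ∧ Set.InjOn w (Set.Iio k) ∧
        ∀ y < leadingOnes x ^ l, β.WordHolds x (leadingOnes x) y fun a =>
          decide (∃ i < k, digitCode (leadingOnes x) y
            (finFunctionFinEquiv.symm a : Fin s → Fin l) = w i) := by
  rw [← and_assoc]
  by_cases h : 0 < leadingOnes x ∧ x.length = relPos τ (leadingOnes x) τ.rels.length
  · rw [cliqueReduction, dif_pos h, reductionStruct, mem_pWT_iff_exists_transversal,
      and_iff_right h]
    exact exists_clique_iff (Nat.pow_pos hl) (Nat.pow_pos h.1)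
  · rw [cliqueReduction, dif_neg h]
    refine iff_of_false ?_ fun h' => h h'.1
    -- A word that encodes no structure is sent to the empty word, which is never an encoding, since
    -- the size and the separator already take up at least two bits.
    rintro ⟨A, hA, -⟩
    have := congrArg List.length hA
    rw [A.length_encode, List.length_nil] at this
    omega

theorem encodeInstance_cliqueReduction [DecidablePred fun z : WordInst => 0 < leadingOnes z.word ∧
      z.word.length = relPos τ (leadingOnes z.word) τ.rels.length] (z : WordInst) :
    encodeInstance (cliqueReduction β (z.word, z.param)) =
      (List.range (if 0 < leadingOnes z.word ∧
          z.word.length = relPos τ (leadingOnes z.word) τ.rels.length then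
        ((2 * z.param + 1) ^ l ^ s) ^ 2 +
          (vtxCount z.param (l ^ s) (leadingOnes z.word ^ l) (leadingOnes z.word ^ s) + (1 +
          (vtxCount z.param (l ^ s) (leadingOnes z.word ^ l) (leadingOnes z.word ^ s) ^ 2 +
          (vtxCount z.param (l ^ s) (leadingOnes z.word ^ l) (leadingOnes z.word ^ s) ^ 2 +
          vtxCount z.param (l ^ s) (leadingOnes z.word ^ l) (leadingOnes z.word ^ s) ^ 2))))
        else 0)).map fun p => StackProg.symOfNat (cliqueSymbol
          (vtxCount z.param (l ^ s) (leadingOnes z.word ^ l) (leadingOnes z.word ^ s))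
          (((2 * z.param + 1) ^ l ^ s) ^ 2)
          (fun u v => u % (2 * z.param + 1) ^ l ^ s = v)
          (fun u v => (u % (2 * z.param + 1) ^ l ^ s + 1) % (2 * z.param + 1) ^ l ^ s = v)
          (FormEdge β z.word (leadingOnes z.word) z.param) p) := by
  rw [cliqueReduction]
  split_ifs with h
  · exact encodeInstance_colourStruct _ _ _ _
  · rfl

/-- The length of the output and its symbol at each position are expressible in the input word, its
length and the parameter. All exponents depend only on `l` and `s`, hence on the fixed sentence and
not on the instance. -/
theorem FPTComputable.cliqueReduction {α : Type} {r₁ : List α × ℕ → List Bool × ℕ}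
    (h : FPTComputable r₁) : FPTComputable fun p => cliqueReduction β (r₁ p) := by
  classical
  have hn := expressible_leadingOnes
  have hk := expressible_param
  have hN := hk.vtxCount (hn.pow l) (hn.pow s) (l ^ s)
  have hK := (expressible_base hk).pow (l ^ s)
  obtain ⟨a, ha⟩ := ExpressibleP.ite (((expressible_const 0).lt hn).and
    (expressible_length.eq (hn.relPos τ τ.rels.length)))
    ((hK.pow 2).add (hN.add ((expressible_const 1).add ((hN.pow 2).add ((hN.pow 2).add
      (hN.pow 2)))))) (expressible_const 0)
  obtain ⟨b, hb⟩ := Expressible.cliqueSymbol hN.weaken (hK.pow 2).weaken expressible_snd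
    (G₁ := fun z u v => u % (2 * z.1.param + 1) ^ l ^ s = v)
    (G₂ := fun z u v => (u % (2 * z.1.param + 1) ^ l ^ s + 1) % (2 * z.1.param + 1) ^ l ^ s = v)
    (G₃ := fun z => FormEdge β z.1.word (leadingOnes z.1.word) z.1.param)
    (fun hu hv => (hu.mod hK.weaken).eq hv)
    (fun hu hv => (((hu.mod hK.weaken).add (expressible_const 1)).mod hK.weaken).eq hv)
    (fun hu hv => expressibleP_formEdge β hk.weaken hn.weaken hu hv)
  refine h.generate a b fun x k => ?_
  refine (encodeInstance_cliqueReduction β ⟨x, k⟩).trans ?_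
  have ha' := ha ⟨x, k⟩
  have hb' := fun i => hb (⟨x, k⟩, i)
  change a.eval x [x.length, k] = _ at ha'
  change ∀ i, b.eval x [i, x.length, k] = _ at hb'
  rw [ha']
  simp only [hb']

theorem snd_cliqueReduction_le (p : List Bool × ℕ) :
    (cliqueReduction β p).2 ≤ ((2 * p.2 + 1) ^ l ^ s) ^ 2 := by
  unfold cliqueReduction
  split_ifs
  · exact le_rfl
  · exact Nat.zero_le _

end Reduction

/-- The weighted team problem for `cliqueFormula` is hard for `W[1]`. -/
theorem wHard_cliqueFormula : WHard 1 (pWT cliqueFormula) := by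
  rintro α _ P ⟨τ, s, ψ, hτ, hψ, r, hr, hrP, g, hg, hgr⟩
  obtain ⟨l, β, hl, hβ⟩ := exists_mem_pWD_iff hτ ψ hψ
  refine ⟨fun p => cliqueReduction β (r p), hr.cliqueReduction β, fun p => ?_,
    fun k => ((2 * g k + 1) ^ l ^ s) ^ 2, ?_, fun x k => ?_⟩
  · rw [hrP p]
    exact (hβ _ _).trans (cliqueReduction_mem_iff β hl _ _).symm
  · have h : Primrec fun n : ℕ => ((2 * n + 1) ^ l ^ s) ^ 2 :=
      Primrec.pow_const (Primrec.pow_const (Primrec.succ.comp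
        (Primrec.nat_mul.comp (Primrec.const 2) Primrec.id)) _) _
    exact h.to_comp.comp hg
  · refine (snd_cliqueReduction_le β _).trans ?_
    change _ ≤ ((2 * g k + 1) ^ l ^ s) ^ 2
    gcongr
    exact hgr x k

/-! ### Functions as relations -/

namespace FinStruct

variable {τ : Vocab}

/-- The position where the bits of the graph of the function `f` start in the encoding of a
structure of size `n`. -/
def funPos (τ : Vocab) (n f : ℕ) : ℕ := n + 1 + ∑ j ∈ Finset.range f, n ^ (τ.funs.getD j 0 + 1)

theorem getD_encode_fun (A : FinStruct τ) {r : ℕ} (f : τ.lang.Functions r)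
    (v : Fin (r + 1) → A.Dom) :
    A.encode.getD (funPos τ A.size f.1 + (finFunctionFinEquiv v : Fin _)) false = true ↔
      A.str.funMap f (fun j => v j.castSucc) = v (Fin.last r) := by
  obtain ⟨i, rfl⟩ := f
  have hlen : ∀ j : Fin τ.funs.length, (encodeRel {v : Fin (τ.funs.get j + 1) → A.Dom |
      A.str.funMap (⟨j, rfl⟩ : τ.lang.Functions (τ.funs.get j)) (fun j => v j.castSucc)
          = v (Fin.last _)}).length = A.size ^ (τ.funs.getD j 0 + 1) := by
    intro j
    rw [length_encodeRel, List.getD_eq_getElem _ _ j.2]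
    rfl
  have hp : (finFunctionFinEquiv v : Fin _).1 < A.size ^ (τ.funs.getD i 0 + 1) := by
    rw [← hlen, length_encodeRel]
    exact Fin.is_lt _
  have h := List.getD_flatMap_finRange false (len := fun j => A.size ^ (τ.funs.getD j 0 + 1)) hlen
    i hp
  unfold encode funPos
  rw [List.getD_append, add_assoc, List.getD_append_right]
  · have h0 : ∀ x, A.size + 1 + x - (List.replicate A.size true ++ [false]).length = x := by
      intro x; simp
    rw [h0, h, getD_encodeRel]
    exact Iff.rfl
  · simp
  · rw [List.length_append, List.length_flatMap_finRange
      (len := fun j => A.size ^ (τ.funs.getD j 0 + 1)) hlen]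
    have h1 : ∑ j ∈ Finset.range (i + 1), A.size ^ (τ.funs.getD j 0 + 1) ≤
        ∑ j ∈ Finset.range τ.funs.length, A.size ^ (τ.funs.getD j 0 + 1) :=
      Finset.sum_le_sum_of_subset (Finset.range_subset_range.2 i.2)
    rw [Finset.sum_range_succ] at h1
    simp only [List.length_append, List.length_replicate, List.length_singleton]
    omega

theorem getD_encode_rel (A : FinStruct τ) {r : ℕ} (R : τ.lang.Relations r)
    (v : Fin r → A.Dom) :
    A.encode.getD (funPos τ A.size τ.funs.length + (∑ j ∈ Finset.range R.1, A.size ^ τ.rels.getD j 0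
      + (finFunctionFinEquiv v : Fin _))) false = true ↔ A.str.RelMap R v := by
  obtain ⟨i, rfl⟩ := R
  have hlenF : ∀ j : Fin τ.funs.length, (encodeRel {v : Fin (τ.funs.get j + 1) → A.Dom |
      A.str.funMap (⟨j, rfl⟩ : τ.lang.Functions (τ.funs.get j)) (fun j => v j.castSucc)
          = v (Fin.last _)}).length = A.size ^ (τ.funs.getD j 0 + 1) := by
    intro j
    rw [length_encodeRel, List.getD_eq_getElem _ _ j.2]
    rfl
  have hlen : ∀ j : Fin τ.rels.length, (encodeRel {v : Fin (τ.rels.get j) → A.Dom |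
      A.str.RelMap (⟨j, rfl⟩ : τ.lang.Relations (τ.rels.get j)) v}).length
        = A.size ^ τ.rels.getD j 0 := by
    intro j
    rw [length_encodeRel, List.getD_eq_getElem _ _ j.2]
    rfl
  have hp : (finFunctionFinEquiv v : Fin _).1 < A.size ^ τ.rels.getD i 0 := by
    rw [← hlen, length_encodeRel]
    exact Fin.is_lt _
  have h := List.getD_flatMap_finRange false (len := fun j => A.size ^ τ.rels.getD j 0) hlen i hp
  have h0 : (List.replicate A.size true ++ [false] ++
      (List.finRange τ.funs.length).flatMap (fun i =>
        encodeRel {v : Fin (τ.funs.get i + 1) → A.Dom |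
          A.str.funMap (⟨i, rfl⟩ : τ.lang.Functions (τ.funs.get i)) (fun j => v j.castSucc)
            = v (Fin.last _)})).length = funPos τ A.size τ.funs.length := by
    rw [List.length_append, List.length_flatMap_finRange
      (len := fun j => A.size ^ (τ.funs.getD j 0 + 1)) hlenF]
    simp [funPos]
  unfold encode
  rw [List.getD_append_right _ _ _ _ (by rw [h0]; exact Nat.le_add_right _ _), h0,
    Nat.add_sub_cancel_left, h, getD_encodeRel]
  exact Iff.rfl

end FinStruct

namespace Vocab

/-- The relational vocabulary in which the functions are replaced by their graphs. -/
def graphVocab (τ : Vocab) : Vocab := ⟨[], τ.funs.map (· + 1) ++ τ.rels⟩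

variable (τ : Vocab)

theorem isRelational_graphVocab : τ.graphVocab.IsRelational := rfl

variable {τ}

/-- The symbol for the graph of a function. -/
def graphRel {r : ℕ} (f : τ.lang.Functions r) : τ.graphVocab.lang.Relations (r + 1) :=
  ⟨⟨f.1, by
    have := f.1.2
    simp only [graphVocab, List.length_append, List.length_map]
    omega⟩, by
    have h := f.2
    simp only [graphVocab, List.get_eq_getElem] at h ⊢
    rw [List.getElem_append_left (by simp), List.getElem_map, h]⟩

/-- The symbol for a relation of the original vocabulary. -/
def oldRel {r : ℕ} (R : τ.lang.Relations r) : τ.graphVocab.lang.Relations r :=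
  ⟨⟨τ.funs.length + R.1, by
    have := R.1.2
    simp only [graphVocab, List.length_append, List.length_map]
    omega⟩, by
    have h := R.2
    simp only [graphVocab, List.get_eq_getElem] at h ⊢
    rw [List.getElem_append_right (by simp)]
    simp only [List.length_map, Nat.add_sub_cancel_left]
    exact h⟩

theorem graphRel_or_oldRel {r : ℕ} (R : τ.graphVocab.lang.Relations r) :
    (∃ (q : ℕ) (h : q + 1 = r) (f : τ.lang.Functions q), R = h ▸ graphRel f) ∨
      ∃ R' : τ.lang.Relations r, R = oldRel R' := by
  obtain ⟨⟨i, hi⟩, hr⟩ := R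
  have hi' := hi
  simp only [graphVocab, List.length_append, List.length_map, List.get_eq_getElem] at hi' hr
  by_cases h : i < τ.funs.length
  · left
    rw [List.getElem_append_left (by simpa using h), List.getElem_map] at hr
    subst hr
    exact ⟨τ.funs[i], rfl, ⟨⟨i, h⟩, rfl⟩, rfl⟩
  · right
    rw [List.getElem_append_right (by simpa using h)] at hr
    simp only [List.length_map] at hr
    exact ⟨⟨⟨i - τ.funs.length, by omega⟩, hr⟩,
      Subtype.ext (Fin.ext (Nat.add_sub_cancel' (not_lt.1 h)).symm)⟩

theorem getD_rels_graphVocab_left {j : ℕ} (h : j < τ.funs.length) :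
    τ.graphVocab.rels.getD j 0 = τ.funs.getD j 0 + 1 := by
  have h' : j < (τ.funs.map (· + 1)).length := by simpa using h
  rw [graphVocab, List.getD_append _ _ _ _ h', List.getD_eq_getElem _ _ h',
    List.getD_eq_getElem _ _ h, List.getElem_map]

theorem getD_rels_graphVocab_right (j : ℕ) :
    τ.graphVocab.rels.getD (τ.funs.length + j) 0 = τ.rels.getD j 0 := by
  rw [graphVocab, List.getD_append_right _ _ _ _ (by simp)]
  simp

theorem sum_rels_graphVocab_left (n : ℕ) {i : ℕ} (h : i ≤ τ.funs.length) :
    ∑ j ∈ Finset.range i, n ^ τ.graphVocab.rels.getD j 0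
      = ∑ j ∈ Finset.range i, n ^ (τ.funs.getD j 0 + 1) :=
  Finset.sum_congr rfl fun j hj => by
    rw [getD_rels_graphVocab_left ((Finset.mem_range.1 hj).trans_le h)]

theorem sum_rels_graphVocab_right (n i : ℕ) :
    ∑ j ∈ Finset.range (τ.funs.length + i), n ^ τ.graphVocab.rels.getD j 0
      = ∑ j ∈ Finset.range τ.funs.length, n ^ (τ.funs.getD j 0 + 1) +
        ∑ j ∈ Finset.range i, n ^ τ.rels.getD j 0 := by
  rw [Finset.sum_range_add, sum_rels_graphVocab_left n le_rfl]
  simp only [getD_rels_graphVocab_right]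

end Vocab

/-- A structure with functions and a relational structure that represents it. -/
structure Represents {τ : Vocab} {n : ℕ} (sA : τ.lang.Structure (Fin n))
    (sR : τ.graphVocab.lang.Structure (Fin n)) : Prop where
  graph : ∀ {r : ℕ} (f : τ.lang.Functions r) (v : Fin (r + 1) → Fin n),
    sR.RelMap (Vocab.graphRel f) v ↔ sA.funMap f (fun j => v j.castSucc) = v (Fin.last r)
  rel : ∀ {r : ℕ} (R : τ.lang.Relations r) (v : Fin r → Fin n),
    sR.RelMap (Vocab.oldRel R) v ↔ sA.RelMap R v

section Represents

variable {τ : Vocab} {n : ℕ}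

/-- In the encoding over `graphVocab` the tables of the graphs come first and those of the old
relations follow, exactly where the encoding of the structure with functions has them. -/
theorem represents_of_encode_eq {hn hn' : 0 < n} {sA : τ.lang.Structure (Fin n)}
    {sR : τ.graphVocab.lang.Structure (Fin n)}
    (h : (FinStruct.mk n hn sA).encode = (FinStruct.mk n hn' sR).encode) : Represents sA sR where
  graph f v := by
    have h1 := (FinStruct.mk n hn sA).getD_encode_fun f v
    have h2 := (FinStruct.mk n hn' sR).getD_encode_rel (Vocab.graphRel f) v
    refine h2.symm.trans (Iff.trans ?_ h1)
    rw [h]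
    have e : ∑ j ∈ Finset.range (Vocab.graphRel f).1.1, n ^ τ.graphVocab.rels.getD j 0
        = ∑ j ∈ Finset.range f.1, n ^ (τ.funs.getD j 0 + 1) :=
      Vocab.sum_rels_graphVocab_left n f.1.2.le
    rw [e, FinStruct.funPos, FinStruct.funPos, add_assoc, add_assoc]
    simp [Vocab.graphVocab, add_assoc]
  rel R v := by
    have h1 := (FinStruct.mk n hn sA).getD_encode_rel R v
    have h2 := (FinStruct.mk n hn' sR).getD_encode_rel (Vocab.oldRel R) v
    refine h2.symm.trans (Iff.trans ?_ h1)
    rw [h]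
    have e : ∑ j ∈ Finset.range (Vocab.oldRel R).1.1, n ^ τ.graphVocab.rels.getD j 0
        = ∑ j ∈ Finset.range τ.funs.length, n ^ (τ.funs.getD j 0 + 1) +
        ∑ j ∈ Finset.range R.1, n ^ τ.rels.getD j 0 := Vocab.sum_rels_graphVocab_right n R.1
    rw [e, FinStruct.funPos, FinStruct.funPos]
    simp [Vocab.graphVocab, add_assoc]

/-- The encoding over `τ` has the length required of an encoding over `graphVocab`, and over a
relational vocabulary this already makes it an encoding. -/
theorem exists_encode_graphVocab (hn : 0 < n) (sA : τ.lang.Structure (Fin n)) :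
    ∃ sR : τ.graphVocab.lang.Structure (Fin n),
      (FinStruct.mk n hn sA).encode = (FinStruct.mk n hn sR).encode := by
  have h := (FinStruct.exists_encode_iff τ.isRelational_graphVocab (FinStruct.mk n hn sA).encode).2
    (by
      rw [FinStruct.leadingOnes_encode, FinStruct.length_encode, relPos]
      refine ⟨hn, ?_⟩
      have e : τ.graphVocab.rels.length = τ.funs.length + τ.rels.length := by
        simp [Vocab.graphVocab]
      rw [e, Vocab.sum_rels_graphVocab_right, add_assoc])
  obtain ⟨⟨n', hn', sR⟩, hR⟩ := h
  have hs := congrArg leadingOnes hR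
  rw [FinStruct.leadingOnes_encode, FinStruct.leadingOnes_encode] at hs
  obtain rfl : n = n' := hs
  exact ⟨sR, hR⟩

/-- The word of `sA` is decoded to some relational structure, which represents `sA`. A representing
structure is unique because every symbol of `graphVocab` is a graph symbol or an old relation
symbol. -/
theorem Represents.encode_eq {sA : τ.lang.Structure (Fin n)}
    {sR : τ.graphVocab.lang.Structure (Fin n)} (h : Represents sA sR) (hn : 0 < n) :
    (FinStruct.mk n hn sA).encode = (FinStruct.mk n hn sR).encode := by
  obtain ⟨sR', hR'⟩ := exists_encode_graphVocab hn sA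
  have h' := represents_of_encode_eq hR'
  rw [hR']
  have : sR' = sR := by
    refine Language.Structure.ext ?_ ?_
    · funext r f
      exact f.1.elim0
    · funext r R v
      rcases Vocab.graphRel_or_oldRel R with ⟨q, rfl, f, rfl⟩ | ⟨R, rfl⟩
      · exact propext ((h'.graph f v).trans (h.graph f v).symm)
      · exact propext ((h'.rel R v).trans (h.rel R v).symm)
  rw [this]

theorem exists_represents {sR : τ.graphVocab.lang.Structure (Fin n)}
    (h : ∀ {r : ℕ} (f : τ.lang.Functions r) (v : Fin r → Fin n),
      ∃! z, sR.RelMap (Vocab.graphRel f) (Fin.snoc v z : Fin (r + 1) → Fin n)) :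
    ∃ sA : τ.lang.Structure (Fin n), Represents sA sR := by
  refine ⟨⟨fun f v => (h f v).choose, fun R v => sR.RelMap (Vocab.oldRel R) v⟩,
    ⟨fun f v => ?_, fun R v => Iff.rfl⟩⟩
  obtain ⟨h1, h2⟩ := (h f fun j => v j.castSucc).choose_spec
  change _ ↔ (h f fun j => v j.castSucc).choose = _
  have e : v = (Fin.snoc (fun j => v j.castSucc) (v (Fin.last _)) : Fin (_ + 1) → Fin n) :=
    (Fin.snoc_init_self v).symm
  constructor
  · intro hv
    rw [e] at hv
    exact (h2 _ hv).symm
  · intro hv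
    rw [hv, ← e] at h1
    exact h1

end Represents

/-! ### Definability by quantifier-free, existential and `Π₂`-formulas in a family of structures -/

section Definability

variable {L : FirstOrder.Language.{0, 0}} {I : Type} (M : I → Type) [∀ i, L.Structure (M i)]

/-- `Q` is defined by a quantifier-free formula with the variables `V`. -/
def QFDef (L : FirstOrder.Language.{0, 0}) [∀ i, L.Structure (M i)] {V : Type}
    (Q : ∀ i, (V → M i) → Prop) : Prop :=
  ∃ q : L.Formula V, q.IsQF ∧ ∀ i v, q.Realize v ↔ Q i v

/-- `Q` is defined by an existential formula with the variables `V`. -/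
def ExDef (L : FirstOrder.Language.{0, 0}) [∀ i, L.Structure (M i)] {V : Type}
    (Q : ∀ i, (V → M i) → Prop) : Prop :=
  ∃ (Y : Type) (_ : Finite Y) (R : ∀ i, (V ⊕ Y → M i) → Prop), QFDef M L R ∧
    ∀ i v, Q i v ↔ ∃ y, R i (Sum.elim v y)

/-- `Q` is defined by a sentence with a quantifier prefix `∀ ⋯ ∀ ∃ ⋯ ∃`. -/
def AllExDef (L : FirstOrder.Language.{0, 0}) [∀ i, L.Structure (M i)] (Q : I → Prop) : Prop :=
  ∃ (X : Type) (_ : Finite X) (R : ∀ i, (X → M i) → Prop), ExDef M L R ∧ ∀ i, Q i ↔ ∀ x, R i x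

variable {M} {V W : Type}

theorem QFDef.congr {Q R : ∀ i, (V → M i) → Prop} (h : QFDef M L Q) (hQR : ∀ i v, Q i v ↔ R i v) :
    QFDef M L R := by
  obtain ⟨q, hq, hqQ⟩ := h
  exact ⟨q, hq, fun i v => (hqQ i v).trans (hQR i v)⟩

theorem qfDef_eq (x y : V) : QFDef M L fun _ v => v x = v y :=
  ⟨(Language.Term.var x).equal (Language.Term.var y), .of_isAtomic (.equal _ _), fun i v => by
    simp⟩

theorem qfDef_rel {n : ℕ} (R : L.Relations n) (x : Fin n → V) :
    QFDef M L fun i v => (inferInstance : L.Structure (M i)).RelMap R fun j => v (x j) :=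
  ⟨R.formula fun j => Language.Term.var (x j), .of_isAtomic (.rel _ _), fun i v => by
    simp [Language.Formula.realize_rel]⟩

theorem QFDef.not {Q : ∀ i, (V → M i) → Prop} (h : QFDef M L Q) :
    QFDef M L fun i v => ¬ Q i v := by
  obtain ⟨q, hq, hqQ⟩ := h
  exact ⟨q.not, hq.not, fun i v => by rw [Language.Formula.realize_not, hqQ]⟩

theorem QFDef.and {Q R : ∀ i, (V → M i) → Prop} (hQ : QFDef M L Q) (hR : QFDef M L R) :
    QFDef M L fun i v => Q i v ∧ R i v := by
  obtain ⟨q, hq, hqQ⟩ := hQ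
  obtain ⟨r, hr, hrR⟩ := hR
  exact ⟨q ⊓ r, hq.inf hr, fun i v => by rw [Language.Formula.realize_inf, hqQ, hrR]⟩

theorem QFDef.or {Q R : ∀ i, (V → M i) → Prop} (hQ : QFDef M L Q) (hR : QFDef M L R) :
    QFDef M L fun i v => Q i v ∨ R i v :=
  (hQ.not.and hR.not).not.congr fun i v => by tauto

theorem QFDef.comp {Q : ∀ i, (V → M i) → Prop} (h : QFDef M L Q) (f : V → W) :
    QFDef M L fun i w => Q i fun x => w (f x) := by
  obtain ⟨q, hq, hqQ⟩ := h
  refine ⟨Language.Formula.relabel f q, hq.relabel _, fun i v => ?_⟩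
  rw [Language.Formula.realize_relabel, hqQ]
  rfl

theorem ExDef.congr {Q R : ∀ i, (V → M i) → Prop} (h : ExDef M L Q) (hQR : ∀ i v, Q i v ↔ R i v) :
    ExDef M L R := by
  obtain ⟨Y, hY, q, hq, hqQ⟩ := h
  exact ⟨Y, hY, q, hq, fun i v => (hQR i v).symm.trans (hqQ i v)⟩

theorem QFDef.exDef {Q : ∀ i, (V → M i) → Prop} (h : QFDef M L Q) : ExDef M L Q :=
  ⟨Empty, inferInstance, _, h.comp Sum.inl, fun _ _ => by simp⟩

theorem ExDef.ex {Z : Type} [Finite Z] {Q : ∀ i, (V ⊕ Z → M i) → Prop} (h : ExDef M L Q) :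
    ExDef M L fun i v => ∃ z, Q i (Sum.elim v z) := by
  obtain ⟨Y, hY, R, hR, hQR⟩ := h
  refine ⟨Z ⊕ Y, inferInstance, _, hR.comp (Equiv.sumAssoc V Z Y), fun i v => ?_⟩
  simp only [hQR]
  constructor
  · rintro ⟨z, y, h⟩
    refine ⟨Sum.elim z y, ?_⟩
    convert h with x
    rcases x with (x | x) | x <;> rfl
  · rintro ⟨y, h⟩
    refine ⟨fun z => y (Sum.inl z), fun z => y (Sum.inr z), ?_⟩
    convert h with x
    rcases x with (x | x) | x <;> rfl

theorem ExDef.and {Q R : ∀ i, (V → M i) → Prop} (hQ : ExDef M L Q) (hR : ExDef M L R) :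
    ExDef M L fun i v => Q i v ∧ R i v := by
  obtain ⟨Y, hY, q, hq, hqQ⟩ := hQ
  obtain ⟨Y', hY', r, hr, hrR⟩ := hR
  refine ⟨Y ⊕ Y', inferInstance, _, (hq.comp (Sum.map id Sum.inl)).and
    (hr.comp (Sum.map id Sum.inr)), fun i v => ?_⟩
  simp only [hqQ, hrR]
  have h1 : ∀ y : Y ⊕ Y' → M i, (fun x : V ⊕ Y => (Sum.elim v y : V ⊕ (Y ⊕ Y') → M i)
      (Sum.map id Sum.inl x)) = Sum.elim v fun x => y (Sum.inl x) := fun y => by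
    funext x; cases x <;> rfl
  have h2 : ∀ y : Y ⊕ Y' → M i, (fun x : V ⊕ Y' => (Sum.elim v y : V ⊕ (Y ⊕ Y') → M i)
      (Sum.map id Sum.inr x)) = Sum.elim v fun x => y (Sum.inr x) := fun y => by
    funext x; cases x <;> rfl
  simp only [h1, h2]
  constructor
  · rintro ⟨⟨y, hy⟩, y', hy'⟩
    exact ⟨Sum.elim y y', hy, hy'⟩
  · rintro ⟨y, hy, hy'⟩
    exact ⟨⟨_, hy⟩, _, hy'⟩

theorem exDef_forall {ι : Type} [Finite ι] {Q : ι → ∀ i, (V → M i) → Prop}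
    (h : ∀ j, ExDef M L (Q j)) : ExDef M L fun i v => ∀ j, Q j i v := by
  classical
  have := Fintype.ofFinite ι
  suffices H : ∀ s : Finset ι, ExDef M L fun i v => ∀ j ∈ s, Q j i v from
    (H Finset.univ).congr fun i v => by simp
  intro s
  induction s using Finset.induction_on with
  | empty => exact (QFDef.exDef ⟨⊤, Language.BoundedFormula.IsQF.top, fun i v => by simp⟩)
  | insert j s _ ih => exact ((h j).and ih).congr fun i v => by simp

/-- The existential quantifier is pulled out of the implication; when the premise fails, a witness
must still exist, and this uses nonempty domains. -/
theorem QFDef.imp_exDef [∀ i, Nonempty (M i)] {Q R : ∀ i, (V → M i) → Prop} (hQ : QFDef M L Q)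
    (hR : ExDef M L R) : ExDef M L fun i v => Q i v → R i v := by
  obtain ⟨Y, hY, r, hr, hrR⟩ := hR
  refine ⟨Y, hY, _, (hQ.comp Sum.inl).not.or hr, fun i v => ?_⟩
  simp only [hrR, Sum.elim_inl]
  constructor
  · intro h
    by_cases hq : Q i v
    · obtain ⟨y, hy⟩ := h hq
      exact ⟨y, Or.inr hy⟩
    · exact ⟨fun _ => Classical.arbitrary _, Or.inl hq⟩
  · rintro ⟨y, h⟩ hq
    exact ⟨y, h.resolve_left fun h => h hq⟩

theorem ExDef.comp {Q : ∀ i, (V → M i) → Prop} (h : ExDef M L Q) (f : V → W) :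
    ExDef M L fun i w => Q i fun x => w (f x) := by
  obtain ⟨Y, hY, q, hq, hqQ⟩ := h
  refine ⟨Y, hY, _, hq.comp (Sum.map f id), fun i w => ?_⟩
  refine (hqQ i _).trans (exists_congr fun y => ?_)
  have : (Sum.elim (fun x => w (f x)) y : V ⊕ Y → M i) = fun x => (Sum.elim w y) (Sum.map f id x) := by
    funext x; cases x <;> rfl
  rw [this]

theorem AllExDef.congr {Q R : I → Prop} (h : AllExDef M L Q) (hQR : ∀ i, Q i ↔ R i) :
    AllExDef M L R := (funext fun i => propext (hQR i) : Q = R) ▸ h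

theorem ExDef.all [Finite V] {Q : ∀ i, (V → M i) → Prop} (h : ExDef M L Q) :
    AllExDef M L fun i => ∀ v, Q i v := ⟨V, inferInstance, Q, h, fun _ => Iff.rfl⟩

/-- Both universal prefixes are merged into one. To recover a single conjunct, the variables of the
other one are given arbitrary values, which needs nonempty domains. -/
theorem AllExDef.and [∀ i, Nonempty (M i)] {Q R : I → Prop} (hQ : AllExDef M L Q)
    (hR : AllExDef M L R) : AllExDef M L fun i => Q i ∧ R i := by
  obtain ⟨X, hX, q, hq, hqQ⟩ := hQ
  obtain ⟨X', hX', r, hr, hrR⟩ := hR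
  refine ⟨X ⊕ X', inferInstance, _, (hq.comp Sum.inl).and (hr.comp Sum.inr), fun i => ?_⟩
  simp only [hqQ, hrR]
  constructor
  · rintro ⟨h, h'⟩ x
    exact ⟨h _, h' _⟩
  · intro h
    exact ⟨fun x => (h (Sum.elim x fun _ => Classical.arbitrary _)).1,
      fun x => (h (Sum.elim (fun _ => Classical.arbitrary _) x)).2⟩

theorem allExDef_forall [∀ i, Nonempty (M i)] {ι : Type} [Finite ι] {Q : ι → I → Prop}
    (h : ∀ j, AllExDef M L (Q j)) : AllExDef M L fun i => ∀ j, Q j i := by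
  classical
  have := Fintype.ofFinite ι
  suffices H : ∀ s : Finset ι, AllExDef M L fun i => ∀ j ∈ s, Q j i from
    (H Finset.univ).congr fun i => by simp
  intro s
  induction s using Finset.induction_on with
  | empty =>
    refine (ExDef.all (V := Empty) (Q := fun _ _ => True) (QFDef.exDef
      ⟨⊤, Language.BoundedFormula.IsQF.top, fun i v => by simp⟩)).congr fun i => by simp
  | insert j s _ ih => exact ((h j).and ih).congr fun i => by simp

theorem exists_isSigmaForm_exs {n : ℕ} (b : ℕ) (φ : L.BoundedFormula Empty (n + b))
    (h : IsSigmaForm 1 φ) : ∃ ψ : L.BoundedFormula Empty n, IsSigmaForm 1 ψ ∧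
      ∀ (N : Type) [L.Structure N] (xs : Fin n → N), ψ.Realize default xs ↔
        ∃ ys : Fin b → N, φ.Realize default (Fin.append xs ys) := by
  induction b with
  | zero =>
    refine ⟨φ, h, fun N _ xs => ?_⟩
    have : ∀ ys : Fin 0 → N, Fin.append xs ys = xs := fun ys => by
      rw [Subsingleton.elim ys Fin.elim0, Fin.append_elim0]
      rfl
    simp only [this, exists_const]
  | succ b ih =>
    obtain ⟨ψ, hψ, H⟩ := ih (Language.BoundedFormula.ex (n := n + b) φ) (.ex h)
    refine ⟨ψ, hψ, fun N _ xs => (H N xs).trans ?_⟩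
    simp only [Language.BoundedFormula.realize_ex]
    constructor
    · rintro ⟨ys, z, h⟩
      refine ⟨Fin.snoc ys z, ?_⟩
      rw [Fin.append_snoc]
      exact h
    · rintro ⟨ys, h⟩
      refine ⟨Fin.init ys, ys (Fin.last b), ?_⟩
      rw [← Fin.append_snoc, Fin.snoc_init_self]
      exact h

theorem isPiForm_alls : ∀ {n : ℕ} (φ : L.BoundedFormula Empty n), IsPiForm 2 φ →
    IsPiForm 2 φ.alls
  | 0, _, h => h
  | _ + 1, φ, h => isPiForm_alls φ.all (.all h)

/-- A property that is defined by a prefix `∀ ⋯ ∀ ∃ ⋯ ∃` is defined by a `Π₂`-sentence. -/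
theorem AllExDef.exists_sentence {Q : I → Prop} (h : AllExDef M L Q) :
    ∃ ψ : L.Sentence, IsPiForm 2 ψ ∧ ∀ i, M i ⊨ ψ ↔ Q i := by
  obtain ⟨X, hX, R, ⟨Y, hY, S, ⟨q, hq, hqS⟩, hRS⟩, hQR⟩ := h
  obtain ⟨a, ⟨eX⟩⟩ := Finite.exists_equiv_fin X
  obtain ⟨b, ⟨eY⟩⟩ := Finite.exists_equiv_fin Y
  -- The universal variables take the first `a` de Bruijn levels and the existential ones the last
  -- `b`, so that the existential quantifiers are the inner ones.
  let g : X ⊕ Y → Empty ⊕ Fin (a + b) :=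
    Sum.elim (fun x => Sum.inr ((eX x).castAdd b)) fun y => Sum.inr ((eY y).natAdd a)
  let q' : L.BoundedFormula Empty (a + b) := Language.BoundedFormula.relabel g q
  have hq' : q'.IsQF := hq.relabel g
  obtain ⟨ψ, hψ, H⟩ := exists_isSigmaForm_exs b q' (.of_pi (.qf hq'))
  refine ⟨ψ.alls, isPiForm_alls _ (.of_sigma hψ), fun i => ?_⟩
  refine Language.BoundedFormula.realize_alls.trans ?_
  rw [hQR]
  have key : ∀ (x : X → M i) (y : Y → M i),
      q'.Realize default (Fin.append (x ∘ eX.symm) (y ∘ eY.symm)) ↔ S i (Sum.elim x y) := by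
    intro x y
    rw [← hqS]
    refine Language.BoundedFormula.realize_relabel.trans ?_
    rw [Language.Formula.Realize]
    have h1 : Sum.elim (default : Empty → M i)
        (Fin.append (x ∘ eX.symm) (y ∘ eY.symm) ∘ Fin.castAdd 0) ∘ g = Sum.elim x y := by
      funext z
      rcases z with z | z
      · change Fin.append (x ∘ eX.symm) (y ∘ eY.symm) ((eX z).castAdd b) = x z
        simp
      · change Fin.append (x ∘ eX.symm) (y ∘ eY.symm) ((eY z).natAdd a) = y z
        simp
    rw [h1]
    exact iff_of_eq (congrArg _ (Subsingleton.elim _ _))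
  simp only [H, hRS]
  constructor
  · intro h x
    obtain ⟨ys, hys⟩ := h (x ∘ eX.symm)
    refine ⟨ys ∘ eY, (key _ _).1 ?_⟩
    rw [Function.comp_assoc, Equiv.self_comp_symm]
    exact hys
  · intro h xs
    obtain ⟨y, hy⟩ := h (xs ∘ eX)
    refine ⟨y ∘ eY.symm, ?_⟩
    have := (key _ _).2 hy
    rw [Function.comp_assoc, Equiv.self_comp_symm] at this
    exact this

end Definability

/-! ### Inclusion logic without disjunctions is `Π₂`-definable -/

/-- A relational structure over the vocabulary of graphs together with a relation. -/
structure RelModel (τ : Vocab) (s : ℕ) where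
  size : ℕ
  size_pos : 0 < size
  str : τ.graphVocab.lang.Structure (Fin size)
  S : Set (Fin s → Fin size)

namespace RelModel

variable {τ : Vocab} {s : ℕ}

/-- The domain of a relational model. -/
abbrev Dom (i : RelModel τ s) : Type := Fin i.size

instance (i : RelModel τ s) : Nonempty i.Dom := ⟨⟨0, i.size_pos⟩⟩

instance (i : RelModel τ s) : (τ.graphVocab.lang.sum (relVarLang s)).Structure i.Dom :=
  (FinStruct.mk i.size i.size_pos i.str).expand i.S

/-- All function symbols are interpreted by graphs of functions. -/
def IsFunctional (i : RelModel τ s) : Prop :=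
  ∀ (f : Fin τ.funs.length) (v : Fin (τ.funs.get f) → i.Dom),
    ∃! z, i.str.RelMap (Vocab.graphRel (⟨f, rfl⟩ : τ.lang.Functions (τ.funs.get f)))
      (Fin.snoc v z : Fin (τ.funs.get f + 1) → i.Dom)

end RelModel

/-- A relational model that represents a structure with functions. -/
structure FunModel (τ : Vocab) (s : ℕ) extends RelModel τ s where
  funStr : τ.lang.Structure (Fin size)
  represents : Represents funStr str

namespace FunModel

variable {τ : Vocab} {s : ℕ}

/-- The domain of a model. -/
abbrev Dom (i : FunModel τ s) : Type := i.toRelModel.Dom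

instance (i : FunModel τ s) : τ.lang.Structure i.Dom := i.funStr

end FunModel

section Definability

variable {τ : Vocab} {s : ℕ}

/-- The language of the relational vocabulary with the relation variable. -/
abbrev graphLang (τ : Vocab) (s : ℕ) : FirstOrder.Language.{0, 0} :=
  τ.graphVocab.lang.sum (relVarLang s)

theorem qfDef_str {I : Type} (m : I → RelModel τ s) {V : Type} {n : ℕ}
    (R : τ.graphVocab.lang.Relations n) (x : Fin n → V) :
    QFDef (fun i => (m i).Dom) (graphLang τ s) fun i v => (m i).str.RelMap R fun j => v (x j) :=
  qfDef_rel (L := graphLang τ s) (Sum.inl R) x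

theorem qfDef_mem {I : Type} (m : I → RelModel τ s) {V : Type} (x : Fin s → V) :
    QFDef (fun i => (m i).Dom) (graphLang τ s) fun i v => (fun j => v (x j)) ∈ (m i).S :=
  qfDef_rel (L := graphLang τ s) (Sum.inr ⟨rfl⟩) x

/-- Existence of a value has the form `∀∃`, and its uniqueness is purely universal. -/
theorem allExDef_isFunctional :
    AllExDef (fun i : RelModel τ s => i.Dom) (graphLang τ s) RelModel.IsFunctional := by
  refine allExDef_forall fun f => ?_
  have hgraph : ∀ {V : Type} (x : Fin (τ.funs.get f) → V) (z : V),
      QFDef (fun i : RelModel τ s => i.Dom) (graphLang τ s) fun i v => i.str.RelMap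
        (Vocab.graphRel (⟨f, rfl⟩ : τ.lang.Functions (τ.funs.get f)))
        (Fin.snoc (fun j => v (x j)) (v z) : Fin (τ.funs.get f + 1) → i.Dom) := by
    intro V x z
    refine (qfDef_str id (Vocab.graphRel (⟨f, rfl⟩ : τ.lang.Functions (τ.funs.get f)))
      (Fin.snoc x z : Fin (τ.funs.get f + 1) → V)).congr fun i v => ?_
    refine iff_of_eq (congrArg _ ?_)
    exact Fin.comp_snoc (n := τ.funs.get f) v x z
  have h1 := (ExDef.ex (hgraph (V := Fin (τ.funs.get f) ⊕ Unit) Sum.inl (Sum.inr ())).exDef).all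
  have h2 := (((hgraph (V := Fin (τ.funs.get f) ⊕ Bool) Sum.inl (Sum.inr true)).and
    (hgraph Sum.inl (Sum.inr false))).imp_exDef
      (qfDef_eq (Sum.inr true) (Sum.inr false)).exDef).all
  refine (h1.and h2).congr fun i => ?_
  constructor
  · rintro ⟨h1, h2⟩ v
    obtain ⟨z, hz⟩ := h1 v
    exact ⟨z (), hz, fun z' hz' => h2 (Sum.elim v fun b => if b then z' else z ()) ⟨hz', hz⟩⟩
  · intro h
    refine ⟨fun v => ?_, fun v hv => ?_⟩
    · obtain ⟨z, hz, -⟩ := h v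
      exact ⟨fun _ => z, hz⟩
    · exact (h fun j => v (Sum.inl j)).unique hv.1 hv.2

variable {X : Finset ℕ}

/-- The graph of a term is existentially definable. -/
theorem exDef_val (t : τ.lang.Term ℕ) (ht : t.varFinset ⊆ X) {V : Type} (g : {x // x ∈ X} → V)
    (z : V) : ExDef (fun i : FunModel τ s => i.Dom) (graphLang τ s) fun i v =>
      Assignment.val (A := i.Dom) (X := X) (fun x => v (g x)) t = v z := by
  induction t generalizing V with
  | var x =>
    have hx : x ∈ X := ht (by simp)
    refine (qfDef_eq (g ⟨x, hx⟩) z).exDef.congr fun i v => ?_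
    rw [Assignment.val, Language.Term.realize_var, dif_pos hx]
  | @func n f ts ih =>
    have hts : ∀ j, (ts j).varFinset ⊆ X := fun j =>
      (Finset.subset_biUnion_of_mem (fun j => (ts j).varFinset) (Finset.mem_univ j)).trans ht
    -- A nested term is flattened: new existential variables name the values of the arguments, and
    -- the graph of `f` links them to the value of the term.
    have h1 := exDef_forall fun j => ih j (hts j) (V := V ⊕ Fin n) (fun x => Sum.inl (g x))
      (Sum.inr j)
    have h2 := qfDef_str (fun i : FunModel τ s => i.toRelModel) (Vocab.graphRel f)
      (Fin.snoc Sum.inr (Sum.inl z) : Fin (n + 1) → V ⊕ Fin n)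
    refine (h1.and h2.exDef).ex.congr fun i v => ?_
    have key : ∀ y : Fin n → i.Dom, i.str.RelMap (Vocab.graphRel f)
        (fun j => (Sum.elim v y : V ⊕ Fin n → i.Dom)
          ((Fin.snoc Sum.inr (Sum.inl z) : Fin (n + 1) → V ⊕ Fin n) j)) ↔
        i.funStr.funMap f y = v z := by
      intro y
      rw [i.represents.graph]
      simp only [Fin.snoc_castSucc, Fin.snoc_last, Sum.elim_inr, Sum.elim_inl]
    constructor
    · rintro ⟨y, h, h'⟩
      rw [← (key y).1 h']
      exact congrArg (i.funStr.funMap f) (funext h)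
    · intro h
      exact ⟨fun j => Assignment.val (A := i.Dom) (X := X) (fun x => v (g x)) (ts j),
        fun j => rfl, (key _).2 h⟩

/-- The team that corresponds to a relation. -/
def teamOf {A : Type} (e : Fin s ≃ {x // x ∈ X}) (S : Set (Fin s → A)) : Set (Assignment X A) :=
  {a | (fun j => a (e j)) ∈ S}

/-- The universal quantifiers range over an assignment, restricted to the team, and the existential
ones name the values of terms. As the terms are evaluated positively, negated literals stay
existential as well. A disjunction would require a choice of subteams, for which a single relation
`S` leaves no room. -/
theorem IncFormula.allExDef_sat (e : Fin s ≃ {x // x ∈ X}) (φ : IncFormula τ.lang)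
    (hq : φ.QuantifierFree) (hd : φ.DisjunctionFree) (hX : φ.freeVars ⊆ X) :
    AllExDef (fun i : FunModel τ s => i.Dom) (graphLang τ s)
      fun i => φ.Sat i.Dom X (teamOf e i.S) := by
  have hmem : ∀ {V : Type} (x : {x // x ∈ X} → V),
      QFDef (fun i : FunModel τ s => i.Dom) (graphLang τ s)
        fun i v => (fun y => v (x y)) ∈ teamOf (A := i.Dom) e i.S := fun x =>
    qfDef_mem (fun i : FunModel τ s => i.toRelModel) fun j => x (e j)
  have hts : ∀ {n : ℕ} {ts : Fin n → τ.lang.Term ℕ},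
      (Finset.univ.biUnion fun j => (ts j).varFinset) ⊆ X → ∀ j, (ts j).varFinset ⊆ X :=
    fun h j => (Finset.subset_biUnion_of_mem _ (Finset.mem_univ j)).trans h
  induction φ with
  | eq t u =>
    have hX := Finset.union_subset_iff.1 hX
    have h := ((exDef_val t hX.1 (V := {x // x ∈ X} ⊕ Unit) Sum.inl (Sum.inr ())).and
      (exDef_val u hX.2 (s := s) Sum.inl (Sum.inr ()))).ex
    refine (((hmem fun x => x).imp_exDef h).all).congr fun i => ?_
    refine forall₂_congr fun v _ => ?_
    constructor
    · rintro ⟨z, h1, h2⟩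
      exact h1.trans h2.symm
    · intro h
      exact ⟨fun _ => _, h, rfl⟩
  | neq t u =>
    have hX := Finset.union_subset_iff.1 hX
    have h := (((exDef_val t hX.1 (V := {x // x ∈ X} ⊕ Bool) Sum.inl (Sum.inr true)).and
      (exDef_val u hX.2 (s := s) Sum.inl (Sum.inr false))).and
        (qfDef_eq (Sum.inr true) (Sum.inr false)).not.exDef).ex
    refine (((hmem fun x => x).imp_exDef h).all).congr fun i => ?_
    refine forall₂_congr fun v _ => ?_
    constructor
    · rintro ⟨z, ⟨h1, h2⟩, h3⟩ h
      exact h3 (h1.symm.trans (h.trans h2))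
    · intro h
      exact ⟨fun b => if b then Assignment.val (A := i.Dom) (X := X) v t else
        Assignment.val (A := i.Dom) (X := X) v u, ⟨rfl, rfl⟩, h⟩
  | @rel n R ts =>
    have h := ((exDef_forall fun j => exDef_val (ts j) (hts hX j) (s := s)
      (V := {x // x ∈ X} ⊕ Fin n) Sum.inl (Sum.inr j)).and (qfDef_str
        (fun i : FunModel τ s => i.toRelModel) (Vocab.oldRel R) Sum.inr).exDef).ex
    refine (((hmem fun x => x).imp_exDef h).all).congr fun i => ?_
    refine forall₂_congr fun v _ => ?_
    constructor
    · rintro ⟨z, h1, h2⟩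
      have h2 := (i.represents.rel R _).1 h2
      rw [← funext h1] at h2
      exact h2
    · intro h
      exact ⟨_, fun j => rfl, (i.represents.rel R _).2 h⟩
  | @nrel n R ts =>
    have h := ((exDef_forall fun j => exDef_val (ts j) (hts hX j) (s := s)
      (V := {x // x ∈ X} ⊕ Fin n) Sum.inl (Sum.inr j)).and (qfDef_str
        (fun i : FunModel τ s => i.toRelModel) (Vocab.oldRel R) Sum.inr).not.exDef).ex
    refine (((hmem fun x => x).imp_exDef h).all).congr fun i => ?_
    refine forall₂_congr fun v _ => ?_
    constructor
    · rintro ⟨z, h1, h2⟩ h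
      refine h2 ((i.represents.rel R _).2 ?_)
      have h1 := funext h1
      change _ = fun j => z j at h1
      change i.funStr.RelMap R fun j => z j
      rw [← h1]
      exact h
    · intro h
      exact ⟨_, fun j => rfl, fun h' => h ((i.represents.rel R _).1 h')⟩
  | @inc n ts us =>
    have hX := Finset.union_subset_iff.1 hX
    -- The existential variables are the second assignment and the common values of both tuples of
    -- terms.
    have h := ((exDef_forall fun j => exDef_val (ts j) (hts hX.1 j) (s := s)
      (V := {x // x ∈ X} ⊕ ({x // x ∈ X} ⊕ Fin n)) Sum.inl (Sum.inr (Sum.inr j))).and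
      ((exDef_forall fun j => exDef_val (us j) (hts hX.2 j) (s := s)
        (V := {x // x ∈ X} ⊕ ({x // x ∈ X} ⊕ Fin n)) (fun x => Sum.inr (Sum.inl x))
          (Sum.inr (Sum.inr j))).and (hmem fun x => Sum.inr (Sum.inl x)).exDef)).ex
    refine (((hmem fun x => x).imp_exDef h).all).congr fun i => ?_
    refine forall₂_congr fun v _ => ?_
    constructor
    · rintro ⟨z, h1, h2, h3⟩
      exact ⟨_, h3, fun j => (h1 j).trans (h2 j).symm⟩
    · rintro ⟨v', h3, h⟩
      exact ⟨Sum.elim v' fun j => Assignment.val (A := i.Dom) (X := X) v (ts j), fun j => rfl,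
        fun j => (h j).symm, h3⟩
  | and φ ψ hφ hψ =>
    have hX := Finset.union_subset_iff.1 hX
    exact (hφ hq.1 hd.1 hX.1).and (hψ hq.2 hd.2 hX.2)
  | or φ ψ => exact hd.elim
  | ex x φ => exact hq.elim
  | all x φ => exact hq.elim

end Definability

-- From structures with functions back to arbitrary relational structures.

/-- The defining formula makes sense in all structures of the larger family, and `Q'` is whatever it
happens to define there. This is needed because a candidate input may interpret the graph symbols by
relations that are not functional. -/
theorem AllExDef.exists_extend {L : FirstOrder.Language.{0, 0}} {I J : Type} (f : I → J)
    {M : J → Type} [∀ j, L.Structure (M j)] {Q : I → Prop}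
    (h : AllExDef (fun i => M (f i)) L Q) :
    ∃ Q' : J → Prop, AllExDef M L Q' ∧ ∀ i, Q' (f i) ↔ Q i := by
  obtain ⟨X, hX, R, ⟨Y, hY, S, ⟨q, hq, hqS⟩, hRS⟩, hQR⟩ := h
  refine ⟨_, ExDef.all (M := M) (V := X) ⟨Y, hY, _, ⟨q, hq, fun _ _ => Iff.rfl⟩,
    fun _ _ => Iff.rfl⟩, fun i => ?_⟩
  rw [hQR]
  simp only [hRS, ← hqS]

theorem encard_teamOf {A : Type} {s : ℕ} {X : Finset ℕ} (e : Fin s ≃ {x // x ∈ X})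
    (S : Set (Fin s → A)) : (teamOf e S).encard = S.encard := by
  have h : teamOf e S = (e.arrowCongr (Equiv.refl A)) '' S := by
    rw [Equiv.image_eq_preimage_symm]
    rfl
  rw [h, (Equiv.injective _).encard_image]

theorem exists_teamOf_eq {A : Type} {s : ℕ} {X : Finset ℕ} (e : Fin s ≃ {x // x ∈ X})
    (T : Set (Assignment X A)) : ∃ S : Set (Fin s → A), teamOf e S = T :=
  ⟨{v | (fun x => v (e.symm x)) ∈ T}, by
    ext a
    simp [teamOf]⟩

/-- The weighted team problem for a quantifier-free formula of inclusion logic without disjunctions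
is in `W[2]`. -/
theorem inW_pWT {τ : Vocab} (φ : IncFormula τ.lang) (hq : φ.QuantifierFree)
    (hd : φ.DisjunctionFree) : InW 2 (pWT φ) := by
  let e := φ.freeVars.equivFin.symm
  obtain ⟨Q, hQ, hQsat⟩ := AllExDef.exists_extend (M := fun i : RelModel τ _ => i.Dom)
    FunModel.toRelModel (φ.allExDef_sat e hq hd subset_rfl)
  -- The sentence also demands functionality, so inputs that come from no structure with functions
  -- are rejected.
  obtain ⟨ψ, hψ, H⟩ := (allExDef_isFunctional.and hQ).exists_sentence
  -- The reduction is the identity, because a structure and its relational version have the same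
  -- encoding.
  refine ⟨τ.graphVocab, _, ψ, τ.isRelational_graphVocab, hψ, fun p => p, fptComputable_id,
    fun p => ⟨?_, ?_⟩, id, Computable.id, fun x k => le_rfl⟩
  · rintro ⟨⟨n, hn, sA⟩, hx, T, hT, hsat⟩
    obtain ⟨sR, hR⟩ := exists_encode_graphVocab hn sA
    obtain ⟨S, rfl⟩ := exists_teamOf_eq e T
    have hrep := represents_of_encode_eq hR
    rw [encard_teamOf] at hT
    refine ⟨⟨n, hn, sR⟩, hx.trans hR, S, hT, (H ⟨n, hn, sR, S⟩).2
      ⟨fun f v => ?_, (hQsat ⟨⟨n, hn, sR, S⟩, sA, hrep⟩).2 hsat⟩⟩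
    refine ⟨sA.funMap (⟨f, rfl⟩ : τ.lang.Functions (τ.funs.get f)) v, ?_, fun z hz => ?_⟩
    · refine (hrep.graph _ _).2 ?_
      simp only [Fin.snoc_castSucc, Fin.snoc_last]
    · have hz := (hrep.graph _ _).1 hz
      simp only [Fin.snoc_castSucc, Fin.snoc_last] at hz
      exact hz.symm
  · rintro ⟨⟨n, hn, sR⟩, hx, S, hS, hsol⟩
    obtain ⟨hfun, hQ'⟩ := (H ⟨n, hn, sR, S⟩).1 hsol
    obtain ⟨sA, hrep⟩ := exists_represents (sR := sR) fun f v => by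
      obtain ⟨f, rfl⟩ := f
      exact hfun f v
    exact ⟨⟨n, hn, sA⟩, hx.trans (hrep.encode_eq hn).symm, teamOf e S,
      (encard_teamOf e S).trans hS, (hQsat ⟨⟨n, hn, sR, S⟩, sA, hrep⟩).1 hQ'⟩

theorem mainTheorem10 :
    (∀ (τ : Vocab) (φ : IncFormula τ.lang), φ.QuantifierFree → φ.DisjunctionFree →
      InW 2 (pWT φ)) ∧
    (∃ (τ : Vocab) (φ : IncFormula τ.lang), φ.QuantifierFree ∧ φ.DisjunctionFree ∧
      WHard 1 (pWT φ)) :=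
  ⟨fun _ φ hq hd => inW_pWT φ hq hd, cliqueVocab, cliqueFormula, ⟨trivial, trivial, trivial⟩,
    ⟨trivial, trivial, trivial⟩, wHard_cliqueFormula⟩
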